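/- Let $E$ be a real Euclidean space of dimension $2n$ with inner product $B$, let $J$ be a compatible complex structure ($J$ orthogonal, $J^T=-J$), and let $\xi_1,\dots,\xi_n,\eta_1,\dots,\eta_n$ be an orthonormal basis of $E$ with $J\xi_j=-\eta_j$, $J\eta_j=\xi_j$, and dual basis $x_1,\dots,x_n,y_1,\dots,y_n$ of $E^*$. Let $G\subset \mathrm O(E)$ be a finite group generated by reflections, $\mathcal S$ its set of reflections, with $-1$-eigenvectors $\alpha_s\in E$, $a_s=B(\alpha_s,\cdot)\in E^*$, and let $c:\mathcal S\to\mathbb R$ be invariant under conjugation. The rational Cherednik algebra $H_c=H_c(G,E)$ is the quotient of $T(E_{\mathbb C}\oplus E_{\mathbb C}^*)\rtimes\mathbb C[G]$ by $[\xi,\eta]=0=[x,y]$ and $[\xi,x]=\langle x,\xi\rangle-2\sum_{s\in\mathcal S}\frac{\langle x,\alpha_s\rangle\langle a_s,\xi\rangle}{\langle a_s,\alpha_s\rangle}c(s)s$. Let $\tau$ be an irreducible complex representation of $G$ on $V(\tau)$. Let $M_c(\tau)$ be the $H_c$-module induced from $V(\tau)$, where $E$ acts on $V(\tau)$ by zero,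 let $M_c(\tau)_k$ be its subspace spanned by the products of $k$ elements of $E^*$ applied to $V(\tau)$, and let $N_c(\tau)$ be the scalar by which $\sigma=\sum_s c(s)s$ acts on $V(\tau)$. Let $\mathcal C$ be the complex Clifford algebra of $(E_{\mathbb C},B_{\mathbb C})$, with $v^2=B(v,v)$, let $e_j,e_{n+j}\in\mathcal C$ be the images of $\xi_j,\eta_j$, and put $f_j=\frac12(e_j-ie_{n+j})$, $f_j^\dagger=\frac12(e_j+ie_{n+j})$. Let $\mathbb S=\mathcal C I=(\bigwedge f^\dagger)I$ with $I=f_1f_1^\dagger\cdots f_nf_n^\dagger$ be the spinor space, $\mathbb S^l$ the span of the elements $f^\dagger_{j_1}\cdots f^\dagger_{j_l}I$, and $K_c(\tau)=M_c(\tau)\otimes\mathbb S$, a module over $H_c\otimes\mathcal C$. Put $z_j=x_j+iy_j$, $\bar z_j=x_j-iy_j$, $\zeta_j=\frac12(\xi_j-i\eta_j)$, $\bar\zeta_j=\frac12(\xi_j+i\eta_j)$ and $\pi^{\pm}=\frac12(1\pm iJ)$. The Lie superalgebra $\mathfrak u(2|1)$ (complexification $\mathfrak{gl}(2|1)$) is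 realised in $H_c\otimes\mathcal C$ with odd elements $$F_+=\sum_j\bar z_jf_j^\dagger,\quad \bar F_+=\sum_j z_jf_j,\quad F_-=2\sum_j\zeta_jf_j^\dagger,\quad \bar F_-=2\sum_j\bar\zeta_jf_j$$ and even elements $E_+=\frac12\sum_j z_j\bar z_j$, $E_-=-2\sum_j\zeta_j\bar\zeta_j$, $H=\sum_j(z_j\zeta_j+\bar z_j\bar\zeta_j)+n-\sigma$, $Z_2=\frac12\sum_j[f_j^\dagger,f_j]$ and $$Z_1=\sum_j(\bar z_j\bar\zeta_j-z_j\zeta_j)-\sum_{s}c(s)\,s\otimes\Big(1-\frac{2\,\pi^-(\alpha_s)\,\pi^+(\alpha_s)}{\langle a_s,\alpha_s\rangle}\Big).$$ Let $\mathcal R$ be the centraliser of these nine elements in $H_c\otimes\mathcal C$. Let $*$ be the conjugate-linear anti-involution of $H_c\otimes\mathcal C$ with $\xi^*=B(\xi,\cdot)$ for $\xi\in E$, $g^*=g^{-1}$ for $g\in G$, and $v^*=v$ for the image $v\in\mathcal C$ of a vector of $E$. Assume that $K_c(\tau)$ is unitarisable, i.e. that it has a positive definite Hermitian form with $(hp\,|\,q)=(p\,|\,h^*q)$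 for all $h\in H_c\otimes\mathcal C$. For $k\ge0$ and $0\le l\le n$ let $\mathcal H_c(\tau)_k=M_c(\tau)_k\cap\ker E_-$, let $\mathscr S_c(\tau)_k^l$ be the set of eigenvalues of $Z_1$ on $\mathcal H_c(\tau)_k\otimes\mathbb S^l$, and let $\mathcal M_c(\tau)_{k,\nu}^l$ be the subspace of the elements of $\mathcal H_c(\tau)_k\otimes\mathbb S^l$ on which $Z_1$ acts by $\nu$ and which are killed by $F_-$ and $\bar F_-$. Let $L_{\mathfrak u(2|1)}(\lambda,\nu,\gamma)$ be the irreducible lowest weight representation of $\mathfrak u(2|1)$, generated by a vector killed by $F_-,\bar F_-,E_-$ on which $(H,Z_1,Z_2)$ acts by $(\lambda,\nu,\gamma)$; that is, the quotient of the lowest weight Verma module by its largest proper submodule. Then each $\mathcal M_c(\tau)_{k,\nu}^l$ is $\mathcal R$-stable, and there is a joint $(\mathcal R,\mathfrak u(2|1))$-decomposition $$K_c(\tau)\cong\bigoplus_{l=0}^n\bigoplus_{k\ge0}\bigoplus_{\nu\in\mathscr S_c(\tau)_k^l}\mathcal M_c(\tau)_{k,\nu}^l\otimes L_{\mathfrak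 u(2|1)}\big(k+n-N_c(\tau),\nu,l-\tfrac n2\big),$$ that is, a linear isomorphism that intertwines the actions of $\mathfrak u(2|1)$ (on $K_c(\tau)$ and on the second factors) and of $\mathcal R$ (on $K_c(\tau)$ and on the first factors), and under which $m\in\mathcal M_c(\tau)_{k,\nu}^l$ corresponds to $m\otimes v_0$ with $v_0$ the lowest weight vector of the second factor; moreover the second factor is a simple module whenever $\mathcal M_c(\tau)_{k,\nu}^l\neq0$. -/

import Mathlib

open scoped TensorProduct DirectSum

noncomputable section

namespace SpinorHowe

/-! ### Reflection groups and the rational Cherednik algebra -/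

section Cherednik

variable {E : Type*} [NormedAddCommGroup E] [InnerProductSpace ℝ E]

/-- `s` is the orthogonal reflection in the hyperplane orthogonal to some nonzero vector. -/
def IsReflection (s : E ≃ₗᵢ[ℝ] E) : Prop :=
  ∃ α : E, α ≠ 0 ∧ s = (ℝ ∙ α)ᗮ.reflection

/-- A group of linear isometries generated by the reflections that it contains. -/
def IsReflectionGroup (G : Subgroup (E ≃ₗᵢ[ℝ] E)) : Prop :=
  Subgroup.closure {s : E ≃ₗᵢ[ℝ] E | s ∈ G ∧ IsReflection s} = G

/-- The set `𝒮` of reflections of `G`. -/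
abbrev Refl (G : Subgroup (E ≃ₗᵢ[ℝ] E)) : Type _ :=
  {s : G // IsReflection (s : E ≃ₗᵢ[ℝ] E)}

instance (G : Subgroup (E ≃ₗᵢ[ℝ] E)) [Finite G] : Fintype (Refl G) := Fintype.ofFinite _

/-- A fixed `-1` eigenvector `α_s ∈ E` of the reflection `s`. -/
def root {G : Subgroup (E ≃ₗᵢ[ℝ] E)} (s : Refl G) : E := s.2.choose

/-- A fixed `-1` eigenvector `a_s ∈ E*` of the reflection `s`. Rescaling `α_s` or `a_s` changes none
of the expressions below. -/
def coroot {G : Subgroup (E ≃ₗᵢ[ℝ] E)} (s : Refl G) : Module.Dual ℝ E := innerₗ E (root s)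

/-- The contragredient action of a linear isometry on `E*`. -/
def dualAct (g : E ≃ₗᵢ[ℝ] E) (x : Module.Dual ℝ E) : Module.Dual ℝ E :=
  x ∘ₗ (g⁻¹ : E ≃ₗᵢ[ℝ] E).toLinearEquiv.toLinearMap

/-- Generators of the rational Cherednik algebra: elements of `E`, of `E*`, and of `G`. -/
inductive CherGen (G : Subgroup (E ≃ₗᵢ[ℝ] E)) : Type _
  | vec (ξ : E) : CherGen G
  | cov (x : Module.Dual ℝ E) : CherGen G
  | grp (g : G) : CherGen G

/-- The generators inside the free complex algebra on them. -/
abbrev gen₀ {G : Subgroup (E ≃ₗᵢ[ℝ] E)} (a : CherGen G) : FreeAlgebra ℂ (CherGen G) :=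
  FreeAlgebra.ι ℂ a

open CherGen in
/-- Defining relations of the rational Cherednik algebra. The first block presents
`T(E_ℂ ⊕ E*_ℂ) ⋊ ℂ[G]`; the last three relations are those by which one divides. -/
inductive CherRel (G : Subgroup (E ≃ₗᵢ[ℝ] E)) [Finite G] (c : Refl G → ℝ) :
    FreeAlgebra ℂ (CherGen G) → FreeAlgebra ℂ (CherGen G) → Prop
  | vec_add (ξ η : E) : CherRel G c (gen₀ (vec (ξ + η))) (gen₀ (vec ξ) + gen₀ (vec η))
  | vec_smul (r : ℝ) (ξ : E) : CherRel G c (gen₀ (vec (r • ξ))) ((r : ℂ) • gen₀ (vec ξ))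
  | cov_add (x y : Module.Dual ℝ E) :
      CherRel G c (gen₀ (cov (x + y))) (gen₀ (cov x) + gen₀ (cov y))
  | cov_smul (r : ℝ) (x : Module.Dual ℝ E) :
      CherRel G c (gen₀ (cov (r • x))) ((r : ℂ) • gen₀ (cov x))
  | grp_one : CherRel G c (gen₀ (grp 1)) 1
  | grp_mul (g h : G) : CherRel G c (gen₀ (grp (g * h))) (gen₀ (grp g) * gen₀ (grp h))
  | grp_vec (g : G) (ξ : E) :
      CherRel G c (gen₀ (grp g) * gen₀ (vec ξ))
        (gen₀ (vec ((g : E ≃ₗᵢ[ℝ] E) ξ)) * gen₀ (grp g))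
  | grp_cov (g : G) (x : Module.Dual ℝ E) :
      CherRel G c (gen₀ (grp g) * gen₀ (cov x))
        (gen₀ (cov (dualAct (g : E ≃ₗᵢ[ℝ] E) x)) * gen₀ (grp g))
  | vec_comm (ξ η : E) :
      CherRel G c (gen₀ (vec ξ) * gen₀ (vec η)) (gen₀ (vec η) * gen₀ (vec ξ))
  | cov_comm (x y : Module.Dual ℝ E) :
      CherRel G c (gen₀ (cov x) * gen₀ (cov y)) (gen₀ (cov y) * gen₀ (cov x))
  | vec_cov (ξ : E) (x : Module.Dual ℝ E) :
      CherRel G c (gen₀ (vec ξ) * gen₀ (cov x) - gen₀ (cov x) * gen₀ (vec ξ))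
        (algebraMap ℂ _ (x ξ : ℂ) - (2 : ℂ) • ∑ s : Refl G,
          ((x (root s) * coroot s ξ / coroot s (root s) * c s : ℝ) : ℂ) • gen₀ (grp s.1))

/-- The rational Cherednik algebra `H_c(G, E)` (at `t = 1`). -/
def Cherednik (G : Subgroup (E ≃ₗᵢ[ℝ] E)) [Finite G] (c : Refl G → ℝ) : Type _ :=
  RingQuot (CherRel G c)

instance (G : Subgroup (E ≃ₗᵢ[ℝ] E)) [Finite G] (c : Refl G → ℝ) : Ring (Cherednik G c) :=
  inferInstanceAs (Ring (RingQuot (CherRel G c)))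

instance (G : Subgroup (E ≃ₗᵢ[ℝ] E)) [Finite G] (c : Refl G → ℝ) : Algebra ℂ (Cherednik G c) :=
  inferInstanceAs (Algebra ℂ (RingQuot (CherRel G c)))

variable (G : Subgroup (E ≃ₗᵢ[ℝ] E)) [Finite G] (c : Refl G → ℝ)

/-- The quotient map from the free algebra. -/
def cherMk : FreeAlgebra ℂ (CherGen G) →ₐ[ℂ] Cherednik G c := RingQuot.mkAlgHom ℂ (CherRel G c)

/-- The element of `H_c(G, E)` given by `ξ ∈ E`. -/
def hVec (ξ : E) : Cherednik G c := cherMk G c (gen₀ (.vec ξ))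

/-- The element of `H_c(G, E)` given by `x ∈ E*`. -/
def hCov (x : Module.Dual ℝ E) : Cherednik G c :=
  cherMk G c (gen₀ (.cov x))

/-- The element of `H_c(G, E)` given by `g ∈ G`. -/
def hGrp (g : G) : Cherednik G c := cherMk G c (gen₀ (.grp g))

/-! ### Standard modules -/

variable {V : Type*} [AddCommGroup V] [Module ℂ V] (τ : Representation ℂ G V)

/-- The relations `h g ⊗ v = h ⊗ τ(g) v` and `h ξ ⊗ v = 0` (`g ∈ G`, `ξ ∈ E`), as an
`H_c(G, E)`-submodule of `H_c(G, E) ⊗ V`. -/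
def standardRel : Submodule (Cherednik G c) (Cherednik G c ⊗[ℂ] V) :=
  Submodule.span (Cherednik G c)
    ({m | ∃ (g : G) (v : V), m = hGrp G c g ⊗ₜ[ℂ] v - 1 ⊗ₜ[ℂ] τ g v} ∪
      {m | ∃ (ξ : E) (v : V), m = hVec G c ξ ⊗ₜ[ℂ] v})

/-- The standard module `M_c(τ)`: the `H_c(G, E)`-module induced from `V(τ)`, on which `G` acts
by `τ` and `E` acts by zero. -/
def Standard : Type _ := (Cherednik G c ⊗[ℂ] V) ⧸ standardRel G c τ

instance : AddCommGroup (Standard G c τ) :=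
  inferInstanceAs (AddCommGroup ((Cherednik G c ⊗[ℂ] V) ⧸ standardRel G c τ))

instance : Module (Cherednik G c) (Standard G c τ) :=
  inferInstanceAs (Module (Cherednik G c) ((Cherednik G c ⊗[ℂ] V) ⧸ standardRel G c τ))

instance : Module ℂ (Standard G c τ) :=
  inferInstanceAs (Module ℂ ((Cherednik G c ⊗[ℂ] V) ⧸ standardRel G c τ))

instance : IsScalarTower ℂ (Cherednik G c) (Standard G c τ) :=
  inferInstanceAs (IsScalarTower ℂ (Cherednik G c) ((Cherednik G c ⊗[ℂ] V) ⧸ standardRel G c τ))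

/-- The quotient map `H_c(G, E) ⊗ V(τ) → M_c(τ)`. -/
def standardMk : (Cherednik G c ⊗[ℂ] V) →ₗ[Cherednik G c] Standard G c τ :=
  (standardRel G c τ).mkQ

/-- The canonical map `V(τ) → M_c(τ)`. -/
def standardι (v : V) : Standard G c τ := standardMk G c τ (1 ⊗ₜ[ℂ] v)

/-- The degree `k` part of `M_c(τ)`: homogeneous polynomials of degree `k` applied to `V(τ)`. -/
def standardDeg (k : ℕ) : Submodule ℂ (Standard G c τ) :=
  Submodule.span ℂ {m | ∃ (x : Fin k → Module.Dual ℝ E) (v : V),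
    m = (List.ofFn fun i => hCov G c (x i)).prod • standardι G c τ v}

/-- `N_c(τ)`: the scalar by which `σ = ∑ c(s) s` acts on `V(τ)`. -/
def scalarN : ℂ :=
  Classical.epsilon fun N : ℂ => ∀ v : V, ∑ s : Refl G, (c s : ℂ) • τ s.1 v = N • v

end Cherednik

/-! ### The Clifford algebra and spinors -/

section Clifford

variable {E : Type*} [NormedAddCommGroup E] [InnerProductSpace ℝ E]

/-- The complex-bilinear extension of `B` to `E_ℂ`, as a quadratic form. -/
def quadC (E : Type*) [NormedAddCommGroup E] [InnerProductSpace ℝ E] :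
    QuadraticForm ℂ (ℂ ⊗[ℝ] E) :=
  QuadraticForm.baseChange ℂ (LinearMap.BilinMap.toQuadraticMap (innerₗ E))

/-- The complex Clifford algebra `𝒞` of `(E_ℂ, B_ℂ)`. -/
abbrev Cl (E : Type*) [NormedAddCommGroup E] [InnerProductSpace ℝ E] : Type _ :=
  CliffordAlgebra (quadC E)

/-- The element of the Clifford algebra given by a vector of `E`. -/
def cl (v : E) : Cl E := CliffordAlgebra.ι (quadC E) (1 ⊗ₜ[ℝ] v)

/-- The projection `π⁺ = (1 + i J) / 2`, with values in the Clifford algebra. -/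
def projPlus (J : E →ₗ[ℝ] E) (v : E) : Cl E := (1 / 2 : ℂ) • (cl v + Complex.I • cl (J v))

/-- The projection `π⁻ = (1 - i J) / 2`, with values in the Clifford algebra. -/
def projMinus (J : E →ₗ[ℝ] E) (v : E) : Cl E := (1 / 2 : ℂ) • (cl v - Complex.I • cl (J v))

variable {n : ℕ} (b : OrthonormalBasis (Fin n ⊕ Fin n) ℝ E)

/-- `f_j = (e_j - i e_{n+j}) / 2`. -/
def f (j : Fin n) : Cl E := (1 / 2 : ℂ) • (cl (b (.inl j)) - Complex.I • cl (b (.inr j)))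

/-- `f_j† = (e_j + i e_{n+j}) / 2`. -/
def fd (j : Fin n) : Cl E := (1 / 2 : ℂ) • (cl (b (.inl j)) + Complex.I • cl (b (.inr j)))

/-- `I = (f_1 f_1†) ⋯ (f_n f_n†)`. -/
def spinVac : Cl E := (List.ofFn fun j => f b j * fd b j).prod

/-- The spinor space `𝕊 = (⋀ f†) I` inside `𝒞`: the left ideal of `𝒞` generated by `I`. -/
def spinorIdeal : Submodule (Cl E) (Cl E) := Submodule.span (Cl E) {spinVac b}

/-- The spinor space `𝕊` as a module over the Clifford algebra. -/
def Spinor : Type _ := spinorIdeal b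

instance : AddCommGroup (Spinor b) := inferInstanceAs (AddCommGroup (spinorIdeal b))

instance : Module (Cl E) (Spinor b) := inferInstanceAs (Module (Cl E) (spinorIdeal b))

instance : Module ℂ (Spinor b) := inferInstanceAs (Module ℂ (spinorIdeal b))

instance : IsScalarTower ℂ (Cl E) (Spinor b) :=
  inferInstanceAs (IsScalarTower ℂ (Cl E) (spinorIdeal b))

/-- The element `I` of `𝕊`. -/
def spinI : Spinor b := (⟨spinVac b, Submodule.mem_span_singleton_self _⟩ : spinorIdeal b)

/-- The spinors of degree `l`. -/
def spinorDeg (l : ℕ) : Submodule ℂ (Spinor b) :=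
  Submodule.span ℂ {p | ∃ j : Fin l → Fin n,
    p = (List.ofFn fun i => fd b (j i)).prod • spinI b}

end Clifford

/-! ### The Lie superalgebra `u(2|1)` -/

/-- The basis of `gl(2|1)`, the complexification of `u(2|1)`: the odd elements `F₊, F̄₊, F₋, F̄₋` and
the even elements `E₊, E₋, H, Z₁, Z₂`. (In `3 × 3` supermatrices with odd last coordinate, one may
take `E₊ = e₁₂`, `E₋ = e₂₁`, `H = e₁₁ - e₂₂`, `Z₁ = e₁₁ + e₂₂`, `Z₂ = - e₃₃`,
`F₊ = e₁₃`, `F̄₊ = 2 e₃₂`, `F₋ = - e₂₃`, `F̄₋ = 2 e₃₁`.) -/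
inductive UGen : Type
  | Fp | Fbp | Fm | Fbm | Ep | Em | H | Z1 | Z2

/-- The generators inside the free complex algebra on them. -/
abbrev ug (x : UGen) : FreeAlgebra ℂ UGen := FreeAlgebra.ι ℂ x

/-- Commutator. -/
abbrev superComm {A : Type*} [Ring A] (x y : A) : A := x * y - y * x

/-- Anticommutator. -/
abbrev superAnti {A : Type*} [Ring A] (x y : A) : A := x * y + y * x

/-- `Z = 2 Z₂ - Z₁`. -/
abbrev ugZ : FreeAlgebra ℂ UGen := 2 * ug .Z2 - ug .Z1

open UGen in
/-- All the superbrackets of the basis elements of `gl(2|1)`. -/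
inductive URel : FreeAlgebra ℂ UGen → FreeAlgebra ℂ UGen → Prop
  | EpEm : URel (superComm (ug Ep) (ug Em)) (ug H)
  | HEp : URel (superComm (ug H) (ug Ep)) (2 * ug Ep)
  | HEm : URel (superComm (ug H) (ug Em)) (-(2 * ug Em))
  | Z1Ep : URel (superComm (ug Z1) (ug Ep)) 0
  | Z1Em : URel (superComm (ug Z1) (ug Em)) 0
  | Z1H : URel (superComm (ug Z1) (ug H)) 0
  | Z2Ep : URel (superComm (ug Z2) (ug Ep)) 0
  | Z2Em : URel (superComm (ug Z2) (ug Em)) 0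
  | Z2H : URel (superComm (ug Z2) (ug H)) 0
  | Z1Z2 : URel (superComm (ug Z1) (ug Z2)) 0
  | FpFp : URel (superAnti (ug Fp) (ug Fp)) 0
  | FmFm : URel (superAnti (ug Fm) (ug Fm)) 0
  | FbpFbp : URel (superAnti (ug Fbp) (ug Fbp)) 0
  | FbmFbm : URel (superAnti (ug Fbm) (ug Fbm)) 0
  | FpFm : URel (superAnti (ug Fp) (ug Fm)) 0
  | FbpFbm : URel (superAnti (ug Fbp) (ug Fbm)) 0
  | FpFbp : URel (superAnti (ug Fp) (ug Fbp)) (2 * ug Ep)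
  | FmFbm : URel (superAnti (ug Fm) (ug Fbm)) (-(2 * ug Em))
  | FpFbm : URel (superAnti (ug Fp) (ug Fbm)) (ug H - ugZ)
  | FmFbp : URel (superAnti (ug Fm) (ug Fbp)) (ug H + ugZ)
  | EpFp : URel (superComm (ug Ep) (ug Fp)) 0
  | EpFbp : URel (superComm (ug Ep) (ug Fbp)) 0
  | EpFm : URel (superComm (ug Ep) (ug Fm)) (-ug Fp)
  | EpFbm : URel (superComm (ug Ep) (ug Fbm)) (-ug Fbp)
  | EmFp : URel (superComm (ug Em) (ug Fp)) (-ug Fm)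
  | EmFbp : URel (superComm (ug Em) (ug Fbp)) (-ug Fbm)
  | EmFm : URel (superComm (ug Em) (ug Fm)) 0
  | EmFbm : URel (superComm (ug Em) (ug Fbm)) 0
  | HFp : URel (superComm (ug H) (ug Fp)) (ug Fp)
  | HFbp : URel (superComm (ug H) (ug Fbp)) (ug Fbp)
  | HFm : URel (superComm (ug H) (ug Fm)) (-ug Fm)
  | HFbm : URel (superComm (ug H) (ug Fbm)) (-ug Fbm)
  | Z1Fp : URel (superComm (ug Z1) (ug Fp)) (ug Fp)
  | Z1Fbp : URel (superComm (ug Z1) (ug Fbp)) (-ug Fbp)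
  | Z1Fm : URel (superComm (ug Z1) (ug Fm)) (ug Fm)
  | Z1Fbm : URel (superComm (ug Z1) (ug Fbm)) (-ug Fbm)
  | Z2Fp : URel (superComm (ug Z2) (ug Fp)) (ug Fp)
  | Z2Fbp : URel (superComm (ug Z2) (ug Fbp)) (-ug Fbp)
  | Z2Fm : URel (superComm (ug Z2) (ug Fm)) (ug Fm)
  | Z2Fbm : URel (superComm (ug Z2) (ug Fbm)) (-ug Fbm)

/-- The universal enveloping superalgebra of `gl(2|1)`. Its modules are the complex representations
of `u(2|1)`. -/
def U21 : Type := RingQuot URel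

instance : Ring U21 := inferInstanceAs (Ring (RingQuot URel))

instance : Algebra ℂ U21 := inferInstanceAs (Algebra ℂ (RingQuot URel))

/-- The quotient map from the free algebra. -/
def u21Mk : FreeAlgebra ℂ UGen →ₐ[ℂ] U21 := RingQuot.mkAlgHom ℂ URel

/-- The basis elements inside the enveloping algebra. -/
def uι (x : UGen) : U21 := u21Mk (ug x)

/-- The left ideal of the Verma module: it is generated by the lowering operators and by
`H - lam`, `Z₁ - ν`, `Z₂ - γ`. -/
def vermaIdeal (lam ν γ : ℂ) : Submodule U21 U21 :=
  Submodule.span U21 {uι .Fm, uι .Fbm, uι .Em, uι .H - algebraMap ℂ U21 lam,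
    uι .Z1 - algebraMap ℂ U21 ν, uι .Z2 - algebraMap ℂ U21 γ}

/-- The lowest weight Verma module of `(H, Z₁, Z₂)`-weight `(lam, ν, γ)`. -/
def Verma (lam ν γ : ℂ) : Type := U21 ⧸ vermaIdeal lam ν γ

instance (lam ν γ : ℂ) : AddCommGroup (Verma lam ν γ) :=
  inferInstanceAs (AddCommGroup (U21 ⧸ vermaIdeal lam ν γ))

instance (lam ν γ : ℂ) : Module U21 (Verma lam ν γ) :=
  inferInstanceAs (Module U21 (U21 ⧸ vermaIdeal lam ν γ))

instance (lam ν γ : ℂ) : Module ℂ (Verma lam ν γ) :=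
  inferInstanceAs (Module ℂ (U21 ⧸ vermaIdeal lam ν γ))

instance (lam ν γ : ℂ) : IsScalarTower ℂ U21 (Verma lam ν γ) :=
  inferInstanceAs (IsScalarTower ℂ U21 (U21 ⧸ vermaIdeal lam ν γ))

/-- The lowest weight vector of the Verma module. -/
def vermaVec (lam ν γ : ℂ) : Verma lam ν γ := (vermaIdeal lam ν γ).mkQ 1

/-- The largest proper submodule of the Verma module: the sum of all the submodules that do not
contain the lowest weight vector. -/
def vermaMax (lam ν γ : ℂ) : Submodule U21 (Verma lam ν γ) :=
  sSup {N | vermaVec lam ν γ ∉ N}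

/-- `L(lam, ν, γ)`: the irreducible lowest weight representation of `u(2|1)` of
`(H, Z₁, Z₂)` lowest weight `(lam, ν, γ)`. -/
def LowestWeight (lam ν γ : ℂ) : Type := Verma lam ν γ ⧸ vermaMax lam ν γ

instance (lam ν γ : ℂ) : AddCommGroup (LowestWeight lam ν γ) :=
  inferInstanceAs (AddCommGroup (Verma lam ν γ ⧸ vermaMax lam ν γ))

instance (lam ν γ : ℂ) : Module U21 (LowestWeight lam ν γ) :=
  inferInstanceAs (Module U21 (Verma lam ν γ ⧸ vermaMax lam ν γ))

instance (lam ν γ : ℂ) : Module ℂ (LowestWeight lam ν γ) :=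
  inferInstanceAs (Module ℂ (Verma lam ν γ ⧸ vermaMax lam ν γ))

instance (lam ν γ : ℂ) : IsScalarTower ℂ U21 (LowestWeight lam ν γ) :=
  inferInstanceAs (IsScalarTower ℂ U21 (Verma lam ν γ ⧸ vermaMax lam ν γ))

/-- The lowest weight vector of `L(lam, ν, γ)`. -/
def lowestVec (lam ν γ : ℂ) : LowestWeight lam ν γ :=
  (vermaMax lam ν γ).mkQ (vermaVec lam ν γ)

/-! ### The realisation of `u(2|1)` and the decomposition of polynomial spinors -/

section Realisation

variable {E : Type*} [NormedAddCommGroup E] [InnerProductSpace ℝ E]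
  (G : Subgroup (E ≃ₗᵢ[ℝ] E)) [Finite G] (c : Refl G → ℝ)

/-- The algebra `H_c(G, E) ⊗ 𝒞`. -/
abbrev HC : Type _ := Cherednik G c ⊗[ℂ] Cl E

variable {n : ℕ} (J : E →ₗ[ℝ] E) (b : OrthonormalBasis (Fin n ⊕ Fin n) ℝ E)

/-- `z_j = x_j + i y_j`. -/
def z (j : Fin n) : Cherednik G c :=
  hCov G c (b.toBasis.coord (.inl j)) + Complex.I • hCov G c (b.toBasis.coord (.inr j))

/-- `z̄_j = x_j - i y_j`. -/
def zb (j : Fin n) : Cherednik G c :=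
  hCov G c (b.toBasis.coord (.inl j)) - Complex.I • hCov G c (b.toBasis.coord (.inr j))

/-- `ζ_j = (ξ_j - i η_j) / 2`. -/
def zeta (j : Fin n) : Cherednik G c :=
  (1 / 2 : ℂ) • (hVec G c (b (.inl j)) - Complex.I • hVec G c (b (.inr j)))

/-- `ζ̄_j = (ξ_j + i η_j) / 2`. -/
def zetab (j : Fin n) : Cherednik G c :=
  (1 / 2 : ℂ) • (hVec G c (b (.inl j)) + Complex.I • hVec G c (b (.inr j)))

/-- `E₊ = ½ ∑ z_j z̄_j`. -/
def opEp : Cherednik G c := (1 / 2 : ℂ) • ∑ j, z G c b j * zb G c b j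

/-- `E₋ = -2 ∑ ζ_j ζ̄_j`. -/
def opEm : Cherednik G c := -((2 : ℂ) • ∑ j, zeta G c b j * zetab G c b j)

/-- `σ = ∑ c(s) s`. -/
def sigma : Cherednik G c := ∑ s : Refl G, (c s : ℂ) • hGrp G c s.1

/-- `H = ∑ (z_j ζ_j + z̄_j ζ̄_j) + n - σ`. -/
def opH : Cherednik G c :=
  ∑ j, (z G c b j * zeta G c b j + zb G c b j * zetab G c b j)
    + algebraMap ℂ (Cherednik G c) (n : ℂ) - sigma G c

/-- `Z₀ = ∑ (z̄_j ζ̄_j - z_j ζ_j)`. -/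
def opZ0 : Cherednik G c := ∑ j, (zb G c b j * zetab G c b j - z G c b j * zeta G c b j)

/-- `τ_s = 1 - 2 α_s† π⁺(a_s) / ⟨a_s, α_s⟩`; as `a_s` is the image of `α_s` under `E ≅ E*`, it is
identified with `α_s` inside `E`. -/
def tauS {G : Subgroup (E ≃ₗᵢ[ℝ] E)} (J : E →ₗ[ℝ] E) (s : Refl G) : Cl E :=
  1 - ((2 / coroot s (root s) : ℝ) : ℂ) • (projMinus J (root s) * projPlus J (root s))

/-- `Ω_c = ∑ c(s) s ⊗ τ_s`. -/
def Omega : HC G c := ∑ s : Refl G, (c s : ℂ) • (hGrp G c s.1 ⊗ₜ[ℂ] tauS J s)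

/-- The realisation of the basis of `gl(2|1)` in `H_c(G, E) ⊗ 𝒞`. -/
def realise : UGen → HC G c
  | .Fp => ∑ j, zb G c b j ⊗ₜ[ℂ] fd b j
  | .Fbp => ∑ j, z G c b j ⊗ₜ[ℂ] f b j
  | .Fm => (2 : ℂ) • ∑ j, zeta G c b j ⊗ₜ[ℂ] fd b j
  | .Fbm => (2 : ℂ) • ∑ j, zetab G c b j ⊗ₜ[ℂ] f b j
  | .Ep => opEp G c b ⊗ₜ[ℂ] 1
  | .Em => opEm G c b ⊗ₜ[ℂ] 1
  | .H => opH G c b ⊗ₜ[ℂ] 1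
  | .Z1 => opZ0 G c b ⊗ₜ[ℂ] 1 - Omega G c J
  | .Z2 => 1 ⊗ₜ[ℂ] ((1 / 2 : ℂ) • ∑ j, (fd b j * f b j - f b j * fd b j))

/-- `ℛ`: the centraliser algebra of `u(2|1)` in `H_c(G, E) ⊗ 𝒞`. -/
def centR : Subalgebra ℂ (HC G c) := Subalgebra.centralizer ℂ (Set.range (realise G c J b))

variable {V : Type*} [AddCommGroup V] [Module ℂ V] (τ : Representation ℂ G V)

/-- `K_c(τ) = M_c(τ) ⊗ 𝕊`. -/
abbrev SpinModule : Type _ := Standard G c τ ⊗[ℂ] Spinor b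

/-- The action of `H_c(G, E) ⊗ 𝒞` on `K_c(τ)`. -/
def act : HC G c →ₐ[ℂ] Module.End ℂ (SpinModule G c b τ) :=
  Module.endTensorEndAlgHom.comp
    (Algebra.TensorProduct.map (Algebra.lsmul ℂ ℂ (Standard G c τ)) (Algebra.lsmul ℂ ℂ (Spinor b)))

/-- `K_c(τ)` is `∗`-unitarisable: there is a positive definite Hermitian form with
`(h p | q) = (p | h* q)` for all `h`. The conjugate-linear anti-involution `∗` of
`H_c(G, E) ⊗ 𝒞` is determined by `ξ* = B(ξ, ·)` and `e* = e` for vectors `ξ` and Clifford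
generators `e` from the real space `E`, and `g* = g⁻¹`, so the condition is stated on these
generators. -/
def IsUnitarisable : Prop :=
  ∃ form : InnerProductSpace.Core ℂ (SpinModule G c b τ),
    (∀ (ξ : E) (p q : SpinModule G c b τ),
      form.inner (act G c b τ (hVec G c ξ ⊗ₜ[ℂ] 1) p) q =
        form.inner p (act G c b τ (hCov G c (innerₗ E ξ) ⊗ₜ[ℂ] 1) q)) ∧
    (∀ (g : G) (p q : SpinModule G c b τ),
      form.inner (act G c b τ (hGrp G c g ⊗ₜ[ℂ] 1) p) q =
        form.inner p (act G c b τ (hGrp G c g⁻¹ ⊗ₜ[ℂ] 1) q)) ∧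
    (∀ (v : E) (p q : SpinModule G c b τ),
      form.inner (act G c b τ (1 ⊗ₜ[ℂ] cl v) p) q =
        form.inner p (act G c b τ (1 ⊗ₜ[ℂ] cl v) q))

/-- `ℋ_c(τ)_k`: the kernel of `E₋` in the degree `k` part of `M_c(τ)`. -/
def harm (k : ℕ) : Submodule ℂ (Standard G c τ) :=
  standardDeg G c τ k ⊓ LinearMap.ker (Algebra.lsmul ℂ ℂ (Standard G c τ) (opEm G c b))

/-- `ℋ_c(τ)_k^l = ℋ_c(τ)_k ⊗ 𝕊^l`. -/
def harmSpin (k l : ℕ) : Submodule ℂ (SpinModule G c b τ) :=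
  Submodule.map₂ (TensorProduct.mk ℂ (Standard G c τ) (Spinor b))
    (harm G c b τ k) (spinorDeg b l)

/-- The set of eigenvalues of `Z₁` on `ℋ_c(τ)_k^l`. -/
def eigenSet (k l : ℕ) : Set ℂ :=
  {ν | ∃ p ∈ harmSpin G c b τ k l, p ≠ 0 ∧ act G c b τ (realise G c J b .Z1) p = ν • p}

/-- `ℳ_c(τ)_{k,ν}^l`: the elements of the `ν`-eigenspace of `Z₁` in `ℋ_c(τ)_k^l` that are killed
by `F₋` and `F̄₋`. -/
def monog (k l : ℕ) (ν : ℂ) : Submodule ℂ (SpinModule G c b τ) :=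
  harmSpin G c b τ k l ⊓ Module.End.eigenspace (act G c b τ (realise G c J b .Z1)) ν
    ⊓ LinearMap.ker (act G c b τ (realise G c J b .Fm))
    ⊓ LinearMap.ker (act G c b τ (realise G c J b .Fbm))

/-- The index set of the decomposition: `0 ≤ l ≤ n`, `k ≥ 0`, and an eigenvalue `ν` of `Z₁` on
`ℋ_c(τ)_k^l`. -/
structure SpinIndex where
  l : Fin (n + 1)
  k : ℕ
  ν : ℂ
  mem : ν ∈ eigenSet G c J b τ k l

instance : DecidableEq (SpinIndex G c J b τ) := Classical.decEq _

variable {G c J b τ}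

/-- The multiplicity space `ℳ_c(τ)_{k,ν}^l` of an index. -/
abbrev SpinIndex.M (i : SpinIndex G c J b τ) : Submodule ℂ (SpinModule G c b τ) :=
  monog G c J b τ i.k i.l i.ν

/-- The representation `L(k + n - N_c(τ), ν, l - n/2)` of an index. -/
abbrev SpinIndex.L (i : SpinIndex G c J b τ) : Type :=
  LowestWeight ((i.k : ℂ) + (n : ℂ) - scalarN G c τ) i.ν (((i.l : ℕ) : ℂ) - (n : ℂ) / 2)

/-- The lowest weight vector of the representation of an index. -/
abbrev SpinIndex.vec (i : SpinIndex G c J b τ) : i.L :=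
  lowestVec ((i.k : ℂ) + (n : ℂ) - scalarN G c τ) i.ν (((i.l : ℕ) : ℂ) - (n : ℂ) / 2)

/-- The inclusion of a pure tensor `m ⊗ v` into the direct sum over all indices of `ℳ ⊗ L`. -/
abbrev SpinIndex.incl (i : SpinIndex G c J b τ) (m : i.M) (v : i.L) :
    ⨁ i : SpinIndex G c J b τ, i.M ⊗[ℂ] i.L :=
  DirectSum.lof ℂ (SpinIndex G c J b τ) (fun i => i.M ⊗[ℂ] i.L) i (m ⊗ₜ[ℂ] v)

end Realisation

end SpinorHowe

end

noncomputable section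

namespace SpinorHowe

/-! ### Modules over the enveloping superalgebra -/

section Enveloping

open UGen

/-! The elements of `realise` satisfy the superbrackets of gl(2|1) (`superRelations_realise`), so
K_c(τ) becomes a module over `U21`. The involution exchanges z_j with 2ζ_j, z̄_j with 2ζ̄_j and f_j
with f_j†. Hence F₊* = F̄₋ and F̄₊* = F₋, and Z₂, H and Z₁ are symmetric. On M_c(τ)_k ⊗ 𝕊^l the
operators H and Z₂ act by k + n - N_c(τ) and l - n/2, so these finite-dimensional pieces are exactly
the joint weight spaces (`weightSpace_eq_spinDeg`). Positivity of the form then gives two facts.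

Generation (`totalEval_surjective`). Let R be the submodule generated by the spaces ℳ. By induction
on k, suppose that R contains every piece of degree k. If y has degree k + 1 and is orthogonal to
the part of R of its own weight, then (F₋y | F₋y) = (y | F̄₊F₋y) = 0, because F₋y has degree k and
so lies in R. The same argument applies to F̄₋. So y is a lowest weight vector; after diagonalising
the symmetric operator Z₁ it is a sum of elements of the spaces ℳ, and R is everything.

Rigidity (`IsUnitary.vermaMax_le_ker`, `IsUnitary.inner_smul_smul_eq_zero`). Let m be a lowest
weight vector. A submodule of its Verma module that avoids the lowest weight vector consists of
vectors F₊a + F̄₊b. Its image is orthogonal to m, since the adjoints F̄₋ and F₋ kill m, hence to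
everything generated by m, hence to itself, and so is zero. Thus m ≠ 0 generates a copy of the
simple module L. In the same way, orthogonal lowest weight vectors generate orthogonal submodules.
The index (k, ν, l) can be read off the weight, so distinct spaces ℳ are orthogonal, and the sum of
the maps ℳ ⊗ L → K_c(τ), m ⊗ uv₀ ↦ um, is injective (`totalEval_injective`).

The centraliser ℛ commutes with `U21`, hence preserves each ℳ, which is cut out by weights and
kernels (`mem_monog_iff`), and it commutes with m ⊗ uv₀ ↦ um. -/

theorem u21Mk_eq_of_rel {a b : FreeAlgebra ℂ UGen} (h : URel a b) : u21Mk a = u21Mk b :=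
  RingQuot.mkAlgHom_rel ℂ h

theorem u21_induction {P : U21 → Prop} (hc : ∀ r : ℂ, P (algebraMap ℂ U21 r))
    (hg : ∀ g, P (uι g)) (hm : ∀ a b, P a → P b → P (a * b)) (ha : ∀ a b, P a → P b → P (a + b))
    (u : U21) : P u := by
  obtain ⟨x, rfl⟩ := RingQuot.mkAlgHom_surjective ℂ URel u
  induction x using FreeAlgebra.induction with
  | grade0 r => exact (AlgHom.commutes u21Mk r) ▸ hc r
  | grade1 g => exact hg g
  | mul a b h1 h2 => exact (map_mul u21Mk a b) ▸ hm _ _ h1 h2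
  | add a b h1 h2 => exact (map_add u21Mk a b) ▸ ha _ _ h1 h2

theorem u21Mk_two : u21Mk 2 = 2 := map_ofNat u21Mk 2

theorem two_mul_uι_Ep : uι Fp * uι Fbp + uι Fbp * uι Fp = 2 * uι Ep := by
  simpa [superAnti, uι, u21Mk_two] using u21Mk_eq_of_rel URel.FpFbp

theorem two_mul_uι_Em : uι Fm * uι Fbm + uι Fbm * uι Fm = -(2 * uι Em) := by
  simpa [superAnti, uι, u21Mk_two] using u21Mk_eq_of_rel URel.FmFbm

theorem uι_FpFm : uι Fp * uι Fm + uι Fm * uι Fp = 0 := by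
  simpa [superAnti, uι] using u21Mk_eq_of_rel URel.FpFm

theorem uι_FbpFbm : uι Fbp * uι Fbm + uι Fbm * uι Fbp = 0 := by
  simpa [superAnti, uι] using u21Mk_eq_of_rel URel.FbpFbm

theorem uι_FpFbm : uι Fp * uι Fbm + uι Fbm * uι Fp = uι H - (2 * uι Z2 - uι Z1) := by
  simpa [superAnti, uι, ugZ, u21Mk_two] using u21Mk_eq_of_rel URel.FpFbm

theorem uι_FmFbp : uι Fm * uι Fbp + uι Fbp * uι Fm = uι H + (2 * uι Z2 - uι Z1) := by
  simpa [superAnti, uι, ugZ, u21Mk_two] using u21Mk_eq_of_rel URel.FmFbp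

theorem uι_HFp : uι H * uι Fp - uι Fp * uι H = uι Fp := by
  simpa [superComm, uι] using u21Mk_eq_of_rel URel.HFp

theorem uι_HFbp : uι H * uι Fbp - uι Fbp * uι H = uι Fbp := by
  simpa [superComm, uι] using u21Mk_eq_of_rel URel.HFbp

theorem uι_Z1Fp : uι Z1 * uι Fp - uι Fp * uι Z1 = uι Fp := by
  simpa [superComm, uι] using u21Mk_eq_of_rel URel.Z1Fp

theorem uι_Z1Fbp : uι Z1 * uι Fbp - uι Fbp * uι Z1 = -uι Fbp := by
  simpa [superComm, uι] using u21Mk_eq_of_rel URel.Z1Fbp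

theorem uι_Z2Fp : uι Z2 * uι Fp - uι Fp * uι Z2 = uι Fp := by
  simpa [superComm, uι] using u21Mk_eq_of_rel URel.Z2Fp

theorem uι_Z2Fbp : uι Z2 * uι Fbp - uι Fbp * uι Z2 = -uι Fbp := by
  simpa [superComm, uι] using u21Mk_eq_of_rel URel.Z2Fbp

theorem uι_HFm : uι H * uι Fm - uι Fm * uι H = -uι Fm := by
  simpa [superComm, uι] using u21Mk_eq_of_rel URel.HFm

theorem uι_HFbm : uι H * uι Fbm - uι Fbm * uι H = -uι Fbm := by
  simpa [superComm, uι] using u21Mk_eq_of_rel URel.HFbm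

theorem uι_Z1Fm : uι Z1 * uι Fm - uι Fm * uι Z1 = uι Fm := by
  simpa [superComm, uι] using u21Mk_eq_of_rel URel.Z1Fm

theorem uι_Z1Fbm : uι Z1 * uι Fbm - uι Fbm * uι Z1 = -uι Fbm := by
  simpa [superComm, uι] using u21Mk_eq_of_rel URel.Z1Fbm

theorem uι_Z2Fm : uι Z2 * uι Fm - uι Fm * uι Z2 = uι Fm := by
  simpa [superComm, uι] using u21Mk_eq_of_rel URel.Z2Fm

theorem uι_Z2Fbm : uι Z2 * uι Fbm - uι Fbm * uι Z2 = -uι Fbm := by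
  simpa [superComm, uι] using u21Mk_eq_of_rel URel.Z2Fbm

theorem uι_Z1H : uι Z1 * uι H - uι H * uι Z1 = 0 := by
  simpa [superComm, uι] using u21Mk_eq_of_rel URel.Z1H

theorem uι_Z1Z2 : uι Z1 * uι Z2 - uι Z2 * uι Z1 = 0 := by
  simpa [superComm, uι] using u21Mk_eq_of_rel URel.Z1Z2

variable {W : Type*} [AddCommGroup W] [Module ℂ W] [Module U21 W]

/-- E₊ and E₋ are, up to sign, half the anticommutators of odd elements, so stability and
adjointness never have to be checked on them separately. -/
theorem uι_Ep_smul (w : W) :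
    uι Ep • w = (1 / 2 : ℂ) • (uι Fp • uι Fbp • w + uι Fbp • uι Fp • w) := by
  have h := congrArg (· • w) two_mul_uι_Ep
  simp only [add_smul, mul_smul, two_mul] at h
  rw [h, ← two_smul ℂ, smul_smul]; norm_num

theorem uι_Em_smul (w : W) :
    uι Em • w = -((1 / 2 : ℂ) • (uι Fm • uι Fbm • w + uι Fbm • uι Fm • w)) := by
  have h := congrArg (· • w) two_mul_uι_Em
  simp only [add_smul, mul_smul, two_mul, neg_smul] at h
  rw [h, ← two_smul ℂ, smul_neg, smul_smul]; norm_num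

/-- A vector of weight `(lam, ν, γ)` killed by `F₋` and `F̄₋`. -/
structure IsLowest (lam ν γ : ℂ) (v : W) : Prop where
  Fm : uι Fm • v = 0
  Fbm : uι Fbm • v = 0
  H : uι H • v = lam • v
  Z1 : uι Z1 • v = ν • v
  Z2 : uι Z2 • v = γ • v

theorem IsLowest.Em {lam ν γ : ℂ} {v : W} (hv : IsLowest lam ν γ v) : uι Em • v = 0 := by
  rw [uι_Em_smul, hv.Fm, hv.Fbm]; simp

variable [IsScalarTower ℂ U21 W]

theorem algebraMap_u21_smul (r : ℂ) (w : W) : algebraMap ℂ U21 r • w = r • w := by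
  rw [Algebra.algebraMap_eq_smul_one, smul_assoc, one_smul]

theorem u21_smul_comm (u : U21) (r : ℂ) (w : W) : u • r • w = r • u • w := by
  rw [← algebraMap_u21_smul r w, ← algebraMap_u21_smul r (u • w), smul_smul, smul_smul,
    Algebra.commutes]

/-- The action of an element of the enveloping superalgebra as a complex linear map. -/
def uAct (W : Type*) [AddCommGroup W] [Module ℂ W] [Module U21 W] [IsScalarTower ℂ U21 W]
    (u : U21) : Module.End ℂ W where
  toFun w := u • w
  map_add' := smul_add u
  map_smul' r w := u21_smul_comm u r w

/-- A subspace stable under the generators other than `E₊, E₋` is stable under everything. -/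
theorem smul_mem_of_stable (T : Submodule ℂ W)
    (h : ∀ g ∈ ({Fp, Fbp, Fm, Fbm, H, Z1, Z2} : Set UGen), ∀ w ∈ T, uι g • w ∈ T)
    (u : U21) : ∀ w ∈ T, u • w ∈ T := by
  induction u using u21_induction with
  | hc r => intro w hw; rw [algebraMap_u21_smul]; exact T.smul_mem r hw
  | hg g =>
    have hp := h Fp (by simp)
    have hbp := h Fbp (by simp)
    have hm := h Fm (by simp)
    have hbm := h Fbm (by simp)
    intro w hw
    cases g with
    | Ep =>
      rw [uι_Ep_smul]
      exact T.smul_mem _ (T.add_mem (hp _ (hbp _ hw)) (hbp _ (hp _ hw)))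
    | Em =>
      rw [uι_Em_smul]
      exact T.neg_mem (T.smul_mem _ (T.add_mem (hm _ (hbm _ hw)) (hbm _ (hm _ hw))))
    | _ => exact h _ (by simp) w hw
  | hm a b h1 h2 => intro w hw; rw [mul_smul]; exact h1 _ (h2 _ hw)
  | ha a b h1 h2 => intro w hw; rw [add_smul]; exact T.add_mem (h1 _ hw) (h2 _ hw)

theorem smul_weight {X Y : U21} {a y : ℂ} {w : W} (h : X * Y - Y * X = y • Y) (hw : X • w = a • w) :
    X • Y • w = (a + y) • Y • w := by
  have h1 := congrArg (· • w) h
  simp only [sub_smul, mul_smul, smul_assoc] at h1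
  rw [hw, u21_smul_comm] at h1
  rw [sub_eq_iff_eq_add.1 h1, add_smul, add_comm]

/-- The joint eigenspaces of `H` and `Z₂`. -/
def weightSpace (W : Type*) [AddCommGroup W] [Module ℂ W] [Module U21 W] [IsScalarTower ℂ U21 W]
    (a g : ℂ) : Submodule ℂ W :=
  Module.End.eigenspace (uAct W (uι H)) a ⊓ Module.End.eigenspace (uAct W (uι Z2)) g

theorem mem_weightSpace {a g : ℂ} {w : W} :
    w ∈ weightSpace W a g ↔ uι H • w = a • w ∧ uι Z2 • w = g • w := by
  rw [weightSpace, Submodule.mem_inf, Module.End.mem_eigenspace_iff, Module.End.mem_eigenspace_iff]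
  rfl

theorem smul_mem_weightSpace {Y : U21} {a g p q : ℂ} {w : W} (hw : w ∈ weightSpace W a g)
    (hH : uι H * Y - Y * uι H = p • Y) (hZ : uι Z2 * Y - Y * uι Z2 = q • Y) :
    Y • w ∈ weightSpace W (a + p) (g + q) :=
  mem_weightSpace.2 ⟨smul_weight hH (mem_weightSpace.1 hw).1, smul_weight hZ (mem_weightSpace.1 hw).2⟩

theorem Fp_smul_mem_weightSpace {a g : ℂ} {w : W} (hw : w ∈ weightSpace W a g) :
    uι Fp • w ∈ weightSpace W (a + 1) (g + 1) :=
  smul_mem_weightSpace hw (by simpa using uι_HFp) (by simpa using uι_Z2Fp)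

theorem Fbp_smul_mem_weightSpace {a g : ℂ} {w : W} (hw : w ∈ weightSpace W a g) :
    uι Fbp • w ∈ weightSpace W (a + 1) (g + -1) :=
  smul_mem_weightSpace hw (by simpa using uι_HFbp) (by simpa using uι_Z2Fbp)

theorem Fm_smul_mem_weightSpace {a g : ℂ} {w : W} (hw : w ∈ weightSpace W a g) :
    uι Fm • w ∈ weightSpace W (a + -1) (g + 1) :=
  smul_mem_weightSpace hw (by simpa using uι_HFm) (by simpa using uι_Z2Fm)

theorem Fbm_smul_mem_weightSpace {a g : ℂ} {w : W} (hw : w ∈ weightSpace W a g) :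
    uι Fbm • w ∈ weightSpace W (a + -1) (g + -1) :=
  smul_mem_weightSpace hw (by simpa using uι_HFbm) (by simpa using uι_Z2Fbm)

theorem Z1_smul_mem_weightSpace {a g : ℂ} {w : W} (hw : w ∈ weightSpace W a g) :
    uι Z1 • w ∈ weightSpace W a g := by
  have h1 : uι H * uι Z1 - uι Z1 * uι H = (0 : ℂ) • uι Z1 := by
    rw [zero_smul, ← neg_sub, uι_Z1H, neg_zero]
  have h2 : uι Z2 * uι Z1 - uι Z1 * uι Z2 = (0 : ℂ) • uι Z1 := by
    rw [zero_smul, ← neg_sub, uι_Z1Z2, neg_zero]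
  simpa using smul_mem_weightSpace hw h1 h2

/-- The subspaces spanned by the products of `j` raising operators `F₊, F̄₊` applied to `v`. -/
def raised (v : W) : ℕ → Submodule ℂ W
  | 0 => ℂ ∙ v
  | j + 1 => (raised v j).map (uAct W (uι Fp)) ⊔ (raised v j).map (uAct W (uι Fbp))

theorem raised_induction {v : W} {P : ℕ → W → Prop} (h0 : P 0 v)
    (hadd : ∀ j x y, P j x → P j y → P j (x + y)) (hs : ∀ j (r : ℂ) x, P j x → P j (r • x))
    (hp : ∀ j x, x ∈ raised v j → P j x → P (j + 1) (uι Fp • x))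
    (hbp : ∀ j x, x ∈ raised v j → P j x → P (j + 1) (uι Fbp • x)) :
    ∀ j, ∀ x ∈ raised v j, P j x := by
  intro j
  induction j with
  | zero =>
    intro x hx
    obtain ⟨r, rfl⟩ := Submodule.mem_span_singleton.1 hx
    exact hs _ _ _ h0
  | succ j ih =>
    intro x hx
    obtain ⟨_, ⟨a, ha, rfl⟩, _, ⟨b, hb, rfl⟩, rfl⟩ := Submodule.mem_sup.1 hx
    exact hadd _ _ _ (hp j a ha (ih a ha)) (hbp j b hb (ih b hb))

theorem Fp_smul_mem_raised {v x : W} {j : ℕ} (hx : x ∈ raised v j) :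
    uι Fp • x ∈ raised v (j + 1) :=
  Submodule.mem_sup_left (Submodule.mem_map_of_mem (f := uAct W (uι Fp)) hx)

theorem Fbp_smul_mem_raised {v x : W} {j : ℕ} (hx : x ∈ raised v j) :
    uι Fbp • x ∈ raised v (j + 1) :=
  Submodule.mem_sup_right (Submodule.mem_map_of_mem (f := uAct W (uι Fbp)) hx)

/-- Both raising operators have H-weight 1, so the eigenvalue of H counts the factors and separates
the spaces `raised v j`. -/
theorem H_smul_raised {lam ν γ : ℂ} {v : W} (hv : IsLowest lam ν γ v) :
    ∀ j, ∀ x ∈ raised v j, uι H • x = (lam + j : ℂ) • x := by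
  refine raised_induction (P := fun j x => uι H • x = (lam + j : ℂ) • x) (by simp [hv.H])
    (fun j x y hx hy => by rw [smul_add, hx, hy, smul_add])
    (fun j r x hx => by rw [u21_smul_comm, hx, smul_comm]) ?_ ?_
  · intro j x _ hx
    have h := congrArg (· • x) uι_HFp
    simp only [sub_smul, mul_smul, hx, u21_smul_comm] at h
    rw [sub_eq_iff_eq_add.1 h]; push_cast; generalize uι Fp • x = y; module
  · intro j x _ hx
    have h := congrArg (· • x) uι_HFbp
    simp only [sub_smul, mul_smul, hx, u21_smul_comm] at h
    rw [sub_eq_iff_eq_add.1 h]; push_cast; generalize uι Fbp • x = y; module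

/-- A semisimple weight operator preserves the spaces `raised v j`. -/
theorem weight_smul_mem_raised {v : W} {g : UGen} {a ap ab : ℂ} (hv : uι g • v = a • v)
    (hp : uι g * uι Fp - uι Fp * uι g = ap • uι Fp)
    (hb : uι g * uι Fbp - uι Fbp * uι g = ab • uι Fbp) :
    ∀ j, ∀ x ∈ raised v j, uι g • x ∈ raised v j := by
  refine raised_induction (P := fun j x => uι g • x ∈ raised v j)
    (hv ▸ Submodule.smul_mem _ _ (Submodule.mem_span_singleton_self v))
    (fun j x y hx hy => by rw [smul_add]; exact Submodule.add_mem _ hx hy)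
    (fun j r x hx => by rw [u21_smul_comm]; exact Submodule.smul_mem _ _ hx) ?_ ?_
  · intro j x h1 h2
    have h := congrArg (· • x) hp
    simp only [sub_smul, mul_smul, smul_assoc] at h
    rw [sub_eq_iff_eq_add.1 h]
    exact Submodule.add_mem _ (Submodule.smul_mem _ _ (Fp_smul_mem_raised h1))
      (Fp_smul_mem_raised h2)
  · intro j x h1 h2
    have h := congrArg (· • x) hb
    simp only [sub_smul, mul_smul, smul_assoc] at h
    rw [sub_eq_iff_eq_add.1 h]
    exact Submodule.add_mem _ (Submodule.smul_mem _ _ (Fbp_smul_mem_raised h1))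
      (Fbp_smul_mem_raised h2)

theorem raised_le_iSup (v : W) (j : ℕ) : raised v j ≤ ⨆ j, raised v j := le_iSup _ j

/-- A weak form of Poincaré–Birkhoff–Witt: a lowering operator can be moved to the right past the
raising operators, at the cost of terms in H, Z₁, Z₂, until it reaches v and kills it. -/
theorem smul_mem_iSup_raised {lam ν γ : ℂ} {v : W} (hv : IsLowest lam ν γ v) (u : U21) :
    ∀ w ∈ ⨆ j, raised v j, u • w ∈ ⨆ j, raised v j := by
  set T := ⨆ j, raised v j with hT
  have red : ∀ g : UGen, (∀ j, ∀ x ∈ raised v j, uι g • x ∈ T) → ∀ w ∈ T, uι g • w ∈ T := by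
    intro g hg w hw
    have : T ≤ T.comap (uAct W (uι g)) := iSup_le fun j x hx => hg j x hx
    exact this hw
  have hH := red H fun j x hx => raised_le_iSup v j <| by
    rw [H_smul_raised hv j x hx]; exact Submodule.smul_mem _ _ hx
  have hZ1 := red Z1 fun j x hx => raised_le_iSup v j <|
    weight_smul_mem_raised (ap := 1) (ab := -1) hv.Z1 (by simpa using uι_Z1Fp)
      (by simpa using uι_Z1Fbp) j x hx
  have hZ2 := red Z2 fun j x hx => raised_le_iSup v j <|
    weight_smul_mem_raised (ap := 1) (ab := -1) hv.Z2 (by simpa using uι_Z2Fp)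
      (by simpa using uι_Z2Fbp) j x hx
  have hFp := red Fp fun j x hx => raised_le_iSup v (j + 1) (Fp_smul_mem_raised hx)
  have hFbp := red Fbp fun j x hx => raised_le_iSup v (j + 1) (Fbp_smul_mem_raised hx)
  have hZ : ∀ w ∈ T, (2 * uι Z2 - uι Z1) • w ∈ T := fun w hw => by
    rw [sub_smul, two_mul, add_smul]
    exact T.sub_mem (T.add_mem (hZ2 _ hw) (hZ2 _ hw)) (hZ1 _ hw)
  have hadd : ∀ u : U21, ∀ x y : W, u • x ∈ T → u • y ∈ T → u • (x + y) ∈ T :=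
    fun u x y hx hy => by rw [smul_add]; exact T.add_mem hx hy
  have hsmul : ∀ u : U21, ∀ (r : ℂ) (x : W), u • x ∈ T → u • r • x ∈ T :=
    fun u r x hx => by rw [u21_smul_comm]; exact T.smul_mem _ hx
  have hFm := red Fm <| raised_induction (P := fun _ x => uι Fm • x ∈ T)
    (by rw [hv.Fm]; exact T.zero_mem) (fun _ => hadd _) (fun _ => hsmul _)
    (fun j x h1 h2 => by
      have h := congrArg (· • x) uι_FpFm
      simp only [add_smul, mul_smul, zero_smul] at h
      rw [eq_neg_of_add_eq_zero_right h]
      exact T.neg_mem (hFp _ h2))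
    (fun j x h1 h2 => by
      have h := congrArg (· • x) uι_FmFbp
      simp only [add_smul, mul_smul] at h
      rw [eq_sub_of_add_eq h]
      have h1' := raised_le_iSup v j h1
      exact T.sub_mem (T.add_mem (hH _ h1') (hZ _ h1')) (hFbp _ h2))
  have hFbm := red Fbm <| raised_induction (P := fun _ x => uι Fbm • x ∈ T)
    (by rw [hv.Fbm]; exact T.zero_mem) (fun _ => hadd _) (fun _ => hsmul _)
    (fun j x h1 h2 => by
      have h := congrArg (· • x) uι_FpFbm
      simp only [add_smul, mul_smul, sub_smul (uι H)] at h
      rw [eq_sub_of_add_eq' h]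
      have h1' := raised_le_iSup v j h1
      exact T.sub_mem (T.sub_mem (hH _ h1') (hZ _ h1')) (hFp _ h2))
    (fun j x h1 h2 => by
      have h := congrArg (· • x) uι_FbpFbm
      simp only [add_smul, mul_smul, zero_smul] at h
      rw [eq_neg_of_add_eq_zero_right h]
      exact T.neg_mem (hFbp _ h2))
  refine smul_mem_of_stable T ?_ u
  rintro g (rfl | rfl | rfl | rfl | rfl | rfl | rfl)
  exacts [hFp, hFbp, hFm, hFbm, hH, hZ1, hZ2]

theorem iSup_raised_eq_top {lam ν γ : ℂ} {v : W} (hv : IsLowest lam ν γ v)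
    (hgen : ∀ w : W, ∃ u : U21, w = u • v) : ⨆ j, raised v j = ⊤ := by
  refine eq_top_iff.2 fun w _ => ?_
  obtain ⟨u, rfl⟩ := hgen w
  exact smul_mem_iSup_raised hv u v
    (raised_le_iSup v 0 (Submodule.mem_span_singleton_self v))

/-- A submodule of a cyclic lowest weight module which does not contain the lowest weight vector
lies in the image of the raising operators. -/
theorem exists_raised_of_notMem {lam ν γ : ℂ} {v : W} (hv : IsLowest lam ν γ v)
    (hgen : ∀ w : W, ∃ u : U21, w = u • v) (N : Submodule U21 W) (hN : v ∉ N) {w : W}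
    (hw : w ∈ N) : ∃ a b : W, w = uι Fp • a + uι Fbp • b := by
  have hmem : w ∈ ⨆ j, raised v j := iSup_raised_eq_top hv hgen ▸ Submodule.mem_top
  obtain ⟨x, hx, rfl⟩ := (Submodule.mem_iSup_iff_exists_finsupp _ _).1 hmem
  have h0 : ∃ r : ℂ, r • v = x 0 := Submodule.mem_span_singleton.1 (hx 0)
  obtain ⟨r, hr⟩ := h0
  -- A submodule contains the H-components of its elements. This is proved only for the component of
  -- degree 0, by eliminating the other degrees one at a time.
  have key : ∀ s : Finset ℕ, 0 ∉ s → ∀ (r : ℂ) (y : ℕ → W), (∀ j, y j ∈ raised v j) →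
      r • v + ∑ j ∈ s, y j ∈ N → r • v ∈ N := by
    intro s
    induction s using Finset.induction_on with
    | empty => intro _ r y _ h; simpa using h
    | insert j s hj ih =>
      intro h0 r y hy h
      have hj0 : j ≠ 0 := fun h => h0 (h ▸ Finset.mem_insert_self _ _)
      -- H - (lam + j) kills the term of degree j and multiplies the coefficient of v by -j, which
      -- is undone at the end because j ≠ 0.
      have h2 := N.sub_mem (N.smul_mem (uι H) h) (N.smul_mem (algebraMap ℂ U21 (lam + j)) h)
      have h3 := ih (fun h => h0 (Finset.mem_insert_of_mem h)) (-(j : ℂ) * r)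
        (fun i => ((i : ℂ) - j) • y i) (fun i => Submodule.smul_mem _ _ (hy i)) (by
          convert h2 using 1
          rw [algebraMap_u21_smul, smul_add, Finset.sum_insert hj, smul_add, Finset.smul_sum,
            u21_smul_comm, hv.H, H_smul_raised hv j _ (hy j),
            Finset.sum_congr rfl fun i _ => H_smul_raised hv i _ (hy i), smul_add (lam + (j : ℂ)),
            smul_add (lam + (j : ℂ)), Finset.smul_sum]
          have : ∑ i ∈ s, ((i : ℂ) - j) • y i
              = ∑ i ∈ s, (lam + (i : ℂ)) • y i - ∑ i ∈ s, (lam + (j : ℂ)) • y i := by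
            rw [← Finset.sum_sub_distrib]
            refine Finset.sum_congr rfl fun i _ => ?_
            module
          rw [this]
          module)
      have h4 := N.smul_mem (algebraMap ℂ U21 (-(j : ℂ))⁻¹) h3
      rwa [algebraMap_u21_smul, smul_smul, ← mul_assoc, inv_mul_cancel₀ (by simpa using hj0),
        one_mul] at h4
  have hr0 : r = 0 := by
    by_contra hne
    have h1 := key (x.support.erase 0) (by simp) r x hx (by
      rw [hr]
      convert hw using 1
      rw [Finsupp.sum]
      by_cases h : 0 ∈ x.support
      · rw [Finset.add_sum_erase _ (fun j => x j) h]
      · rw [Finset.erase_eq_of_notMem h, Finsupp.notMem_support_iff.1 h, zero_add])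
    have h2 := N.smul_mem (algebraMap ℂ U21 r⁻¹) h1
    rw [algebraMap_u21_smul, smul_smul, inv_mul_cancel₀ hne, one_smul] at h2
    exact hN h2
  have hx0 : x 0 = 0 := by rw [← hr, hr0, zero_smul]
  let R : Submodule ℂ W := LinearMap.range (uAct W (uι Fp)) ⊔ LinearMap.range (uAct W (uι Fbp))
  have hR : x.sum (fun _ y => y) ∈ R := by
    refine Submodule.sum_mem _ fun j _ => ?_
    cases j with
    | zero => simp [hx0]
    | succ j =>
      have h : raised v (j + 1) ≤ R := sup_le_sup LinearMap.map_le_range LinearMap.map_le_range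
      exact h (hx (j + 1))
  obtain ⟨_, ⟨a, rfl⟩, _, ⟨b, rfl⟩, h⟩ := Submodule.mem_sup.1 hR
  exact ⟨a, b, h.symm⟩

end Enveloping

/-! ### Lowest weight modules inside unitary modules -/

section Verma

open UGen

variable {lam ν γ : ℂ}

theorem isLowest_vermaVec : IsLowest lam ν γ (vermaVec lam ν γ) := by
  have key : ∀ u : U21, u ∈ vermaIdeal lam ν γ → u • vermaVec lam ν γ = 0 := fun u hu => by
    change u • (vermaIdeal lam ν γ).mkQ 1 = 0
    rw [← map_smul, smul_eq_mul, mul_one]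
    exact (Submodule.Quotient.mk_eq_zero _).2 hu
  have hsub : ∀ (u : U21) (r : ℂ), u - algebraMap ℂ U21 r ∈ vermaIdeal lam ν γ →
      u • vermaVec lam ν γ = r • vermaVec lam ν γ := fun u r h => by
    have := key _ h
    rwa [sub_smul, algebraMap_u21_smul, sub_eq_zero] at this
  refine ⟨key _ (Submodule.subset_span ?_), key _ (Submodule.subset_span ?_),
    hsub _ _ (Submodule.subset_span ?_), hsub _ _ (Submodule.subset_span ?_),
    hsub _ _ (Submodule.subset_span ?_)⟩ <;> simp

theorem exists_smul_vermaVec (w : Verma lam ν γ) : ∃ u : U21, w = u • vermaVec lam ν γ := by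
  obtain ⟨u, rfl⟩ := (vermaIdeal lam ν γ).mkQ_surjective w
  exact ⟨u, by
    change (vermaIdeal lam ν γ).mkQ u = u • (vermaIdeal lam ν γ).mkQ 1
    rw [← map_smul, smul_eq_mul, mul_one]⟩

theorem exists_smul_lowestVec (w : LowestWeight lam ν γ) :
    ∃ u : U21, w = u • lowestVec lam ν γ := by
  obtain ⟨x, rfl⟩ := (vermaMax lam ν γ).mkQ_surjective w
  obtain ⟨u, rfl⟩ := exists_smul_vermaVec x
  exact ⟨u, map_smul _ _ _⟩

/-- If the largest proper submodule is proper, the quotient by it is simple. -/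
theorem isSimpleModule_lowestWeight (h : vermaVec lam ν γ ∉ vermaMax lam ν γ) :
    IsSimpleModule U21 (LowestWeight lam ν γ) := by
  change IsSimpleModule U21 (Verma lam ν γ ⧸ vermaMax lam ν γ)
  rw [isSimpleModule_iff_isCoatom]
  refine ⟨fun ht => h (ht ▸ Submodule.mem_top), fun N hN => by_contra fun hne => ?_⟩
  refine hN.not_ge (le_sSup fun hv => hne (eq_top_iff.2 fun w _ => ?_))
  obtain ⟨u, rfl⟩ := exists_smul_vermaVec w
  exact N.smul_mem u hv

variable {K : Type*} [AddCommGroup K] [Module ℂ K] [Module U21 K]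

/-- H is half the sum of the two mixed anticommutators of odd elements. Together with the analogous
formula for Z₁, this reduces the symmetry of H and Z₁ to the adjointness of the odd generators and
of Z₂. -/
theorem uι_H_smul (x : K) : uι H • x = (1 / 2 : ℂ) • (uι Fp • uι Fbm • x + uι Fbm • uι Fp • x
    + (uι Fm • uι Fbp • x + uι Fbp • uι Fm • x)) := by
  have h1 := congrArg (· • x) uι_FpFbm
  have h2 := congrArg (· • x) uι_FmFbp
  simp only [add_smul, mul_smul, sub_smul (uι H)] at h1 h2
  rw [h1, h2, sub_add_add_cancel, ← two_smul ℂ, smul_smul]; norm_num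

theorem uι_Z1_smul (x : K) : uι Z1 • x = (2 : ℂ) • uι Z2 • x - (1 / 2 : ℂ) •
    (uι Fm • uι Fbp • x + uι Fbp • uι Fm • x - (uι Fp • uι Fbm • x + uι Fbm • uι Fp • x)) := by
  have h1 := congrArg (· • x) uι_FpFbm
  have h2 := congrArg (· • x) uι_FmFbp
  simp only [add_smul, mul_smul, sub_smul, two_mul] at h1 h2
  rw [h1, h2]
  generalize uι Z1 • x = a
  generalize uι Z2 • x = b
  generalize uι H • x = c
  module

variable [IsScalarTower ℂ U21 K]

/-- The homomorphism from the Verma module determined by a lowest weight vector. -/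
def vermaLift {m : K} (hm : IsLowest lam ν γ m) : Verma lam ν γ →ₗ[U21] K :=
  (vermaIdeal lam ν γ).liftQ (LinearMap.toSpanSingleton U21 K m) <| by
    rw [vermaIdeal, Submodule.span_le]
    rintro u (rfl | rfl | rfl | rfl | rfl | rfl) <;>
      simp [sub_smul, hm.Fm, hm.Fbm, hm.Em, hm.H, hm.Z1, hm.Z2]

theorem vermaLift_vermaVec {m : K} (hm : IsLowest lam ν γ m) :
    vermaLift hm (vermaVec lam ν γ) = m := by
  change (vermaIdeal lam ν γ).liftQ _ _ ((vermaIdeal lam ν γ).mkQ 1) = m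
  simp

end Verma

/-! ### Orthogonality and irreducibility in unitary modules -/

section Unitary

open UGen

open scoped ComplexInnerProductSpace

/-- The adjointness relations of the basis elements of `gl(2|1)` that imply all the others. -/
structure IsUnitary (K : Type*) [NormedAddCommGroup K] [InnerProductSpace ℂ K] [Module U21 K] :
    Prop where
  adj_Fp : ∀ x y : K, ⟪uι Fp • x, y⟫ = ⟪x, uι Fbm • y⟫
  adj_Fbp : ∀ x y : K, ⟪uι Fbp • x, y⟫ = ⟪x, uι Fm • y⟫
  adj_Z2 : ∀ x y : K, ⟪uι Z2 • x, y⟫ = ⟪x, uι Z2 • y⟫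

variable {K : Type*} [NormedAddCommGroup K] [InnerProductSpace ℂ K] [Module U21 K]

theorem IsUnitary.adj_Fm (h : IsUnitary K) (x y : K) : ⟪uι Fm • x, y⟫ = ⟪x, uι Fbp • y⟫ := by
  rw [← inner_conj_symm, ← h.adj_Fbp, inner_conj_symm]

theorem IsUnitary.adj_Fbm (h : IsUnitary K) (x y : K) : ⟪uι Fbm • x, y⟫ = ⟪x, uι Fp • y⟫ := by
  rw [← inner_conj_symm, ← h.adj_Fp, inner_conj_symm]

theorem IsUnitary.adj_H (h : IsUnitary K) (x y : K) : ⟪uι H • x, y⟫ = ⟪x, uι H • y⟫ := by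
  rw [uι_H_smul, uι_H_smul]
  simp only [inner_smul_left, inner_smul_right, inner_add_left, inner_add_right, h.adj_Fp, h.adj_Fbm, h.adj_Fm,
    h.adj_Fbp, map_div₀, map_one, map_ofNat]
  
theorem IsUnitary.adj_Z1 (h : IsUnitary K) (x y : K) : ⟪uι Z1 • x, y⟫ = ⟪x, uι Z1 • y⟫ := by
  rw [uι_Z1_smul, uι_Z1_smul]
  simp only [inner_smul_left, inner_smul_right, inner_add_left, inner_add_right, inner_sub_left,
    inner_sub_right, h.adj_Fp, h.adj_Fbm, h.adj_Fm, h.adj_Fbp, h.adj_Z2, map_div₀, map_one, map_ofNat]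

variable [IsScalarTower ℂ U21 K]

theorem inner_eq_zero_of_weight {g : UGen} (hg : ∀ x y : K, ⟪uι g • x, y⟫ = ⟪x, uι g • y⟫)
    {a b : ℂ} (hab : a ≠ b) {x y : K} (hx : uι g • x = a • x) (hy : uι g • y = b • y) :
    ⟪x, y⟫ = 0 := by
  have hsym : (uAct K (uι g)).IsSymmetric := hg
  have h := hsym.orthogonalFamily_eigenspaces hab
  exact h ⟨x, Module.End.mem_eigenspace_iff.2 hx⟩ ⟨y, Module.End.mem_eigenspace_iff.2 hy⟩

/-- The orthogonal complement of a stable subspace is stable. -/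
theorem IsUnitary.smul_mem_orthogonal (h : IsUnitary K) (N : Submodule ℂ K)
    (hN : ∀ u : U21, ∀ x ∈ N, u • x ∈ N) (u : U21) : ∀ x ∈ Nᗮ, u • x ∈ Nᗮ := by
  refine smul_mem_of_stable Nᗮ ?_ u
  intro g hg w hw
  rw [Submodule.mem_orthogonal] at hw ⊢
  intro v hv
  -- The adjoint of each generator is again a generator, so it can be moved onto the vector of the
  -- stable space N.
  rcases hg with rfl | rfl | rfl | rfl | rfl | rfl | rfl
  · rw [← h.adj_Fbm]; exact hw _ (hN _ _ hv)
  · rw [← h.adj_Fm]; exact hw _ (hN _ _ hv)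
  · rw [← h.adj_Fbp]; exact hw _ (hN _ _ hv)
  · rw [← h.adj_Fp]; exact hw _ (hN _ _ hv)
  · rw [← h.adj_H]; exact hw _ (hN _ _ hv)
  · rw [← h.adj_Z1]; exact hw _ (hN _ _ hv)
  · rw [← h.adj_Z2]; exact hw _ (hN _ _ hv)

/-- The kernel of the homomorphism from a Verma module to a unitary module contains the largest
proper submodule. -/
theorem IsUnitary.vermaMax_le_ker (h : IsUnitary K) {lam ν γ : ℂ} {m : K}
    (hm : IsLowest lam ν γ m) : vermaMax lam ν γ ≤ LinearMap.ker (vermaLift hm) := by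
  refine sSup_le fun N hN => ?_
  let N' : Submodule ℂ K := (N.map (vermaLift hm)).restrictScalars ℂ
  have hst : ∀ u : U21, ∀ x ∈ N', u • x ∈ N' := fun u x hx =>
    (N.map (vermaLift hm)).smul_mem u hx
  -- Elements of N have no component along the lowest weight vector, hence are of the form F₊a +
  -- F̄₊b. The adjoints F̄₋ and F₋ kill m.
  have hmem : m ∈ N'ᗮ := by
    rw [Submodule.mem_orthogonal]
    rintro _ ⟨x, hx, rfl⟩
    obtain ⟨a, b, rfl⟩ := exists_raised_of_notMem isLowest_vermaVec exists_smul_vermaVec N hN hx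
    rw [map_add, map_smul, map_smul, inner_add_left, h.adj_Fp, h.adj_Fbp, hm.Fbm, hm.Fm]
    simp
  intro x hx
  rw [LinearMap.mem_ker]
  have h1 : vermaLift hm x ∈ N' := Submodule.mem_map_of_mem hx
  have h2 : vermaLift hm x ∈ N'ᗮ := by
    obtain ⟨u, rfl⟩ := exists_smul_vermaVec x
    rw [map_smul, vermaLift_vermaVec]
    exact h.smul_mem_orthogonal N' hst u m hmem
  -- The image of N consists of vectors u • m, so it lies in N' and in its orthogonal complement.
  exact inner_self_eq_zero.1 (h2 _ h1)

theorem IsUnitary.vermaVec_notMem (h : IsUnitary K) {lam ν γ : ℂ} {m : K}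
    (hm : IsLowest lam ν γ m) (h0 : m ≠ 0) : vermaVec lam ν γ ∉ vermaMax lam ν γ := fun hmem =>
  h0 <| by simpa [vermaLift_vermaVec] using h.vermaMax_le_ker hm hmem

/-- The homomorphism from the irreducible lowest weight module determined by a lowest weight vector
of a unitary module. -/
def lowestLift (h : IsUnitary K) {lam ν γ : ℂ} {m : K} (hm : IsLowest lam ν γ m) :
    LowestWeight lam ν γ →ₗ[U21] K :=
  (vermaMax lam ν γ).liftQ (vermaLift hm) (h.vermaMax_le_ker hm)

theorem lowestLift_lowestVec (h : IsUnitary K) {lam ν γ : ℂ} {m : K} (hm : IsLowest lam ν γ m) :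
    lowestLift h hm (lowestVec lam ν γ) = m := by
  change (vermaMax lam ν γ).liftQ _ _ ((vermaMax lam ν γ).mkQ (vermaVec lam ν γ)) = m
  rw [Submodule.mkQ_apply, Submodule.liftQ_apply, vermaLift_vermaVec]

theorem lowestLift_smul_lowestVec (h : IsUnitary K) {lam ν γ : ℂ} {m : K}
    (hm : IsLowest lam ν γ m) (u : U21) :
    lowestLift h hm (u • lowestVec lam ν γ) = u • m := by
  rw [map_smul, lowestLift_lowestVec]

theorem lowestLift_injective (h : IsUnitary K) {lam ν γ : ℂ} {m : K} (hm : IsLowest lam ν γ m)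
    (h0 : m ≠ 0) : Function.Injective (lowestLift h hm) := by
  have := isSimpleModule_lowestWeight (h.vermaVec_notMem hm h0)
  refine (LinearMap.injective_or_eq_zero _).resolve_right fun hz => h0 ?_
  rw [← lowestLift_lowestVec h hm, hz, LinearMap.zero_apply]

/-- Orthogonal lowest weight vectors generate orthogonal submodules. -/
theorem IsUnitary.inner_smul_smul_eq_zero (h : IsUnitary K) {lam ν γ lam' ν' γ' : ℂ} {m m' : K}
    (hm : IsLowest lam ν γ m) (hm' : IsLowest lam' ν' γ' m') (ho : ⟪m, m'⟫ = 0) (u u' : U21) :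
    ⟪u • m, u' • m'⟫ = 0 := by
  let N : Submodule ℂ K := ⨆ j, raised m j
  have hmem : m' ∈ Nᗮ := by
    -- In degree 0 this is the hypothesis on m and m'. In higher degree the outermost raising
    -- operator moves across the form and kills m'.
    have : ∀ j, ∀ x ∈ raised m j, ⟪x, m'⟫ = 0 :=
      raised_induction (P := fun _ x => ⟪x, m'⟫ = 0) ho
        (fun j x y hx hy => by rw [inner_add_left, hx, hy, add_zero])
        (fun j r x hx => by rw [inner_smul_left, hx, mul_zero])
        (fun j x _ _ => by rw [h.adj_Fp, hm'.Fbm, inner_zero_right])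
        (fun j x _ _ => by rw [h.adj_Fbp, hm'.Fm, inner_zero_right])
    have hle : N ≤ (ℂ ∙ m')ᗮ := iSup_le fun j x hx =>
      (Submodule.mem_orthogonal_singleton_iff_inner_left).2 (this j x hx)
    rw [Submodule.mem_orthogonal]
    exact fun x hx => Submodule.mem_orthogonal_singleton_iff_inner_left.1 (hle hx)
  have hs := smul_mem_iSup_raised hm
  exact h.smul_mem_orthogonal N hs u' m' hmem _
    (hs u m (raised_le_iSup m 0 (Submodule.mem_span_singleton_self m)))

/-! ### The isotypic decomposition of a unitary module -/

variable {ι : Type*} [DecidableEq ι] {lam ν γ : ι → ℂ} {M : ι → Submodule ℂ K}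

/-- The evaluation map `M ⊗ L(lam, ν, γ) → K`. -/
def evalMap (h : IsUnitary K) {lam ν γ : ℂ} {M : Submodule ℂ K}
    (hM : ∀ m ∈ M, IsLowest lam ν γ m) : M ⊗[ℂ] LowestWeight lam ν γ →ₗ[ℂ] K :=
  TensorProduct.lift <| LinearMap.mk₂ ℂ (fun m v => lowestLift h (hM m m.2) v)
    (fun m m' v => by
      -- Linearity in m is visible only after writing v = u • v₀, when the value becomes u • m.
      obtain ⟨u, rfl⟩ := exists_smul_lowestVec v
      simp only [lowestLift_smul_lowestVec, Submodule.coe_add, smul_add])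
    (fun r m v => by
      obtain ⟨u, rfl⟩ := exists_smul_lowestVec v
      simp only [lowestLift_smul_lowestVec, Submodule.coe_smul, u21_smul_comm])
    (fun m v v' => map_add _ v v')
    (fun r m v => by rw [← algebraMap_u21_smul, map_smul, algebraMap_u21_smul])

theorem evalMap_tmul (h : IsUnitary K) {lam ν γ : ℂ} {M : Submodule ℂ K}
    (hM : ∀ m ∈ M, IsLowest lam ν γ m) (m : M) (v : LowestWeight lam ν γ) :
    evalMap h hM (m ⊗ₜ v) = lowestLift h (hM m m.2) v := rfl

theorem evalMap_tmul_smul (h : IsUnitary K) {lam ν γ : ℂ} {M : Submodule ℂ K}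
    (hM : ∀ m ∈ M, IsLowest lam ν γ m) (m : M) (u : U21) :
    evalMap h hM (m ⊗ₜ (u • lowestVec lam ν γ)) = u • (m : K) := by
  rw [evalMap_tmul, lowestLift_smul_lowestVec]

/-- An orthonormal basis of M generates pairwise orthogonal copies of L, so the terms of a vanishing
sum vanish one by one; each copy is embedded because L is simple. -/
theorem evalMap_injective (h : IsUnitary K) {lam ν γ : ℂ} {M : Submodule ℂ K}
    [FiniteDimensional ℂ M] (hM : ∀ m ∈ M, IsLowest lam ν γ m) :
    Function.Injective (evalMap h hM) := by
  classical
  rw [injective_iff_map_eq_zero]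
  intro x hx
  let e := stdOrthonormalBasis ℂ M
  let q := TensorProduct.equivFinsuppOfBasisLeft (N := LowestWeight lam ν γ) e.toBasis
  obtain ⟨y, rfl⟩ := q.symm.surjective x
  have hy : q.symm y = ∑ i, e i ⊗ₜ[ℂ] y i := by
    simp only [q, TensorProduct.equivFinsuppOfBasisLeft_symm_apply]
    rw [Finsupp.sum_fintype _ _ (by simp)]
    simp
  rw [hy, map_sum] at hx
  have hzero : y = 0 := by
    ext i
    refine lowestLift_injective h (hM (e i) (e i).2)
      (fun h0 => e.orthonormal.ne_zero i (Subtype.ext h0)) ?_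
    rw [Finsupp.zero_apply, map_zero, ← inner_self_eq_zero (𝕜 := ℂ)]
    have h2 : ∀ j ≠ i, ⟪lowestLift h (hM (e i) (e i).2) (y i), evalMap h hM (e j ⊗ₜ y j)⟫ = 0 := by
      intro j hj
      obtain ⟨u, hu⟩ := exists_smul_lowestVec (y i)
      obtain ⟨u', hu'⟩ := exists_smul_lowestVec (y j)
      rw [hu, hu', lowestLift_smul_lowestVec, evalMap_tmul_smul]
      exact h.inner_smul_smul_eq_zero (hM _ (e i).2) (hM _ (e j).2)
        (e.orthonormal.2 hj.symm) u u'
    have h3 := congrArg (inner ℂ (lowestLift h (hM (e i) (e i).2) (y i))) hx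
    rw [inner_zero_right, inner_sum, Finset.sum_eq_single i (fun j _ hj => h2 j hj) (by simp)] at h3
    exact h3
  rw [hzero, map_zero]

theorem evalMap_induction (h : IsUnitary K) {lam ν γ : ℂ} {M : Submodule ℂ K}
    (hM : ∀ m ∈ M, IsLowest lam ν γ m) (x : M ⊗[ℂ] LowestWeight lam ν γ) {P : K → Prop}
    (h0 : P 0) (hadd : ∀ x y, P x → P y → P (x + y)) (hs : ∀ m ∈ M, ∀ u : U21, P (u • m)) :
    P (evalMap h hM x) := by
  induction x using TensorProduct.induction_on with
  | zero => rwa [map_zero]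
  | tmul m v =>
    obtain ⟨u, rfl⟩ := exists_smul_lowestVec v
    rw [evalMap_tmul_smul]
    exact hs m m.2 u
  | add x y hx hy => rw [map_add]; exact hadd _ _ hx hy

/-- The sum of the evaluation maps. -/
def totalEval (h : IsUnitary K) (hM : ∀ i, ∀ m ∈ M i, IsLowest (lam i) (ν i) (γ i) m) :
    (⨁ i, M i ⊗[ℂ] LowestWeight (lam i) (ν i) (γ i)) →ₗ[ℂ] K :=
  DirectSum.toModule ℂ ι K fun i => evalMap h (hM i)

/-- Orthogonality of the spaces `M i` passes to the submodules that they generate, so the blocks of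
a vanishing sum vanish separately, and `evalMap_injective` applies to each. -/
theorem totalEval_injective (h : IsUnitary K) [∀ i, FiniteDimensional ℂ (M i)]
    (hM : ∀ i, ∀ m ∈ M i, IsLowest (lam i) (ν i) (γ i) m)
    (horth : ∀ i j, i ≠ j → ∀ m ∈ M i, ∀ m' ∈ M j, ⟪m, m'⟫ = 0) :
    Function.Injective (totalEval h hM) := by
  classical
  rw [injective_iff_map_eq_zero]
  intro x hx
  have h1 : totalEval h hM x = ∑ i ∈ x.support, evalMap h (hM i) (x i) := by
    conv_lhs => rw [← DirectSum.sum_support_of x]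
    rw [map_sum]
    exact Finset.sum_congr rfl fun i _ =>
      DirectSum.toModule_lof ℂ (φ := fun i => evalMap h (hM i)) i (x i)
  ext1 i
  refine evalMap_injective h (hM i) ?_
  rw [DirectSum.zero_apply, map_zero, ← inner_self_eq_zero (𝕜 := ℂ)]
  have h2 : ∀ j ≠ i, ⟪evalMap h (hM i) (x i), evalMap h (hM j) (x j)⟫ = 0 := by
    intro j hj
    refine evalMap_induction h (hM j) (x j) (P := fun a => ⟪evalMap h (hM i) (x i), a⟫ = 0)
      (inner_zero_right _)
      (fun a b ha hb => by rw [inner_add_right, ha, hb, add_zero]) fun m' hm' u' => ?_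
    refine evalMap_induction h (hM i) (x i) (P := fun a => ⟪a, u' • m'⟫ = 0) (inner_zero_left _)
      (fun a b ha hb => by rw [inner_add_left, ha, hb, add_zero]) fun m hm u => ?_
    exact h.inner_smul_smul_eq_zero (hM i m hm) (hM j m' hm') (horth i j hj.symm m hm m' hm') u u'
  have h3 := congrArg (inner ℂ (evalMap h (hM i) (x i))) (h1.symm.trans hx)
  rw [inner_zero_right, inner_sum, Finset.sum_eq_single i (fun j _ hj => h2 j hj) (fun hi => by
    rw [DFinsupp.notMem_support_iff.1 hi, map_zero, inner_zero_right])] at h3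
  exact h3

theorem smul_mem_range_totalEval (h : IsUnitary K)
    (hM : ∀ i, ∀ m ∈ M i, IsLowest (lam i) (ν i) (γ i) m) (u : U21) {w : K}
    (hw : w ∈ LinearMap.range (totalEval h hM)) : u • w ∈ LinearMap.range (totalEval h hM) := by
  obtain ⟨x, rfl⟩ := hw
  induction x using DirectSum.induction_on with
  | zero => rw [map_zero, smul_zero]; exact Submodule.zero_mem _
  | add x y hx hy => rw [map_add, smul_add]; exact Submodule.add_mem _ hx hy
  | of i x =>
    rw [show totalEval h hM (DirectSum.of _ i x) = evalMap h (hM i) x from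
      DirectSum.toModule_lof ℂ (φ := fun i => evalMap h (hM i)) i x]
    refine evalMap_induction h (hM i) x (P := fun a => u • a ∈ LinearMap.range (totalEval h hM))
      (by rw [smul_zero]; exact Submodule.zero_mem _)
      (fun a b ha hb => by rw [smul_add]; exact Submodule.add_mem _ ha hb) fun m hm u' => ?_
    refine ⟨DirectSum.lof ℂ ι _ i (⟨m, hm⟩ ⊗ₜ ((u * u') • lowestVec _ _ _)), ?_⟩
    rw [totalEval, DirectSum.toModule_lof, evalMap_tmul_smul, mul_smul]

theorem mem_range_totalEval (h : IsUnitary K)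
    (hM : ∀ i, ∀ m ∈ M i, IsLowest (lam i) (ν i) (γ i) m) {i : ι} {m : K} (hm : m ∈ M i) :
    m ∈ LinearMap.range (totalEval h hM) := by
  refine ⟨DirectSum.lof ℂ ι _ i (⟨m, hm⟩ ⊗ₜ ((1 : U21) • lowestVec _ _ _)), ?_⟩
  rw [totalEval, DirectSum.toModule_lof, evalMap_tmul_smul, one_smul]

/-- A vector of a weight that is not listed is orthogonal to all the listed weight spaces, hence to
the whole module and to itself. This is used to see that nothing lives in degree -1. -/
theorem IsUnitary.weightSpace_eq_bot (h : IsUnitary K) {κ : Type*} {a g : κ → ℂ}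
    (htop : ⨆ i, weightSpace K (a i) (g i) = ⊤) {a' g' : ℂ}
    (hne : ∀ i, a i ≠ a' ∨ g i ≠ g') : weightSpace K a' g' = ⊥ := by
  refine (Submodule.eq_bot_iff _).2 fun x hx => ?_
  rw [mem_weightSpace] at hx
  have hle : ⨆ i, weightSpace K (a i) (g i) ≤ (ℂ ∙ x)ᗮ := iSup_le fun i y hy => by
    rw [mem_weightSpace] at hy
    refine Submodule.mem_orthogonal_singleton_iff_inner_left.2 ?_
    rcases hne i with h1 | h1
    · exact inner_eq_zero_of_weight h.adj_H h1 hy.1 hx.1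
    · exact inner_eq_zero_of_weight h.adj_Z2 h1 hy.2 hx.2
  rw [htop] at hle
  exact inner_self_eq_zero.1
    (Submodule.mem_orthogonal_singleton_iff_inner_left.1 (hle (Submodule.mem_top (x := x))))

/-- A symmetric operator is diagonalisable on finite-dimensional stable subspaces. -/
theorem le_iSup_inf_eigenspace {K : Type*} [NormedAddCommGroup K] [InnerProductSpace ℂ K]
    {T : Module.End ℂ K} (hT : T.IsSymmetric) (P : Submodule ℂ K)
    [FiniteDimensional ℂ P] (hP : ∀ x ∈ P, T x ∈ P) :
    P ≤ ⨆ μ : ℂ, P ⊓ Module.End.eigenspace T μ := by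
  have hs := hT.restrict_invariant hP
  have htop : ⨆ μ : ℂ, Module.End.eigenspace (T.restrict hP) μ = ⊤ :=
    Submodule.orthogonal_eq_bot_iff.1 hs.orthogonalComplement_iSup_eigenspaces_eq_bot
  intro x hx
  have h1 : (⟨x, hx⟩ : P) ∈ ⨆ μ : ℂ, Module.End.eigenspace (T.restrict hP) μ :=
    htop ▸ Submodule.mem_top
  have h2 := Submodule.mem_map_of_mem (f := P.subtype) h1
  rw [Submodule.map_iSup] at h2
  have hle : ∀ μ : ℂ, (Module.End.eigenspace (T.restrict hP) μ).map P.subtype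
      ≤ P ⊓ Module.End.eigenspace T μ := ?_
  · exact iSup_mono hle h2
  intro μ
  rintro _ ⟨y, hy, rfl⟩
  exact ⟨y.2, Module.End.mem_eigenspace_iff.2
    (congrArg Subtype.val (Module.End.mem_eigenspace_iff.1 hy))⟩

/-- A unitary module graded by finite-dimensional weight spaces is generated by its lowest weight
vectors. -/
theorem totalEval_surjective (h : IsUnitary K)
    (hM : ∀ i, ∀ m ∈ M i, IsLowest (lam i) (ν i) (γ i) m) {a g : ℂ}
    (hfin : ∀ k l : ℕ, FiniteDimensional ℂ (weightSpace K (a + k) (g + l)))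
    (htop : ⨆ kl : ℕ × ℕ, weightSpace K (a + kl.1) (g + kl.2) = ⊤)
    (hlow : ∀ (k l : ℕ) (μ : ℂ) (x : K), x ∈ weightSpace K (a + k) (g + l) → uι Z1 • x = μ • x →
      uι Fm • x = 0 → uι Fbm • x = 0 → x ∈ ⨆ i, M i) :
    Function.Surjective (totalEval h hM) := by
  set R := LinearMap.range (totalEval h hM) with hR
  have hMR : ⨆ i, M i ≤ R := iSup_le fun i m hm => mem_range_totalEval h hM hm
  let P : Submodule ℂ K := LinearMap.ker (uAct K (uι Fm)) ⊓ LinearMap.ker (uAct K (uι Fbm))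
  have hlow' : ∀ k l : ℕ, ∀ x ∈ weightSpace K (a + k) (g + l), uι Fm • x = 0 → uι Fbm • x = 0 →
      x ∈ R := by
    intro k l x hx h1 h2
    have := hfin k l
    -- Z₁ commutes with H and Z₂ and preserves the kernels of F₋ and F̄₋. It is therefore
    -- diagonalisable on the lowest weight vectors of each weight.
    have hle := le_iSup_inf_eigenspace (T := uAct K (uι Z1)) h.adj_Z1
      (weightSpace K (a + k) (g + l) ⊓ P) (fun y hy => ⟨Z1_smul_mem_weightSpace hy.1, ?_, ?_⟩)
    · exact (hle.trans (iSup_le fun μ y hy => hMR (hlow k l μ y hy.1.1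
        (Module.End.mem_eigenspace_iff.1 hy.2) hy.1.2.1 hy.1.2.2))) ⟨hx, h1, h2⟩
    · have e := congrArg (· • y) uι_Z1Fm
      have h1 : uι Fm • y = 0 := hy.2.1
      simp only [sub_smul, mul_smul, h1, smul_zero, zero_sub, neg_eq_zero] at e
      exact e
    · have e := congrArg (· • y) uι_Z1Fbm
      have h1 : uι Fbm • y = 0 := hy.2.2
      simp only [sub_smul, mul_smul, neg_smul, h1, smul_zero, zero_sub, neg_zero, neg_eq_zero] at e
      exact e
  have hbot : ∀ g' : ℂ, weightSpace K (a + ((0 : ℕ) : ℂ) + -1) g' = ⊥ := fun g' =>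
    h.weightSpace_eq_bot htop fun kl => Or.inl fun e => by
      have : ((kl.1 + 1 : ℕ) : ℂ) = 0 := by push_cast at e ⊢; linear_combination e
      exact absurd (Nat.cast_eq_zero.1 this) (by omega)
  have hbot' : ∀ a' : ℂ, weightSpace K a' (g + ((0 : ℕ) : ℂ) + -1) = ⊥ := fun a' =>
    h.weightSpace_eq_bot htop fun kl => Or.inr fun e => by
      have : ((kl.2 + 1 : ℕ) : ℂ) = 0 := by push_cast at e ⊢; linear_combination e
      exact absurd (Nat.cast_eq_zero.1 this) (by omega)
  have key : ∀ k l : ℕ, weightSpace K (a + k) (g + l) ≤ R := by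
    intro k
    induction k with
    | zero =>
      intro l x hx
      refine hlow' 0 l x hx ?_ ?_
      · have := Fm_smul_mem_weightSpace hx
        rwa [hbot, Submodule.mem_bot] at this
      · have := Fbm_smul_mem_weightSpace hx
        rwa [hbot, Submodule.mem_bot] at this
    | succ k ih =>
      intro l x hx
      have := hfin (k + 1) l
      have : FiniteDimensional ℂ (R ⊓ weightSpace K (a + (k + 1 : ℕ)) (g + l) : Submodule ℂ K) :=
        Submodule.finiteDimensional_inf_right _ _
      -- Split off the part of the weight space that is already generated; the remainder y turns out
      -- to be a lowest weight vector.
      obtain ⟨x', hx', y, hy, rfl⟩ :=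
        (R ⊓ weightSpace K (a + (k + 1 : ℕ)) (g + l)).exists_add_mem_mem_orthogonal x
      have hyD : y ∈ weightSpace K (a + (k + 1 : ℕ)) (g + l) := by
        have := Submodule.sub_mem _ hx hx'.2
        rwa [add_sub_cancel_left] at this
      have hk : a + ((k + 1 : ℕ) : ℂ) + -1 = a + k := by push_cast; ring
      rw [Submodule.mem_orthogonal'] at hy
      -- (F₋y | F₋y) = (y | F̄₊F₋y). By induction F₋y lies in R, so F̄₊F₋y lies in R and has the
      -- weight of y, to which y is orthogonal.
      have hFm : uι Fm • y = 0 := by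
        rw [← inner_self_eq_zero (𝕜 := ℂ), h.adj_Fm]
        have h1 := Fm_smul_mem_weightSpace hyD
        have h2 := Fbp_smul_mem_weightSpace h1
        rw [hk, show g + (l : ℂ) + 1 = g + (l + 1 : ℕ) by push_cast; ring] at h1
        rw [neg_add_cancel_right, add_neg_cancel_right] at h2
        exact hy _ ⟨smul_mem_range_totalEval h hM _ (ih _ h1), h2⟩
      have hFbm : uι Fbm • y = 0 := by
        have h1 := Fbm_smul_mem_weightSpace hyD
        -- F₋ raises l, but F̄₋ lowers it, so for l = 0 there is no weight space left for the image.
        cases l with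
        | zero => rwa [hbot', Submodule.mem_bot] at h1
        | succ l =>
          have h2 := Fp_smul_mem_weightSpace h1
          rw [hk, show g + ((l + 1 : ℕ) : ℂ) + -1 = g + l by push_cast; ring] at h1
          rw [neg_add_cancel_right, neg_add_cancel_right] at h2
          rw [← inner_self_eq_zero (𝕜 := ℂ), h.adj_Fbm]
          exact hy _ ⟨smul_mem_range_totalEval h hM _ (ih _ h1), h2⟩
      exact R.add_mem hx'.1 (hlow' _ l y hyD hFm hFbm)
  rw [← LinearMap.range_eq_top, ← hR, eq_top_iff, ← htop]
  exact iSup_le fun kl => key kl.1 kl.2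

/-- The isotypic decomposition of a unitary module graded by finite-dimensional weight spaces. -/
theorem IsUnitary.exists_isotypic_decomposition (h : IsUnitary K)
    (hM : ∀ i, ∀ m ∈ M i, IsLowest (lam i) (ν i) (γ i) m)
    (hne : ∀ i j, i ≠ j → lam i ≠ lam j ∨ ν i ≠ ν j ∨ γ i ≠ γ j) {a g : ℂ}
    (hfin : ∀ k l : ℕ, FiniteDimensional ℂ (weightSpace K (a + k) (g + l)))
    (htop : ⨆ kl : ℕ × ℕ, weightSpace K (a + kl.1) (g + kl.2) = ⊤)
    (hMfin : ∀ i, FiniteDimensional ℂ (M i))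
    (hlow : ∀ (k l : ℕ) (μ : ℂ) (x : K), x ∈ weightSpace K (a + k) (g + l) →
      uι Z1 • x = μ • x → uι Fm • x = 0 → uι Fbm • x = 0 → x ∈ ⨆ i, M i) :
    (∀ i, M i ≠ ⊥ → IsSimpleModule U21 (LowestWeight (lam i) (ν i) (γ i))) ∧
    ∃ Φ : (⨁ i, M i ⊗[ℂ] LowestWeight (lam i) (ν i) (γ i)) ≃ₗ[ℂ] K,
      ∀ (i : ι) (m : M i) (u : U21),
        Φ (DirectSum.lof ℂ ι (fun i => M i ⊗[ℂ] LowestWeight (lam i) (ν i) (γ i)) i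
          (m ⊗ₜ[ℂ] (u • lowestVec _ _ _))) = u • (m : K) := by
  have hinj : Function.Injective (totalEval h hM) :=
    totalEval_injective h hM fun i j hij m hm m' hm' => by
      have h1 := hM i m hm
      have h2 := hM j m' hm'
      rcases hne i j hij with h3 | h3 | h3
      · exact inner_eq_zero_of_weight h.adj_H h3 h1.H h2.H
      · exact inner_eq_zero_of_weight h.adj_Z1 h3 h1.Z1 h2.Z1
      · exact inner_eq_zero_of_weight h.adj_Z2 h3 h1.Z2 h2.Z2
  have hbij : Function.Bijective (totalEval h hM) :=
    ⟨hinj, totalEval_surjective h hM hfin htop hlow⟩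
  refine ⟨fun i hi => ?_, LinearEquiv.ofBijective (totalEval h hM) hbij, fun i m u => ?_⟩
  · obtain ⟨m, hm, h0⟩ := Submodule.exists_mem_ne_zero_of_ne_bot hi
    exact isSimpleModule_lowestWeight (h.vermaVec_notMem (hM i m hm) h0)
  · rw [LinearEquiv.ofBijective_apply, totalEval, DirectSum.toModule_lof, evalMap_tmul_smul]

end Unitary

/-- The isotypic decomposition of a unitarisable module graded by finite-dimensional weight
spaces. -/
theorem exists_isotypic_decomposition {K : Type*} [AddCommGroup K] [Module ℂ K] [Module U21 K]
    [IsScalarTower ℂ U21 K] (form : InnerProductSpace.Core ℂ K)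
    (hFp : ∀ x y : K, form.inner (uι .Fp • x) y = form.inner x (uι .Fbm • y))
    (hFbp : ∀ x y : K, form.inner (uι .Fbp • x) y = form.inner x (uι .Fm • y))
    (hZ2 : ∀ x y : K, form.inner (uι .Z2 • x) y = form.inner x (uι .Z2 • y))
    {ι : Type*} [DecidableEq ι] {lam ν γ : ι → ℂ} {M : ι → Submodule ℂ K}
    (hM : ∀ i, ∀ m ∈ M i, IsLowest (lam i) (ν i) (γ i) m)
    (hne : ∀ i j, i ≠ j → lam i ≠ lam j ∨ ν i ≠ ν j ∨ γ i ≠ γ j) {a g : ℂ}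
    (hfin : ∀ k l : ℕ, FiniteDimensional ℂ (weightSpace K (a + k) (g + l)))
    (htop : ⨆ kl : ℕ × ℕ, weightSpace K (a + kl.1) (g + kl.2) = ⊤)
    (hMfin : ∀ i, FiniteDimensional ℂ (M i))
    (hlow : ∀ (k l : ℕ) (μ : ℂ) (x : K), x ∈ weightSpace K (a + k) (g + l) →
      uι .Z1 • x = μ • x → uι .Fm • x = 0 → uι .Fbm • x = 0 → x ∈ ⨆ i, M i) :
    (∀ i, M i ≠ ⊥ → IsSimpleModule U21 (LowestWeight (lam i) (ν i) (γ i))) ∧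
    ∃ Φ : (⨁ i, M i ⊗[ℂ] LowestWeight (lam i) (ν i) (γ i)) ≃ₗ[ℂ] K,
      ∀ (i : ι) (m : M i) (u : U21),
        Φ (DirectSum.lof ℂ ι (fun i => M i ⊗[ℂ] LowestWeight (lam i) (ν i) (γ i)) i
          (m ⊗ₜ[ℂ] (u • lowestVec _ _ _))) = u • (m : K) := by
  let _ := form.toNormedAddCommGroup
  let _ := InnerProductSpace.ofCore form.toCore
  exact IsUnitary.exists_isotypic_decomposition ⟨hFp, hFbp, hZ2⟩ hM hne hfin htop hMfin hlow

/-! ### Deducing the superbrackets of `gl(2|1)` -/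

section Superbrackets

open UGen

variable {A : Type*} [Ring A] [Algebra ℂ A]

theorem two_mul_cancel_of_algebra {x y : A} (h : 2 * x = 2 * y) : x = y := by
  have h2 : (2 : ℂ) • x = (2 : ℂ) • y := by rw [two_smul, two_smul, ← two_mul, ← two_mul, h]
  exact smul_right_injective A (two_ne_zero (α := ℂ)) h2

theorem superComm_superAnti {X a b : A} {p q : ℂ} (ha : superComm X a = p • a)
    (hb : superComm X b = q • b) : superComm X (superAnti a b) = (p + q) • superAnti a b := by
  have h : superComm X (superAnti a b) = superComm X a * b + a * superComm X b
      + (superComm X b * a + b * superComm X a) := by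
    simp only [superComm, superAnti]; noncomm_ring
  rw [h, ha, hb]
  simp only [superAnti, smul_mul_assoc, mul_smul_comm]
  module

theorem mul_self_eq_zero_of_superAnti {a : A} (ha : superAnti a a = 0) : a * a = 0 :=
  two_mul_cancel_of_algebra (by rw [mul_zero, two_mul]; exact ha)

/-- Since a² = 0, both (ab + ba)a and a(ab + ba) equal aba. This instance of the Jacobi identity
determines the brackets of Z₁ with the odd part and some of those of E₊ and E₋. -/
theorem superComm_superAnti_left {a b : A} (ha : superAnti a a = 0) :
    superComm (superAnti a b) a = 0 := by
  have := mul_self_eq_zero_of_superAnti ha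
  simp only [superComm, superAnti]
  linear_combination (norm := noncomm_ring) b * this - this * b

theorem superComm_superAnti_right {a b : A} (hb : superAnti b b = 0) :
    superComm (superAnti a b) b = 0 := by
  have := mul_self_eq_zero_of_superAnti hb
  simp only [superComm, superAnti]
  linear_combination (norm := noncomm_ring) a * this - this * a

/-- A part of the superbrackets of `gl(2|1)` that implies all of them. -/
structure SuperRelations (r : UGen → A) : Prop where
  FpFp : superAnti (r Fp) (r Fp) = 0
  FmFm : superAnti (r Fm) (r Fm) = 0
  FbpFbp : superAnti (r Fbp) (r Fbp) = 0
  FbmFbm : superAnti (r Fbm) (r Fbm) = 0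
  FpFm : superAnti (r Fp) (r Fm) = 0
  FbpFbm : superAnti (r Fbp) (r Fbm) = 0
  FpFbp : superAnti (r Fp) (r Fbp) = 2 * r Ep
  FmFbm : superAnti (r Fm) (r Fbm) = -(2 * r Em)
  FpFbm : superAnti (r Fp) (r Fbm) = r H - (2 * r Z2 - r Z1)
  FmFbp : superAnti (r Fm) (r Fbp) = r H + (2 * r Z2 - r Z1)
  HFp : superComm (r H) (r Fp) = r Fp
  HFbp : superComm (r H) (r Fbp) = r Fbp
  HFm : superComm (r H) (r Fm) = -r Fm
  HFbm : superComm (r H) (r Fbm) = -r Fbm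
  Z2Fp : superComm (r Z2) (r Fp) = r Fp
  Z2Fbp : superComm (r Z2) (r Fbp) = -r Fbp
  Z2Fm : superComm (r Z2) (r Fm) = r Fm
  Z2Fbm : superComm (r Z2) (r Fbm) = -r Fbm

namespace SuperRelations

variable {r : UGen → A} (h : SuperRelations r)
include h

/-- {F₊, F̄₋} = H - 2Z₂ + Z₁ commutes with F₊, so the weight of F₊ under Z₁ is 2·1 - 1 = 1. The next
three brackets follow in the same way from whichever mixed anticommutator involves the odd element.
-/
theorem Z1Fp : superComm (r Z1) (r Fp) = r Fp := by
  have h1 := superComm_superAnti_left (b := r Fbm) h.FpFp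
  rw [h.FpFbm] at h1
  have h2 := h.HFp
  have h3 := h.Z2Fp
  simp only [superComm] at *
  linear_combination (norm := noncomm_ring) h1 - h2 + 2 * h3

theorem Z1Fbm : superComm (r Z1) (r Fbm) = -r Fbm := by
  have h1 := superComm_superAnti_right (a := r Fp) h.FbmFbm
  rw [h.FpFbm] at h1
  have h2 := h.HFbm
  have h3 := h.Z2Fbm
  simp only [superComm] at *
  linear_combination (norm := noncomm_ring) h1 - h2 + 2 * h3

theorem Z1Fm : superComm (r Z1) (r Fm) = r Fm := by
  have h1 := superComm_superAnti_left (b := r Fbp) h.FmFm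
  rw [h.FmFbp] at h1
  have h2 := h.HFm
  have h3 := h.Z2Fm
  simp only [superComm] at *
  linear_combination (norm := noncomm_ring) h2 - h1 + 2 * h3

theorem Z1Fbp : superComm (r Z1) (r Fbp) = -r Fbp := by
  have h1 := superComm_superAnti_right (a := r Fm) h.FbpFbp
  rw [h.FmFbp] at h1
  have h2 := h.HFbp
  have h3 := h.Z2Fbp
  simp only [superComm] at *
  linear_combination (norm := noncomm_ring) h2 - h1 + 2 * h3

theorem EpFp : superComm (r Ep) (r Fp) = 0 := two_mul_cancel_of_algebra <| by
  have h1 := superComm_superAnti_left (b := r Fbp) h.FpFp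
  rw [h.FpFbp] at h1
  simp only [superComm] at *
  linear_combination (norm := noncomm_ring) h1

theorem EpFbp : superComm (r Ep) (r Fbp) = 0 := two_mul_cancel_of_algebra <| by
  have h1 := superComm_superAnti_right (a := r Fp) h.FbpFbp
  rw [h.FpFbp] at h1
  simp only [superComm] at *
  linear_combination (norm := noncomm_ring) h1

theorem EmFm : superComm (r Em) (r Fm) = 0 := two_mul_cancel_of_algebra <| by
  have h1 := superComm_superAnti_left (b := r Fbm) h.FmFm
  rw [h.FmFbm] at h1
  simp only [superComm] at *
  linear_combination (norm := noncomm_ring) -h1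

theorem EmFbm : superComm (r Em) (r Fbm) = 0 := two_mul_cancel_of_algebra <| by
  have h1 := superComm_superAnti_right (a := r Fm) h.FbmFbm
  rw [h.FmFbm] at h1
  simp only [superComm] at *
  linear_combination (norm := noncomm_ring) -h1

/-- Jacobi identity: as {F₊, F₋} = 0, the bracket of 2E₊ = {F₊, F̄₊} with F₋ is [F₊, {F₋, F̄₊}] =
-[H + 2Z₂ - Z₁, F₊] = -2F₊. The next three brackets are obtained in the same way. -/
theorem EpFm : superComm (r Ep) (r Fm) = -r Fp := two_mul_cancel_of_algebra <| by
  have h0 := h.FpFbp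
  have h1 := h.FpFm
  have h2 := h.FmFbp
  have h3 := h.HFp
  have h4 := h.Z2Fp
  have h5 := h.Z1Fp
  simp only [superComm, superAnti] at *
  linear_combination (norm := noncomm_ring) r Fm * h0 - h0 * r Fm + r Fp * h2 - h2 * r Fp
    + r Fbp * h1 - h1 * r Fbp - h3 - 2 * h4 + h5

theorem EpFbm : superComm (r Ep) (r Fbm) = -r Fbp := two_mul_cancel_of_algebra <| by
  have h0 := h.FpFbp
  have h1 := h.FbpFbm
  have h2 := h.FpFbm
  have h3 := h.HFbp
  have h4 := h.Z2Fbp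
  have h5 := h.Z1Fbp
  simp only [superComm, superAnti] at *
  linear_combination (norm := noncomm_ring) r Fbm * h0 - h0 * r Fbm + r Fbp * h2 - h2 * r Fbp
    + r Fp * h1 - h1 * r Fp - h3 + 2 * h4 - h5

theorem EmFp : superComm (r Em) (r Fp) = -r Fm := two_mul_cancel_of_algebra <| by
  have h0 := h.FmFbm
  have h1 := h.FpFm
  have h2 := h.FpFbm
  have h3 := h.HFm
  have h4 := h.Z2Fm
  have h5 := h.Z1Fm
  simp only [superComm, superAnti] at *
  linear_combination (norm := noncomm_ring) h0 * r Fp - r Fp * h0 - r Fm * h2 + h2 * r Fm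
    - r Fbm * h1 + h1 * r Fbm + h3 - 2 * h4 + h5

theorem EmFbp : superComm (r Em) (r Fbp) = -r Fbm := two_mul_cancel_of_algebra <| by
  have h0 := h.FmFbm
  have h1 := h.FbpFbm
  have h2 := h.FmFbp
  have h3 := h.HFbm
  have h4 := h.Z2Fbm
  have h5 := h.Z1Fbm
  simp only [superComm, superAnti] at *
  linear_combination (norm := noncomm_ring) h0 * r Fbp - r Fbp * h0 - r Fbm * h2 + h2 * r Fbm
    - r Fm * h1 + h1 * r Fm + h3 + 2 * h4 - h5

/-- The bracket of `E₊` and `E₋` with an element acting diagonally on the odd part, and the fact that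
such an element commutes with the diagonal part. -/
theorem weight_even {X : A} {p q : ℂ} (h1 : superComm X (r Fp) = (p + q) • r Fp)
    (h2 : superComm X (r Fbp) = (p - q) • r Fbp) (h3 : superComm X (r Fm) = (q - p) • r Fm)
    (h4 : superComm X (r Fbm) = (-q - p) • r Fbm) :
    superComm X (r Ep) = (2 * p) • r Ep ∧ superComm X (r Em) = (-(2 * p)) • r Em ∧
      superComm X (r H) = 0 ∧ superComm X (2 * r Z2 - r Z1) = 0 := by
  -- Weights add in anticommutators. In terms of p and q, the pairs producing E₊ and E₋ have total
  -- weights 2p and -2p, and the two mixed pairs have total weight 0.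
  have e1 := superComm_superAnti h1 h2
  have e2 := superComm_superAnti h3 h4
  have e3 := superComm_superAnti h1 h4
  have e4 := superComm_superAnti h3 h2
  rw [h.FpFbp, show p + q + (p - q) = 2 * p by ring] at e1
  rw [h.FmFbm, show q - p + (-q - p) = -(2 * p) by ring] at e2
  rw [h.FpFbm, show p + q + (-q - p) = 0 by ring, zero_smul] at e3
  rw [h.FmFbp, show q - p + (p - q) = 0 by ring, zero_smul] at e4
  refine ⟨two_mul_cancel_of_algebra ?_, two_mul_cancel_of_algebra ?_,
    two_mul_cancel_of_algebra ?_, two_mul_cancel_of_algebra ?_⟩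
  · rw [mul_smul_comm, ← e1]; simp only [superComm]; noncomm_ring
  · rw [mul_smul_comm, ← neg_inj, ← smul_neg, ← e2]; simp only [superComm]; noncomm_ring
  · simp only [superComm] at *; linear_combination (norm := noncomm_ring) e3 + e4
  · simp only [superComm] at *; linear_combination (norm := noncomm_ring) e4 - e3

theorem weight_H : superComm (r H) (r Ep) = 2 * r Ep ∧ superComm (r H) (r Em) = -(2 * r Em) := by
  obtain ⟨h1, h2, -⟩ := h.weight_even (X := r H) (p := 1) (q := 0) (by simpa using h.HFp)
    (by simpa using h.HFbp) (by simpa using h.HFm) (by simpa using h.HFbm)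
  refine ⟨h1.trans ?_, h2.trans ?_⟩
  · rw [mul_one, two_smul, two_mul]
  · rw [mul_one, neg_smul, two_smul, two_mul]

theorem weight_Z1 : superComm (r Z1) (r Ep) = 0 ∧ superComm (r Z1) (r Em) = 0 ∧
    superComm (r Z1) (r H) = 0 ∧ superComm (r Z1) (2 * r Z2 - r Z1) = 0 := by
  have := h.weight_even (X := r Z1) (p := 0) (q := 1) (by simpa using h.Z1Fp)
    (by simpa using h.Z1Fbp) (by simpa using h.Z1Fm) (by simpa using h.Z1Fbm)
  simpa using this

theorem weight_Z2 : superComm (r Z2) (r Ep) = 0 ∧ superComm (r Z2) (r Em) = 0 ∧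
    superComm (r Z2) (r H) = 0 := by
  have := h.weight_even (X := r Z2) (p := 0) (q := 1) (by simpa using h.Z2Fp)
    (by simpa using h.Z2Fbp) (by simpa using h.Z2Fm) (by simpa using h.Z2Fbm)
  obtain ⟨h1, h2, h3, -⟩ := this
  exact ⟨by simpa using h1, by simpa using h2, h3⟩

theorem Z1Z2 : superComm (r Z1) (r Z2) = 0 := two_mul_cancel_of_algebra <| by
  have := h.weight_Z1.2.2.2
  simp only [superComm] at *
  linear_combination (norm := noncomm_ring) this

/-- ad E₊ is a derivation with F₋ ↦ -F₊ and F̄₋ ↦ -F̄₊. Applied to -2E₋ = {F₋, F̄₋} it gives -({F₊,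
F̄₋} + {F₋, F̄₊}) = -2H. -/
theorem EpEm : superComm (r Ep) (r Em) = r H := two_mul_cancel_of_algebra <| by
  have h0 := h.FmFbm
  have h1 := h.EpFm
  have h2 := h.EpFbm
  have h3 := h.FpFbm
  have h4 := h.FmFbp
  simp only [superComm, superAnti] at *
  linear_combination (norm := noncomm_ring) r Ep * h0 - h0 * r Ep - r Fm * h2 - h1 * r Fbm
    - r Fbm * h1 - h2 * r Fm + h3 + h4

theorem lift_eq_of_rel {a b : FreeAlgebra ℂ UGen} (hab : URel a b) :
    FreeAlgebra.lift ℂ r a = FreeAlgebra.lift ℂ r b := by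
  have h2 : FreeAlgebra.lift ℂ r 2 = 2 := map_ofNat _ 2
  cases hab <;> simp only [superComm, superAnti, ugZ, map_add, map_sub, map_mul, map_neg, map_zero,
    FreeAlgebra.lift_ι_apply, h2]
  exacts [h.EpEm, h.weight_H.1, h.weight_H.2, h.weight_Z1.1, h.weight_Z1.2.1, h.weight_Z1.2.2.1,
    h.weight_Z2.1, h.weight_Z2.2.1, h.weight_Z2.2.2, h.Z1Z2, h.FpFp, h.FmFm, h.FbpFbp, h.FbmFbm,
    h.FpFm, h.FbpFbm, h.FpFbp, h.FmFbm, h.FpFbm, h.FmFbp, h.EpFp, h.EpFbp, h.EpFm, h.EpFbm, h.EmFp,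
    h.EmFbp, h.EmFm, h.EmFbm, h.HFp, h.HFbp, h.HFm, h.HFbm, h.Z1Fp, h.Z1Fbp, h.Z1Fm, h.Z1Fbm,
    h.Z2Fp, h.Z2Fbp, h.Z2Fm, h.Z2Fbm]

end SuperRelations

/-- The representation of the enveloping superalgebra determined by elements satisfying the
superbracket relations. -/
def SuperRelations.lift {r : UGen → A} (h : SuperRelations r) : U21 →ₐ[ℂ] A :=
  RingQuot.liftAlgHom ℂ ⟨FreeAlgebra.lift ℂ r, fun _ _ hab => h.lift_eq_of_rel hab⟩

theorem SuperRelations.lift_uι {r : UGen → A} (h : SuperRelations r) (g : UGen) :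
    h.lift (uι g) = r g := by
  change RingQuot.liftAlgHom ℂ _ (RingQuot.mkAlgHom ℂ URel (FreeAlgebra.ι ℂ g)) = _
  rw [RingQuot.liftAlgHom_mkAlgHom_apply, FreeAlgebra.lift_ι_apply]

end Superbrackets

/-! ### The rational Cherednik algebra -/

section CherednikRelations

variable {E : Type*} [NormedAddCommGroup E] [InnerProductSpace ℝ E]
  (G : Subgroup (E ≃ₗᵢ[ℝ] E))

open scoped RealInnerProductSpace

variable {G} in
theorem root_ne_zero (s : Refl G) : root s ≠ 0 := s.2.choose_spec.1

variable {G} in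
theorem coe_refl_eq (s : Refl G) : (s.1 : E ≃ₗᵢ[ℝ] E) = (ℝ ∙ root s)ᗮ.reflection :=
  s.2.choose_spec.2

variable {G} in
theorem coroot_apply (s : Refl G) (v : E) : coroot s v = ⟪root s, v⟫ := rfl

variable {G} in
theorem inner_root_self_ne_zero (s : Refl G) : ⟪root s, root s⟫ ≠ 0 :=
  inner_self_ne_zero.2 (root_ne_zero s)

theorem reflection_orthogonal_singleton_apply (α v : E) :
    (ℝ ∙ α)ᗮ.reflection v = v - (2 * ⟪α, v⟫ / ⟪α, α⟫) • α := by
  rw [Submodule.reflection_orthogonal_apply, Submodule.reflection_singleton_apply,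
    neg_sub, real_inner_self_eq_norm_sq, ← Nat.cast_smul_eq_nsmul ℝ, smul_smul, mul_div_assoc]
  rfl

variable {G} in
theorem refl_apply (s : Refl G) (v : E) :
    (s.1 : E ≃ₗᵢ[ℝ] E) v = v - (2 * ⟪root s, v⟫ / ⟪root s, root s⟫) • root s := by
  rw [coe_refl_eq, reflection_orthogonal_singleton_apply]

variable {G} in
theorem refl_inv_apply (s : Refl G) (v : E) :
    ((s.1 : E ≃ₗᵢ[ℝ] E)⁻¹) v = v - (2 * ⟪root s, v⟫ / ⟪root s, root s⟫) • root s := by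
  rw [← refl_apply]
  conv_rhs => rw [coe_refl_eq]
  conv_lhs => rw [coe_refl_eq]
  rw [Submodule.reflection_inv]

variable {G} in
theorem dualAct_refl (s : Refl G) (x : Module.Dual ℝ E) :
    dualAct (s.1 : E ≃ₗᵢ[ℝ] E) x = x - (2 * x (root s) / ⟪root s, root s⟫) • coroot s := by
  ext v
  change x (((s.1 : E ≃ₗᵢ[ℝ] E)⁻¹) v) = _
  rw [refl_inv_apply, map_sub, map_smul, LinearMap.sub_apply, LinearMap.smul_apply, coroot_apply,
    smul_eq_mul, smul_eq_mul]
  ring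

variable (c : Refl G → ℝ)

/-- `c(s) / ⟨a_s, α_s⟩` -/
def reflCoeff (s : Refl G) : ℂ := c s / (⟪root s, root s⟫ : ℝ)

theorem c_eq (s : Refl G) : (c s : ℂ) = reflCoeff G c s * (⟪root s, root s⟫ : ℝ) := by
  rw [reflCoeff, div_mul_cancel₀]
  exact_mod_cast inner_root_self_ne_zero s

variable [Finite G]

theorem cherMk_eq_of_rel {a b : FreeAlgebra ℂ (CherGen G)} (h : CherRel G c a b) :
    cherMk G c a = cherMk G c b := RingQuot.mkAlgHom_rel ℂ h

theorem hVec_add (ξ η : E) : hVec G c (ξ + η) = hVec G c ξ + hVec G c η := by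
  rw [hVec, cherMk_eq_of_rel G c (.vec_add ξ η), map_add]; rfl

theorem hVec_smul (r : ℝ) (ξ : E) : hVec G c (r • ξ) = (r : ℂ) • hVec G c ξ := by
  rw [hVec, cherMk_eq_of_rel G c (.vec_smul r ξ), map_smul]; rfl

theorem hCov_add (x y : Module.Dual ℝ E) : hCov G c (x + y) = hCov G c x + hCov G c y := by
  rw [hCov, cherMk_eq_of_rel G c (.cov_add x y), map_add]; rfl

theorem hCov_smul (r : ℝ) (x : Module.Dual ℝ E) :
    hCov G c (r • x) = (r : ℂ) • hCov G c x := by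
  rw [hCov, cherMk_eq_of_rel G c (.cov_smul r x), map_smul]; rfl

theorem hVec_sub_smul (ξ η : E) (r : ℝ) :
    hVec G c (ξ - r • η) = hVec G c ξ - (r : ℂ) • hVec G c η := by
  rw [eq_sub_iff_add_eq, ← hVec_smul, ← hVec_add, sub_add_cancel]

theorem hCov_sub_smul (x y : Module.Dual ℝ E) (r : ℝ) :
    hCov G c (x - r • y) = hCov G c x - (r : ℂ) • hCov G c y := by
  rw [eq_sub_iff_add_eq, ← hCov_smul, ← hCov_add, sub_add_cancel]

theorem hGrp_mul_hVec (g : G) (ξ : E) :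
    hGrp G c g * hVec G c ξ = hVec G c ((g : E ≃ₗᵢ[ℝ] E) ξ) * hGrp G c g := by
  have := cherMk_eq_of_rel G c (.grp_vec g ξ)
  rwa [map_mul, map_mul] at this

theorem hGrp_mul_hCov (g : G) (x : Module.Dual ℝ E) :
    hGrp G c g * hCov G c x = hCov G c (dualAct (g : E ≃ₗᵢ[ℝ] E) x) * hGrp G c g := by
  have := cherMk_eq_of_rel G c (.grp_cov g x)
  rwa [map_mul, map_mul] at this

theorem hVec_comm (ξ η : E) : hVec G c ξ * hVec G c η = hVec G c η * hVec G c ξ := by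
  have := cherMk_eq_of_rel G c (.vec_comm ξ η)
  rwa [map_mul, map_mul] at this

theorem hCov_comm (x y : Module.Dual ℝ E) : hCov G c x * hCov G c y = hCov G c y * hCov G c x := by
  have := cherMk_eq_of_rel G c (.cov_comm x y)
  rwa [map_mul, map_mul] at this

/-- Linear combinations of the reflections inside `H_c`. -/
def reflSum : (Refl G → ℂ) →ₗ[ℂ] Cherednik G c :=
  Fintype.linearCombination ℂ fun s : Refl G => hGrp G c s.1

theorem reflSum_apply (t : Refl G → ℂ) : reflSum G c t = ∑ s : Refl G, t s • hGrp G c s.1 := rfl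

theorem hVec_mul_hCov (ξ : E) (x : Module.Dual ℝ E) :
    hVec G c ξ * hCov G c x = hCov G c x * hVec G c ξ + (x ξ : ℂ) • 1
      - reflSum G c fun s => 2 * reflCoeff G c s * (x (root s) : ℂ) * (⟪root s, ξ⟫ : ℝ) := by
  have := cherMk_eq_of_rel G c (.vec_cov ξ x)
  rw [map_sub, map_sub, map_mul, map_mul, AlgHom.commutes, map_smul, map_sum] at this
  rw [add_sub_assoc, ← sub_eq_iff_eq_add']
  refine this.trans ?_
  rw [reflSum_apply, Finset.smul_sum, Algebra.algebraMap_eq_smul_one]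
  congr 1
  refine Finset.sum_congr rfl fun s _ => ?_
  rw [map_smul, smul_smul]
  change _ • hGrp G c s.1 = _
  congr 1
  rw [coroot_apply, coroot_apply, reflCoeff]
  push_cast
  ring

theorem hCov_sum_smul {κ : Type*} (I : Finset κ) (r : κ → ℝ) (x : κ → Module.Dual ℝ E) :
    hCov G c (∑ i ∈ I, r i • x i) = ∑ i ∈ I, (r i : ℂ) • hCov G c (x i) := by
  have h0 : hCov G c 0 = 0 := by simpa using hCov_smul G c 0 0
  classical
  induction I using Finset.induction_on with
  | empty => simpa using h0
  | insert i s hi ih => rw [Finset.sum_insert hi, Finset.sum_insert hi, hCov_add, hCov_smul, ih]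

theorem hVec_sum_smul {κ : Type*} (I : Finset κ) (r : κ → ℝ) (x : κ → E) :
    hVec G c (∑ i ∈ I, r i • x i) = ∑ i ∈ I, (r i : ℂ) • hVec G c (x i) := by
  have h0 : hVec G c 0 = 0 := by simpa using hVec_smul G c 0 0
  classical
  induction I using Finset.induction_on with
  | empty => simpa using h0
  | insert i s hi ih => rw [Finset.sum_insert hi, Finset.sum_insert hi, hVec_add, hVec_smul, ih]

/-! ### The Euler element and its correction by σ -/

section Basis

variable {κ : Type*} [Fintype κ] (b : OrthonormalBasis κ ℝ E)

theorem coord_apply_eq_inner (i : κ) (v : E) : b.toBasis.coord i v = ⟪b i, v⟫ := by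
  simp [Module.Basis.coord_apply, OrthonormalBasis.repr_apply_apply]

theorem hCov_eq_sum (x : Module.Dual ℝ E) :
    hCov G c x = ∑ i, (x (b i) : ℂ) • hCov G c (b.toBasis.coord i) := by
  rw [← hCov_sum_smul]
  congr 1
  refine b.toBasis.ext fun j => ?_
  classical
  simp [LinearMap.sum_apply]

theorem hVec_eq_sum (v : E) : hVec G c v = ∑ i, (⟪b i, v⟫ : ℂ) • hVec G c (b i) := by
  rw [← hVec_sum_smul, b.sum_repr' v]

/-- The Euler element `∑ x_i ξ_i` for an orthonormal basis. -/
def euler : Cherednik G c := ∑ i, hCov G c (b.toBasis.coord i) * hVec G c (b i)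

/-- The commutator of the Euler element with x is x minus a sum over reflections coming from [ξ_i,
x]. That sum is reproduced by σ, because s x = s(x) s and s(x) - x is a multiple of a_s. -/
theorem superComm_euler_sub_sigma_hCov (x : Module.Dual ℝ E) :
    superComm (euler G c b - sigma G c) (hCov G c x) = hCov G c x := by
  have h1 : superComm (euler G c b) (hCov G c x) = hCov G c x
      - ∑ s : Refl G, (2 * reflCoeff G c s * (x (root s) : ℂ)) •
        (hCov G c (coroot s) * hGrp G c s.1) := by
    have : superComm (euler G c b) (hCov G c x) = ∑ i, hCov G c (b.toBasis.coord i) *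
        superComm (hVec G c (b i)) (hCov G c x) := by
      simp only [superComm, euler, Finset.sum_mul, Finset.mul_sum, mul_sub,
        Finset.sum_sub_distrib, ← mul_assoc, hCov_comm G c x]
    rw [this]
    have h2 : ∀ i, hCov G c (b.toBasis.coord i) * superComm (hVec G c (b i)) (hCov G c x)
        = (x (b i) : ℂ) • hCov G c (b.toBasis.coord i) - ∑ s : Refl G,
          (2 * reflCoeff G c s * (x (root s) : ℂ)) •
            (((coroot s (b i) : ℝ) : ℂ) • hCov G c (b.toBasis.coord i) * hGrp G c s.1) := by
      intro i
      rw [superComm, hVec_mul_hCov, add_sub_assoc, add_sub_cancel_left, mul_sub, reflSum_apply,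
        Finset.mul_sum, mul_smul_comm, mul_one]
      congr 1
      refine Finset.sum_congr rfl fun s _ => ?_
      rw [mul_smul_comm, smul_mul_assoc, smul_smul, coroot_apply]
    rw [Finset.sum_congr rfl fun i _ => h2 i, Finset.sum_sub_distrib, ← hCov_eq_sum,
      Finset.sum_comm]
    congr 1
    refine Finset.sum_congr rfl fun s _ => ?_
    rw [← Finset.smul_sum, ← Finset.sum_mul, ← hCov_eq_sum]
  have h3 : superComm (sigma G c) (hCov G c x) =
      - ∑ s : Refl G, (2 * reflCoeff G c s * (x (root s) : ℂ)) •
        (hCov G c (coroot s) * hGrp G c s.1) := by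
    rw [superComm, sigma, Finset.sum_mul, Finset.mul_sum, ← Finset.sum_sub_distrib,
      ← Finset.sum_neg_distrib]
    refine Finset.sum_congr rfl fun s _ => ?_
    rw [smul_mul_assoc, hGrp_mul_hCov, dualAct_refl, hCov_sub_smul, mul_smul_comm, sub_mul,
      smul_sub, sub_sub_cancel_left, smul_mul_assoc, smul_smul]
    congr 1
    rw [reflCoeff]
    push_cast
    ring_nf
  rw [show superComm (euler G c b - sigma G c) (hCov G c x) = superComm (euler G c b) (hCov G c x)
    - superComm (sigma G c) (hCov G c x) by simp only [superComm]; noncomm_ring, h1, h3]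
  abel

theorem superComm_euler_sub_sigma_hVec (ξ : E) :
    superComm (euler G c b - sigma G c) (hVec G c ξ) = -hVec G c ξ := by
  have h1 : superComm (euler G c b) (hVec G c ξ) = -hVec G c ξ
      + ∑ s : Refl G, (2 * reflCoeff G c s * (⟪root s, ξ⟫ : ℝ)) •
        (hGrp G c s.1 * hVec G c (root s)) := by
    have : superComm (euler G c b) (hVec G c ξ) = ∑ i,
        -superComm (hVec G c ξ) (hCov G c (b.toBasis.coord i)) * hVec G c (b i) := by
      simp only [superComm, euler, Finset.sum_mul, Finset.mul_sum, sub_mul, neg_sub,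
        Finset.sum_sub_distrib, mul_assoc, hVec_comm G c ξ]
    rw [this]
    have h2 : ∀ i, -superComm (hVec G c ξ) (hCov G c (b.toBasis.coord i)) * hVec G c (b i)
        = -((⟪b i, ξ⟫ : ℂ) • hVec G c (b i)) + ∑ s : Refl G,
          (2 * reflCoeff G c s * (⟪root s, ξ⟫ : ℝ)) •
            (hGrp G c s.1 * (⟪b i, root s⟫ : ℂ) • hVec G c (b i)) := by
      intro i
      rw [superComm, hVec_mul_hCov, add_sub_assoc, add_sub_cancel_left, neg_sub, sub_mul,
        reflSum_apply, Finset.sum_mul, smul_mul_assoc, one_mul, coord_apply_eq_inner,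
        sub_eq_neg_add]
      congr 1
      refine Finset.sum_congr rfl fun s _ => ?_
      rw [mul_smul_comm, smul_mul_assoc, smul_smul, coord_apply_eq_inner]
      congr 1
      ring
    rw [Finset.sum_congr rfl fun i _ => h2 i, Finset.sum_add_distrib, Finset.sum_neg_distrib,
      ← hVec_eq_sum, Finset.sum_comm]
    congr 1
    refine Finset.sum_congr rfl fun s _ => ?_
    rw [← Finset.smul_sum, ← Finset.mul_sum, ← hVec_eq_sum]
  have h3 : superComm (sigma G c) (hVec G c ξ) =
      ∑ s : Refl G, (2 * reflCoeff G c s * (⟪root s, ξ⟫ : ℝ)) •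
        (hGrp G c s.1 * hVec G c (root s)) := by
    rw [superComm, sigma, Finset.sum_mul, Finset.mul_sum, ← Finset.sum_sub_distrib]
    refine Finset.sum_congr rfl fun s _ => ?_
    -- As s is an involution, ξ s = s · s(ξ). This puts the group element on the left, as in `h1`.
    have h4 : hVec G c ξ * hGrp G c s.1 = hGrp G c s.1 * hVec G c ((s.1 : E ≃ₗᵢ[ℝ] E) ξ) := by
      rw [hGrp_mul_hVec]
      congr 2
      rw [coe_refl_eq, Submodule.reflection_reflection]
    rw [smul_mul_assoc, mul_smul_comm, h4, refl_apply, hVec_sub_smul, mul_sub, mul_smul_comm, smul_sub,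
      sub_sub_cancel, smul_smul]
    congr 1
    rw [reflCoeff]
    push_cast
    ring
  rw [show superComm (euler G c b - sigma G c) (hVec G c ξ) = superComm (euler G c b) (hVec G c ξ)
    - superComm (sigma G c) (hVec G c ξ) by simp only [superComm]; noncomm_ring, h1, h3]
  abel

end Basis

end CherednikRelations

/-! ### The Clifford algebra -/

section CliffordRelations

variable {E : Type*} [NormedAddCommGroup E] [InnerProductSpace ℝ E]

open scoped RealInnerProductSpace

theorem cl_add (v w : E) : cl (v + w) = cl v + cl w := by
  rw [cl, TensorProduct.tmul_add, map_add]; rfl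

theorem cl_smul (r : ℝ) (v : E) : cl (r • v) = (r : ℂ) • cl v := by
  rw [cl, cl, TensorProduct.tmul_smul, ← map_smul]
  congr 1

theorem cl_mul_add_swap (v w : E) : cl v * cl w + cl w * cl v = (2 * ⟪v, w⟫ : ℂ) • 1 := by
  rw [cl, cl, CliffordAlgebra.ι_mul_ι_add_swap, Algebra.algebraMap_eq_smul_one]
  congr 1
  have h : ∀ v : E, quadC E (1 ⊗ₜ[ℝ] v) = ((⟪v, v⟫ : ℝ) : ℂ) := fun v => by
    simp [quadC]
  rw [QuadraticMap.polar, ← TensorProduct.tmul_add, h, h, h, inner_add_left, inner_add_right,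
    inner_add_right, real_inner_comm v w]
  push_cast
  ring

theorem cl_sum_smul {κ : Type*} (I : Finset κ) (r : κ → ℝ) (x : κ → E) :
    cl (∑ i ∈ I, r i • x i) = ∑ i ∈ I, (r i : ℂ) • cl (x i) := by
  have h0 : cl (0 : E) = 0 := by simpa using cl_smul 0 (0 : E)
  classical
  induction I using Finset.induction_on with
  | empty => simpa using h0
  | insert i s hi ih => rw [Finset.sum_insert hi, Finset.sum_insert hi, cl_add, cl_smul, ih]

/-- The anticommutator of `cl v + t cl v'` and `cl w + u cl w'`. -/
theorem cl_complex_anti (v v' w w' : E) (t u : ℂ) :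
    (cl v + t • cl v') * (cl w + u • cl w') + (cl w + u • cl w') * (cl v + t • cl v')
      = (2 * (⟪v, w⟫ + u * ⟪v, w'⟫ + t * ⟪v', w⟫ + t * u * ⟪v', w'⟫) : ℂ) • 1 := by
  have h : (cl v + t • cl v') * (cl w + u • cl w') + (cl w + u • cl w') * (cl v + t • cl v')
      = (cl v * cl w + cl w * cl v) + u • (cl v * cl w' + cl w' * cl v)
        + t • (cl v' * cl w + cl w * cl v') + (t * u) • (cl v' * cl w' + cl w' * cl v') := by
    simp only [mul_add, add_mul, smul_mul_assoc, mul_smul_comm, smul_add, smul_smul, mul_comm u t]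
    abel
  rw [h]
  simp only [cl_mul_add_swap]
  module

variable {n : ℕ} (b : OrthonormalBasis (Fin n ⊕ Fin n) ℝ E)

theorem f_eq (j : Fin n) :
    f b j = (1 / 2 : ℂ) • (cl (b (.inl j)) + (-Complex.I) • cl (b (.inr j))) := by
  rw [f, neg_smul, sub_eq_add_neg]

theorem inner_basis (i j : Fin n ⊕ Fin n) : ⟪b i, b j⟫ = if i = j then 1 else 0 :=
  orthonormal_iff_ite.1 b.orthonormal i j

theorem f_mul_f (j k : Fin n) : f b j * f b k + f b k * f b j = 0 := by
  rw [f_eq, f_eq, smul_mul_smul_comm, smul_mul_smul_comm, ← smul_add, cl_complex_anti]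
  simp [inner_basis]

theorem fd_mul_fd (j k : Fin n) : fd b j * fd b k + fd b k * fd b j = 0 := by
  rw [fd, fd, smul_mul_smul_comm, smul_mul_smul_comm, ← smul_add, cl_complex_anti]
  simp [inner_basis]

theorem fd_mul_f (j k : Fin n) :
    fd b j * f b k + f b k * fd b j = (if j = k then (1 : ℂ) else 0) • 1 := by
  rw [fd, f_eq, smul_mul_smul_comm, smul_mul_smul_comm, ← smul_add, cl_complex_anti, smul_smul]
  congr 1
  by_cases h : j = k <;> simp [h]; norm_num

theorem cl_inl (j : Fin n) : cl (b (.inl j)) = f b j + fd b j := by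
  rw [f, fd]; module

theorem cl_inr (j : Fin n) : cl (b (.inr j)) = Complex.I • (f b j - fd b j) := by
  have : f b j - fd b j = (-Complex.I) • cl (b (.inr j)) := by
    rw [f, fd]; module
  rw [this, smul_smul, mul_neg, Complex.I_mul_I, neg_neg, one_smul]

/-- The complex coordinate `⟨z_j, v⟩`. -/
def zCoord (v : E) (j : Fin n) : ℂ := ⟪b (.inl j), v⟫ + Complex.I * ⟪b (.inr j), v⟫

/-- The complex coordinate `⟨z̄_j, v⟩`. -/
def zbCoord (v : E) (j : Fin n) : ℂ := ⟪b (.inl j), v⟫ - Complex.I * ⟪b (.inr j), v⟫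

theorem cl_eq_sum (v : E) :
    cl v = ∑ j, zCoord b v j • f b j + ∑ j, zbCoord b v j • fd b j := by
  conv_lhs => rw [← b.sum_repr' v]
  rw [cl_sum_smul, Fintype.sum_sum_type, ← Finset.sum_add_distrib, ← Finset.sum_add_distrib]
  refine Finset.sum_congr rfl fun j _ => ?_
  rw [cl_inl, cl_inr, zCoord, zbCoord]
  module

variable {J : E →ₗ[ℝ] E}

theorem projPlus_add_projMinus (v : E) : projPlus J v + projMinus J v = cl v := by
  rw [projPlus, projMinus]; module

variable {b}
  (hJ : ∀ j : Fin n, J (b (.inl j)) = -b (.inr j) ∧ J (b (.inr j)) = b (.inl j))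
include hJ

/-- In the coordinates z_j the map J is multiplication by -i, and in the conjugate coordinates by i.
Hence π⁺ retains the f_j part of a vector and π⁻ the f_j† part. -/
theorem zCoord_J (v : E) (j : Fin n) : zCoord b (J v) j = -Complex.I * zCoord b v j := by
  have h : J v = ∑ j, (⟪b (.inr j), v⟫ • b (.inl j) - ⟪b (.inl j), v⟫ • b (.inr j)) := by
    conv_lhs => rw [← b.sum_repr' v]
    rw [map_sum, Fintype.sum_sum_type, ← Finset.sum_add_distrib]
    refine Finset.sum_congr rfl fun j _ => ?_
    rw [map_smul, map_smul, (hJ j).1, (hJ j).2, smul_neg]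
    abel
  have h1 : ⟪b (.inl j), J v⟫ = ⟪b (.inr j), v⟫ := by
    rw [h, inner_sum]
    simp [inner_sub_right, inner_smul_right, inner_basis]
  have h2 : ⟪b (.inr j), J v⟫ = -⟪b (.inl j), v⟫ := by
    rw [h, inner_sum]
    simp [inner_sub_right, inner_smul_right, inner_basis]
  rw [zCoord, zCoord, h1, h2]
  push_cast
  linear_combination ((⟪b (.inr j), v⟫ : ℝ) : ℂ) * Complex.I_sq

theorem zbCoord_J (v : E) (j : Fin n) : zbCoord b (J v) j = Complex.I * zbCoord b v j := by
  have h := congrArg (starRingEnd ℂ) (zCoord_J hJ v j)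
  have hs : ∀ v, starRingEnd ℂ (zCoord b v j) = zbCoord b v j := fun v => by
    rw [zCoord, zbCoord, map_add, map_mul, Complex.conj_I, Complex.conj_ofReal, Complex.conj_ofReal,
      neg_mul, sub_eq_add_neg]
  rwa [map_mul, hs, hs, map_neg, Complex.conj_I, neg_neg] at h

theorem cl_J_eq_sum (v : E) : cl (J v) = Complex.I •
    (∑ j, zbCoord b v j • fd b j - ∑ j, zCoord b v j • f b j) := by
  rw [cl_eq_sum b (J v), smul_sub, Finset.smul_sum, Finset.smul_sum, add_comm, sub_eq_add_neg,
    ← Finset.sum_neg_distrib]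
  simp only [zCoord_J hJ, zbCoord_J hJ, smul_smul, neg_mul, neg_smul]

theorem projPlus_eq_sum (v : E) : projPlus J v = ∑ j, zCoord b v j • f b j := by
  rw [projPlus, cl_eq_sum b v, cl_J_eq_sum hJ, smul_smul, Complex.I_mul_I, neg_one_smul, neg_sub,
    add_add_sub_cancel, ← two_smul ℂ, smul_smul, one_div, inv_mul_cancel₀ two_ne_zero, one_smul]

theorem projMinus_eq_sum (v : E) : projMinus J v = ∑ j, zbCoord b v j • fd b j := by
  rw [projMinus, cl_eq_sum b v, cl_J_eq_sum hJ, smul_smul, Complex.I_mul_I, neg_one_smul, neg_sub,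
    add_sub_sub_cancel, ← two_smul ℂ, smul_smul, one_div, inv_mul_cancel₀ two_ne_zero, one_smul]

/-- π⁺(v) and π⁻(v) are combinations of the f_j alone and of the f_j† alone, so both square to zero.
What is left of (π⁺(v) + π⁻(v))² = ⟪v, v⟫ is the anticommutator. -/
theorem projMinus_mul_projPlus_add (v : E) :
    projMinus J v * projPlus J v + projPlus J v * projMinus J v = ((⟪v, v⟫ : ℝ) : ℂ) • 1 := by
  have h1 : projPlus J v * projPlus J v = 0 := mul_self_eq_zero_of_superAnti <| by
    rw [superAnti, projPlus_eq_sum hJ, Finset.sum_mul_sum]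
    nth_rewrite 2 [Finset.sum_comm]
    rw [← Finset.sum_add_distrib]
    refine Finset.sum_eq_zero fun j _ => ?_
    rw [← Finset.sum_add_distrib]
    refine Finset.sum_eq_zero fun k _ => ?_
    rw [smul_mul_smul_comm, smul_mul_smul_comm, mul_comm (zCoord b v k), ← smul_add, f_mul_f,
      smul_zero]
  have h2 : projMinus J v * projMinus J v = 0 := mul_self_eq_zero_of_superAnti <| by
    rw [superAnti, projMinus_eq_sum hJ, Finset.sum_mul_sum]
    nth_rewrite 2 [Finset.sum_comm]
    rw [← Finset.sum_add_distrib]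
    refine Finset.sum_eq_zero fun j _ => ?_
    rw [← Finset.sum_add_distrib]
    refine Finset.sum_eq_zero fun k _ => ?_
    rw [smul_mul_smul_comm, smul_mul_smul_comm, mul_comm (zbCoord b v k), ← smul_add, fd_mul_fd,
      smul_zero]
  have h3 : (projPlus J v + projMinus J v) * (projPlus J v + projMinus J v)
      = ((⟪v, v⟫ : ℝ) : ℂ) • 1 := by
    rw [projPlus_add_projMinus]
    have := cl_mul_add_swap v v
    rw [← two_smul ℂ, mul_smul] at this
    exact smul_right_injective _ (two_ne_zero (α := ℂ)) this
  rw [← h3, add_mul, mul_add, mul_add, h1, h2]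
  abel

end CliffordRelations

/-! ### The superbracket relations in `H_c ⊗ 𝒞` -/

section RealisationRelations

variable {E : Type*} [NormedAddCommGroup E] [InnerProductSpace ℝ E]
  (G : Subgroup (E ≃ₗᵢ[ℝ] E)) [Finite G] (c : Refl G → ℝ)

open scoped RealInnerProductSpace

/-- The defining relation extended complex bilinearly; t, u = ±i give the four brackets of ζ, ζ̄
with z, z̄ at once. -/
theorem complex_hVec_mul_hCov (ξ ξ' : E) (x x' : Module.Dual ℝ E) (t u : ℂ) :
    (hVec G c ξ + t • hVec G c ξ') * (hCov G c x + u • hCov G c x')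
      = (hCov G c x + u • hCov G c x') * (hVec G c ξ + t • hVec G c ξ')
        + ((x ξ : ℂ) + u * x' ξ + t * (x ξ' + u * x' ξ')) • 1
        - reflSum G c fun s => 2 * reflCoeff G c s * ((x (root s) : ℂ) + u * x' (root s)) *
          ((⟪root s, ξ⟫ : ℝ) + t * (⟪root s, ξ'⟫ : ℝ)) := by
  have h : (fun s : Refl G => 2 * reflCoeff G c s * ((x (root s) : ℂ) + u * x' (root s)) *
          ((⟪root s, ξ⟫ : ℝ) + t * (⟪root s, ξ'⟫ : ℝ)))
      = (fun s => 2 * reflCoeff G c s * (x (root s) : ℂ) * (⟪root s, ξ⟫ : ℝ))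
        + u • (fun s => 2 * reflCoeff G c s * (x' (root s) : ℂ) * (⟪root s, ξ⟫ : ℝ))
        + t • (fun s => 2 * reflCoeff G c s * (x (root s) : ℂ) * (⟪root s, ξ'⟫ : ℝ))
        + (t * u) • (fun s => 2 * reflCoeff G c s * (x' (root s) : ℂ) * (⟪root s, ξ'⟫ : ℝ)) := by
    funext s
    simp only [Pi.add_apply, Pi.smul_apply, smul_eq_mul]
    ring
  rw [h]
  simp only [map_add, map_smul, mul_add, add_mul, smul_mul_assoc, mul_smul_comm,
    hVec_mul_hCov]
  module

variable {n : ℕ} (b : OrthonormalBasis (Fin n ⊕ Fin n) ℝ E)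

theorem zb_eq (j : Fin n) : zb G c b j = hCov G c (b.toBasis.coord (.inl j))
    + (-Complex.I) • hCov G c (b.toBasis.coord (.inr j)) := by
  rw [zb, neg_smul, sub_eq_add_neg]

theorem zeta_eq (j : Fin n) : zeta G c b j =
    (1 / 2 : ℂ) • (hVec G c (b (.inl j)) + (-Complex.I) • hVec G c (b (.inr j))) := by
  rw [zeta, neg_smul, sub_eq_add_neg]

theorem reflSum_congr_of_smul {t : Refl G → ℂ} {t' : Refl G → ℂ} (r : ℂ)
    (h : ∀ s, r * t s = t' s) : r • reflSum G c t = reflSum G c t' := by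
  rw [← map_smul]
  congr 1
  funext s
  exact h s

/-- With t = -i and u = i the constant is (1 + tu)/2 = 1 on the diagonal; when t = u = ±i it is 0,
as in the next two lemmas. The factor ½ in ζ cancels the 2 in the reflection terms. -/
theorem zeta_mul_z (j k : Fin n) : zeta G c b k * z G c b j = z G c b j * zeta G c b k
    + (if j = k then (1 : ℂ) else 0) • 1 - reflSum G c fun s =>
      reflCoeff G c s * zCoord b (root s) j * zbCoord b (root s) k := by
  rw [zeta_eq, z, smul_mul_assoc, complex_hVec_mul_hCov, smul_sub, smul_add, mul_smul_comm,
    smul_smul]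
  congr 1
  · congr 2
    simp only [coord_apply_eq_inner, inner_basis]
    by_cases h : j = k <;> simp [h]; norm_num
  · refine reflSum_congr_of_smul G c _ fun s => ?_
    rw [coord_apply_eq_inner, coord_apply_eq_inner, real_inner_comm (b (.inl k)),
      real_inner_comm (b (.inr k)), zCoord, zbCoord]
    ring

theorem zeta_mul_zb (j k : Fin n) : zeta G c b k * zb G c b j = zb G c b j * zeta G c b k
    + (if j = k then (0 : ℂ) else 0) • 1 - reflSum G c fun s =>
      reflCoeff G c s * zbCoord b (root s) j * zbCoord b (root s) k := by
  rw [zeta_eq, zb_eq, smul_mul_assoc, complex_hVec_mul_hCov, smul_sub, smul_add, mul_smul_comm,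
    smul_smul]
  congr 1
  · congr 2
    simp only [coord_apply_eq_inner, inner_basis]
    by_cases h : j = k <;> simp [h]
  · refine reflSum_congr_of_smul G c _ fun s => ?_
    rw [coord_apply_eq_inner, coord_apply_eq_inner, real_inner_comm (b (.inl k)),
      real_inner_comm (b (.inr k)), zbCoord, zbCoord]
    ring

theorem zetab_mul_z (j k : Fin n) : zetab G c b k * z G c b j = z G c b j * zetab G c b k
    + (if j = k then (0 : ℂ) else 0) • 1 - reflSum G c fun s =>
      reflCoeff G c s * zCoord b (root s) j * zCoord b (root s) k := by
  rw [zetab, z, smul_mul_assoc, complex_hVec_mul_hCov, smul_sub, smul_add, mul_smul_comm,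
    smul_smul]
  congr 1
  · congr 2
    simp only [coord_apply_eq_inner, inner_basis]
    by_cases h : j = k <;> simp [h]
  · refine reflSum_congr_of_smul G c _ fun s => ?_
    rw [coord_apply_eq_inner, coord_apply_eq_inner, real_inner_comm (b (.inl k)),
      real_inner_comm (b (.inr k)), zCoord, zCoord]
    ring

theorem zetab_mul_zb (j k : Fin n) : zetab G c b k * zb G c b j = zb G c b j * zetab G c b k
    + (if j = k then (1 : ℂ) else 0) • 1 - reflSum G c fun s =>
      reflCoeff G c s * zbCoord b (root s) j * zCoord b (root s) k := by
  rw [zetab, zb_eq, smul_mul_assoc, complex_hVec_mul_hCov, smul_sub, smul_add, mul_smul_comm,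
    smul_smul]
  congr 1
  · congr 2
    simp only [coord_apply_eq_inner, inner_basis]
    by_cases h : j = k <;> simp [h]; norm_num
  · refine reflSum_congr_of_smul G c _ fun s => ?_
    rw [coord_apply_eq_inner, coord_apply_eq_inner, real_inner_comm (b (.inl k)),
      real_inner_comm (b (.inr k)), zbCoord, zCoord]
    ring

theorem complex_hCov_comm (x x' y y' : Module.Dual ℝ E) (t u : ℂ) :
    Commute (hCov G c x + t • hCov G c x') (hCov G c y + u • hCov G c y') := by
  have h : ∀ x y, Commute (hCov G c x) (hCov G c y) := hCov_comm G c
  exact ((h x y).add_right ((h x y').smul_right u)).add_left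
    (((h x' y).smul_left t).add_right (((h x' y').smul_right u).smul_left t))

theorem complex_hVec_comm (x x' y y' : E) (t u : ℂ) :
    Commute (hVec G c x + t • hVec G c x') (hVec G c y + u • hVec G c y') := by
  have h : ∀ x y, Commute (hVec G c x) (hVec G c y) := hVec_comm G c
  exact ((h x y).add_right ((h x y').smul_right u)).add_left
    (((h x' y).smul_left t).add_right (((h x' y').smul_right u).smul_left t))

theorem z_comm (j k : Fin n) : z G c b j * z G c b k = z G c b k * z G c b j :=
  complex_hCov_comm G c ..

theorem zb_comm (j k : Fin n) : zb G c b j * zb G c b k = zb G c b k * zb G c b j := by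
  rw [zb_eq, zb_eq]; exact complex_hCov_comm G c ..

theorem z_zb_comm (j k : Fin n) : z G c b j * zb G c b k = zb G c b k * z G c b j := by
  rw [zb_eq]; exact complex_hCov_comm G c ..

theorem zeta_comm (j k : Fin n) : zeta G c b j * zeta G c b k = zeta G c b k * zeta G c b j := by
  rw [zeta_eq, zeta_eq]; exact ((complex_hVec_comm G c ..).smul_left _).smul_right _

theorem zetab_comm (j k : Fin n) :
    zetab G c b j * zetab G c b k = zetab G c b k * zetab G c b j :=
  ((complex_hVec_comm G c ..).smul_left _).smul_right _

theorem zeta_zetab_comm (j k : Fin n) :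
    zeta G c b j * zetab G c b k = zetab G c b k * zeta G c b j := by
  rw [zeta_eq]; exact ((complex_hVec_comm G c ..).smul_left _).smul_right _

variable {G c} in
-- xy ⊗ uv + yx ⊗ vu = xy ⊗ (uv + vu) + (yx - xy) ⊗ vu. The central terms survive only for j = k.
-- The coefficient of each reflection is a product of a function of j and a function of k, so the
-- double sum factors into a product of two Clifford vectors.
theorem superAnti_sum_tmul {x y : Fin n → Cherednik G c} {u v : Fin n → Cl E} {ε₁ ε₂ : ℂ}
    {p q : Refl G → Fin n → ℂ}
    (hxy : ∀ j k, y k * x j = x j * y k + (if j = k then ε₁ else 0) • 1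
      - reflSum G c fun s => reflCoeff G c s * p s j * q s k)
    (huv : ∀ j k, u j * v k + v k * u j = (if j = k then ε₂ else 0) • 1) :
    superAnti (∑ j, x j ⊗ₜ[ℂ] u j) (∑ k, y k ⊗ₜ[ℂ] v k)
      = ε₂ • ((∑ j, x j * y j) ⊗ₜ[ℂ] 1) + ε₁ • (1 ⊗ₜ[ℂ] ∑ j, v j * u j)
        - ∑ s : Refl G, reflCoeff G c s •
          (hGrp G c s.1 ⊗ₜ[ℂ] ((∑ k, q s k • v k) * ∑ j, p s j • u j)) := by
  have h1 : superAnti (∑ j, x j ⊗ₜ[ℂ] u j) (∑ k, y k ⊗ₜ[ℂ] v k)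
      = ∑ j, ∑ k, ((x j * y k) ⊗ₜ[ℂ] (u j * v k) + (y k * x j) ⊗ₜ[ℂ] (v k * u j)) := by
    rw [superAnti, Finset.sum_mul_sum, Finset.sum_mul_sum]
    nth_rewrite 2 [Finset.sum_comm]
    simp only [← Finset.sum_add_distrib, Algebra.TensorProduct.tmul_mul_tmul]
  have h2 : ∀ j k, (x j * y k) ⊗ₜ[ℂ] (u j * v k) + (y k * x j) ⊗ₜ[ℂ] (v k * u j)
      = (if j = k then ε₂ • ((x j * y j) ⊗ₜ[ℂ] (1 : Cl E)) else 0)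
        + (if j = k then ε₁ • ((1 : Cherednik G c) ⊗ₜ[ℂ] (v j * u j)) else 0)
        - ∑ s : Refl G, reflCoeff G c s •
          (hGrp G c s.1 ⊗ₜ[ℂ] ((q s k • v k) * (p s j • u j))) := by
    intro j k
    rw [hxy, TensorProduct.sub_tmul, TensorProduct.add_tmul, ← add_sub_assoc, ← add_assoc,
      ← TensorProduct.tmul_add, huv, reflSum_apply, TensorProduct.sum_tmul]
    congr 1
    · by_cases h : j = k
      · subst h; simp [TensorProduct.smul_tmul']
      · simp [h]
    · refine Finset.sum_congr rfl fun s _ => ?_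
      rw [smul_mul_smul_comm, TensorProduct.tmul_smul, ← TensorProduct.smul_tmul', smul_smul]
      congr 1
      ring
  rw [h1]
  simp only [h2, Finset.sum_sub_distrib, Finset.sum_add_distrib, Finset.sum_ite_eq,
    Finset.mem_univ, if_true, ← Finset.smul_sum, ← TensorProduct.tmul_sum,
    ← TensorProduct.sum_tmul]
  congr 1
  rw [Finset.sum_congr rfl fun j _ => Finset.sum_comm, Finset.sum_comm]
  refine Finset.sum_congr rfl fun s _ => ?_
  rw [Finset.sum_mul_sum]
  simp only [TensorProduct.tmul_sum, Finset.smul_sum]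
  exact Finset.sum_comm

variable {G c} in
/-- The case of commuting first factors. -/
theorem superAnti_sum_tmul_of_comm {x y : Fin n → Cherednik G c} {u v : Fin n → Cl E} {ε₂ : ℂ}
    (hxy : ∀ j k, y k * x j = x j * y k)
    (huv : ∀ j k, u j * v k + v k * u j = (if j = k then ε₂ else 0) • 1) :
    superAnti (∑ j, x j ⊗ₜ[ℂ] u j) (∑ k, y k ⊗ₜ[ℂ] v k) = ε₂ • ((∑ j, x j * y j) ⊗ₜ[ℂ] 1) := by
  rw [superAnti_sum_tmul (ε₁ := 0) (ε₂ := ε₂) (p := 0) (q := 0) (fun j k => ?_) huv]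
  · simp
  · have : (fun s : Refl G => reflCoeff G c s * (0 : Refl G → Fin n → ℂ) s j
        * (0 : Refl G → Fin n → ℂ) s k) = 0 := by
      funext s; simp
    rw [this, hxy]; simp

theorem f_mul_f' (j k : Fin n) :
    f b j * f b k + f b k * f b j = (if j = k then (0 : ℂ) else 0) • 1 := by
  rw [f_mul_f]; simp

theorem fd_mul_fd' (j k : Fin n) :
    fd b j * fd b k + fd b k * fd b j = (if j = k then (0 : ℂ) else 0) • 1 := by
  rw [fd_mul_fd]; simp

theorem f_mul_fd (j k : Fin n) :
    f b j * fd b k + fd b k * f b j = (if j = k then (1 : ℂ) else 0) • 1 := by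
  rw [add_comm, fd_mul_f]; simp [eq_comm]

theorem superAnti_smul_right {A : Type*} [Ring A] [Algebra ℂ A] (r : ℂ) (x y : A) :
    superAnti x (r • y) = r • superAnti x y := by
  simp only [superAnti, mul_smul_comm, smul_mul_assoc, smul_add]

theorem superAnti_smul_left {A : Type*} [Ring A] [Algebra ℂ A] (r : ℂ) (x y : A) :
    superAnti (r • x) y = r • superAnti x y := by
  simp only [superAnti, mul_smul_comm, smul_mul_assoc, smul_add]

theorem superAnti_comm {A : Type*} [Ring A] (x y : A) : superAnti x y = superAnti y x :=
  add_comm _ _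

/-- The number operator `½ ∑ [f_j†, f_j]`. -/
def numberOp : Cl E := (1 / 2 : ℂ) • ∑ j, (fd b j * f b j - f b j * fd b j)

theorem numberOp_eq : numberOp b = ∑ j, fd b j * f b j - (n / 2 : ℂ) • 1 := by
  have : ∀ j, fd b j * f b j - f b j * fd b j = (2 : ℂ) • (fd b j * f b j) - (1 : Cl E) := fun j => by
    have := fd_mul_f b j j
    rw [if_pos rfl, one_smul] at this
    rw [← this]; module
  rw [numberOp, Finset.sum_congr rfl fun j _ => this j, Finset.sum_sub_distrib, ← Finset.smul_sum,
    Finset.sum_const, Finset.card_univ, Fintype.card_fin, ← Nat.cast_smul_eq_nsmul ℂ]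
  module

theorem superComm_numberOp_fd (k : Fin n) : superComm (numberOp b) (fd b k) = fd b k := by
  have h : ∀ j, fd b j * f b j * fd b k - fd b k * (fd b j * f b j)
      = if j = k then fd b j else 0 := fun j => by
    have h1 := f_mul_fd b j k
    have h2 := fd_mul_fd b j k
    have h3 : fd b j * f b j * fd b k - fd b k * (fd b j * f b j)
        = fd b j * (f b j * fd b k + fd b k * f b j)
          - (fd b j * fd b k + fd b k * fd b j) * f b j := by noncomm_ring
    rw [h3, h1, h2, zero_mul, sub_zero]
    by_cases h : j = k <;> simp [h]
  rw [numberOp_eq, superComm, sub_mul, mul_sub, smul_mul_assoc, mul_smul_comm, one_mul, mul_one,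
    sub_sub_sub_cancel_right, Finset.sum_mul, Finset.mul_sum, ← Finset.sum_sub_distrib]
  simp [h]

theorem superComm_numberOp_f (k : Fin n) : superComm (numberOp b) (f b k) = -f b k := by
  have h : ∀ j, fd b j * f b j * f b k - f b k * (fd b j * f b j)
      = if j = k then -f b j else 0 := fun j => by
    have h1 := fd_mul_f b j k
    have h2 := f_mul_f b j k
    have h3 : fd b j * f b j * f b k - f b k * (fd b j * f b j)
        = fd b j * (f b j * f b k + f b k * f b j)
          - (fd b j * f b k + f b k * fd b j) * f b j := by noncomm_ring
    rw [h3, h1, h2, mul_zero, zero_sub]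
    by_cases h : j = k <;> simp [h]
  rw [numberOp_eq, superComm, sub_mul, mul_sub, smul_mul_assoc, mul_smul_comm, one_mul, mul_one,
    sub_sub_sub_cancel_right, Finset.sum_mul, Finset.mul_sum, ← Finset.sum_sub_distrib]
  simp [h]

end RealisationRelations

/-! ### Verification of the superbrackets for the realisation -/

section RealisationSuper

open UGen

variable {E : Type*} [NormedAddCommGroup E] [InnerProductSpace ℝ E]
  (G : Subgroup (E ≃ₗᵢ[ℝ] E)) [Finite G] (c : Refl G → ℝ)
  {n : ℕ} {J : E →ₗ[ℝ] E} (b : OrthonormalBasis (Fin n ⊕ Fin n) ℝ E)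

/-- The cross terms of z_jζ_j and z̄_jζ̄_j cancel, which leaves x_jξ_j + y_jη_j. -/
theorem euler_eq : euler G c b
    = ∑ j, (z G c b j * zeta G c b j + zb G c b j * zetab G c b j) := by
  rw [euler, Fintype.sum_sum_type, ← Finset.sum_add_distrib]
  refine Finset.sum_congr rfl fun j _ => ?_
  rw [z, zb, zeta, zetab]
  simp only [mul_add, add_mul, mul_sub, sub_mul, smul_mul_assoc, mul_smul_comm, smul_add, smul_sub,
    smul_smul]
  match_scalars <;> (ring_nf; try (simp only [Complex.I_sq]; norm_num))

theorem opH_eq : opH G c b = euler G c b - sigma G c + algebraMap ℂ _ (n : ℂ) := by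
  rw [opH, euler_eq]; abel

theorem superComm_opH (x : Cherednik G c) :
    superComm (opH G c b) x = superComm (euler G c b - sigma G c) x := by
  rw [opH_eq]
  simp only [superComm, add_mul, mul_add, Algebra.commutes]
  abel

theorem superComm_add_smul {A : Type*} [Ring A] [Algebra ℂ A] (X a a' : A) (t : ℂ) :
    superComm X (a + t • a') = superComm X a + t • superComm X a' := by
  simp only [superComm, mul_add, add_mul, mul_smul_comm, smul_mul_assoc, smul_sub]
  abel

theorem superComm_smul {A : Type*} [Ring A] [Algebra ℂ A] (X a : A) (t : ℂ) :
    superComm X (t • a) = t • superComm X a := by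
  simp only [superComm, mul_smul_comm, smul_mul_assoc, smul_sub]

theorem superComm_opH_z (j : Fin n) : superComm (opH G c b) (z G c b j) = z G c b j := by
  rw [superComm_opH, z, superComm_add_smul, superComm_euler_sub_sigma_hCov,
    superComm_euler_sub_sigma_hCov]

theorem superComm_opH_zb (j : Fin n) : superComm (opH G c b) (zb G c b j) = zb G c b j := by
  rw [superComm_opH, zb_eq, superComm_add_smul, superComm_euler_sub_sigma_hCov,
    superComm_euler_sub_sigma_hCov]

theorem superComm_opH_zeta (j : Fin n) :
    superComm (opH G c b) (zeta G c b j) = -zeta G c b j := by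
  rw [superComm_opH, zeta_eq, superComm_smul, superComm_add_smul, superComm_euler_sub_sigma_hVec,
    superComm_euler_sub_sigma_hVec]
  module

theorem superComm_opH_zetab (j : Fin n) :
    superComm (opH G c b) (zetab G c b j) = -zetab G c b j := by
  rw [superComm_opH, zetab, superComm_smul, superComm_add_smul, superComm_euler_sub_sigma_hVec,
    superComm_euler_sub_sigma_hVec]
  module

variable {G c} in
theorem superComm_left_sum_tmul {X : Cherednik G c} {x : Fin n → Cherednik G c} {u : Fin n → Cl E}
    {ε : ℂ} (h : ∀ j, superComm X (x j) = ε • x j) :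
    superComm (X ⊗ₜ[ℂ] (1 : Cl E)) (∑ j, x j ⊗ₜ[ℂ] u j) = ε • ∑ j, x j ⊗ₜ[ℂ] u j := by
  rw [superComm, Finset.mul_sum, Finset.sum_mul, ← Finset.sum_sub_distrib, Finset.smul_sum]
  refine Finset.sum_congr rfl fun j _ => ?_
  rw [Algebra.TensorProduct.tmul_mul_tmul, Algebra.TensorProduct.tmul_mul_tmul, one_mul, mul_one,
    ← TensorProduct.sub_tmul, TensorProduct.smul_tmul', ← h]

variable {G c} in
theorem superComm_right_sum_tmul {X : Cl E} {x : Fin n → Cherednik G c} {u : Fin n → Cl E}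
    {ε : ℂ} (h : ∀ j, superComm X (u j) = ε • u j) :
    superComm ((1 : Cherednik G c) ⊗ₜ[ℂ] X) (∑ j, x j ⊗ₜ[ℂ] u j) = ε • ∑ j, x j ⊗ₜ[ℂ] u j := by
  rw [superComm, Finset.mul_sum, Finset.sum_mul, ← Finset.sum_sub_distrib, Finset.smul_sum]
  refine Finset.sum_congr rfl fun j _ => ?_
  rw [Algebra.TensorProduct.tmul_mul_tmul, Algebra.TensorProduct.tmul_mul_tmul, one_mul, mul_one,
    ← TensorProduct.tmul_sub, ← TensorProduct.tmul_smul, ← h]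

/-- `∑ c(s) / ⟨a_s, α_s⟩ s ⊗ π⁻(α_s) π⁺(α_s)` -/
def twistedSigma (J : E →ₗ[ℝ] E) : HC G c :=
  ∑ s : Refl G, reflCoeff G c s • (hGrp G c s.1 ⊗ₜ[ℂ] (projMinus J (root s) * projPlus J (root s)))

theorem sigma_tmul_one : sigma G c ⊗ₜ[ℂ] (1 : Cl E)
    = ∑ s : Refl G, (c s : ℂ) • (hGrp G c s.1 ⊗ₜ[ℂ] (1 : Cl E)) := by
  rw [sigma, TensorProduct.sum_tmul]
  rfl

theorem Omega_eq : Omega G c J = sigma G c ⊗ₜ[ℂ] 1 - (2 : ℂ) • twistedSigma G c J := by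
  rw [Omega, sigma_tmul_one, twistedSigma, Finset.smul_sum, ← Finset.sum_sub_distrib]
  refine Finset.sum_congr rfl fun s _ => ?_
  rw [tauS, TensorProduct.tmul_sub, smul_sub, TensorProduct.tmul_smul, smul_smul, smul_smul]
  congr 2
  rw [c_eq, coroot_apply]
  have := inner_root_self_ne_zero s
  push_cast
  field_simp
  exact mul_div_cancel_right₀ _ (by exact_mod_cast this)

variable {b}

/-- Exchanging the two projections costs ⟨a_s, α_s⟩ for each s, and the weighted sum of these terms
is σ. This accounts for the asymmetric shape of the reflection part of Z₁. -/
theorem sum_projPlus_mul_projMinus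
    (hJ : ∀ j : Fin n, J (b (.inl j)) = -b (.inr j) ∧ J (b (.inr j)) = b (.inl j)) :
    ∑ s : Refl G, reflCoeff G c s •
      (hGrp G c s.1 ⊗ₜ[ℂ] (projPlus J (root s) * projMinus J (root s)))
      = sigma G c ⊗ₜ[ℂ] 1 - twistedSigma G c J := by
  rw [eq_sub_iff_add_eq, twistedSigma, ← Finset.sum_add_distrib, sigma_tmul_one]
  refine Finset.sum_congr rfl fun s _ => ?_
  rw [← smul_add, ← TensorProduct.tmul_add, add_comm, projMinus_mul_projPlus_add hJ,
    TensorProduct.tmul_smul, smul_smul, ← c_eq]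

variable (b)

theorem sum_f_mul_fd : ∑ j, f b j * fd b j = (n : ℂ) • 1 - ∑ j, fd b j * f b j := by
  rw [eq_sub_iff_add_eq, ← Finset.sum_add_distrib]
  simp only [f_mul_fd, if_true, one_smul, Finset.sum_const, Finset.card_univ, Fintype.card_fin]
  rw [← Nat.cast_smul_eq_nsmul ℂ]

theorem realise_Z2_eq : realise G c J b Z2
    = 1 ⊗ₜ[ℂ] (∑ j, fd b j * f b j) - (n / 2 : ℂ) • 1 := by
  change 1 ⊗ₜ[ℂ] numberOp b = _
  rw [numberOp_eq, TensorProduct.tmul_sub, TensorProduct.tmul_smul,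
    Algebra.TensorProduct.one_def]

theorem realise_H_eq : realise G c J b H = (∑ j, z G c b j * zeta G c b j) ⊗ₜ[ℂ] 1
    + (∑ j, zb G c b j * zetab G c b j) ⊗ₜ[ℂ] 1 + (n : ℂ) • 1 - sigma G c ⊗ₜ[ℂ] 1 := by
  change opH G c b ⊗ₜ[ℂ] 1 = _
  rw [opH, TensorProduct.sub_tmul, TensorProduct.add_tmul, Finset.sum_add_distrib,
    TensorProduct.add_tmul, Algebra.algebraMap_eq_smul_one, ← TensorProduct.smul_tmul',
    Algebra.TensorProduct.one_def]

theorem realise_Z1_eq : realise G c J b Z1 = (∑ j, zb G c b j * zetab G c b j) ⊗ₜ[ℂ] 1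
    - (∑ j, z G c b j * zeta G c b j) ⊗ₜ[ℂ] 1 - (sigma G c ⊗ₜ[ℂ] 1
      - (2 : ℂ) • twistedSigma G c J) := by
  change opZ0 G c b ⊗ₜ[ℂ] 1 - Omega G c J = _
  rw [opZ0, Finset.sum_sub_distrib, TensorProduct.sub_tmul, Omega_eq]

theorem mul_self_eq_zero_sum_zb (v : E) :
    (∑ k, zbCoord b v k • fd b k) * ∑ j, zbCoord b v j • fd b j = 0 := by
  refine mul_self_eq_zero_of_superAnti ?_
  rw [superAnti, Finset.sum_mul_sum]
  nth_rewrite 2 [Finset.sum_comm]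
  rw [← Finset.sum_add_distrib]
  refine Finset.sum_eq_zero fun j _ => ?_
  rw [← Finset.sum_add_distrib]
  refine Finset.sum_eq_zero fun k _ => ?_
  rw [smul_mul_smul_comm, smul_mul_smul_comm, mul_comm (zbCoord b v k), ← smul_add, fd_mul_fd,
    smul_zero]

theorem mul_self_eq_zero_sum_z (v : E) :
    (∑ k, zCoord b v k • f b k) * ∑ j, zCoord b v j • f b j = 0 := by
  refine mul_self_eq_zero_of_superAnti ?_
  rw [superAnti, Finset.sum_mul_sum]
  nth_rewrite 2 [Finset.sum_comm]
  rw [← Finset.sum_add_distrib]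
  refine Finset.sum_eq_zero fun j _ => ?_
  rw [← Finset.sum_add_distrib]
  refine Finset.sum_eq_zero fun k _ => ?_
  rw [smul_mul_smul_comm, smul_mul_smul_comm, mul_comm (zCoord b v k), ← smul_add, f_mul_f,
    smul_zero]

variable {b}

/-- The realisation of `gl(2|1)` in `H_c ⊗ 𝒞` satisfies the superbracket relations. -/
theorem superRelations_realise
    (hJ : ∀ j : Fin n, J (b (.inl j)) = -b (.inr j) ∧ J (b (.inr j)) = b (.inl j)) :
    SuperRelations (realise G c J b) where
  FpFp := by
    rw [realise, superAnti_sum_tmul_of_comm (fun j k => zb_comm G c b k j) (fd_mul_fd' b), zero_smul]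
  FbpFbp := by
    rw [realise, superAnti_sum_tmul_of_comm (fun j k => z_comm G c b k j) (f_mul_f' b), zero_smul]
  FmFm := by
    rw [realise, superAnti_smul_left, superAnti_smul_right,
      superAnti_sum_tmul_of_comm (fun j k => zeta_comm G c b k j) (fd_mul_fd' b), zero_smul,
      smul_zero, smul_zero]
  FbmFbm := by
    rw [realise, superAnti_smul_left, superAnti_smul_right,
      superAnti_sum_tmul_of_comm (fun j k => zetab_comm G c b k j) (f_mul_f' b), zero_smul,
      smul_zero, smul_zero]
  FpFm := by
    rw [realise, realise, superAnti_smul_right,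
      superAnti_sum_tmul (p := fun s => zbCoord b (root s)) (q := fun s => zbCoord b (root s))
        (zeta_mul_zb G c b) (fd_mul_fd' b)]
    -- The Clifford factor of each reflection term is the square of π⁻(α_s), which is isotropic.
    simp [mul_self_eq_zero_sum_zb]
  FbpFbm := by
    rw [realise, realise, superAnti_smul_right,
      superAnti_sum_tmul (p := fun s => zCoord b (root s)) (q := fun s => zCoord b (root s))
        (zetab_mul_z G c b) (f_mul_f' b)]
    simp [mul_self_eq_zero_sum_z]
  FpFbp := by
    rw [realise, realise, realise, superAnti_sum_tmul_of_comm (fun j k => z_zb_comm G c b k j)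
      (fd_mul_f b), one_smul, opEp, ← TensorProduct.smul_tmul', two_mul, ← add_smul]
    norm_num
    simp only [z_zb_comm]
  FmFbm := by
    rw [realise, realise, realise, superAnti_smul_left, superAnti_smul_right,
      superAnti_sum_tmul_of_comm (fun j k => (zeta_zetab_comm G c b j k).symm)
      (fd_mul_f b), one_smul, opEm, TensorProduct.neg_tmul, ← TensorProduct.smul_tmul', mul_neg,
      neg_neg, two_mul, two_smul, two_smul, ← two_smul ℂ]
  FpFbm := by
    rw [realise_H_eq, realise_Z1_eq, realise_Z2_eq, realise, realise, superAnti_smul_right,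
      superAnti_sum_tmul (p := fun s => zbCoord b (root s)) (q := fun s => zCoord b (root s))
        (zetab_mul_zb G c b) (fd_mul_f b)]
    simp only [← projPlus_eq_sum hJ, ← projMinus_eq_sum hJ]
    -- This bracket produces π⁺(α_s)π⁻(α_s), whereas Z₁ is written with the opposite order. The
    -- other mixed bracket already has the order of Z₁.
    rw [sum_projPlus_mul_projMinus G c hJ, sum_f_mul_fd, TensorProduct.tmul_sub,
      TensorProduct.tmul_smul, ← Algebra.TensorProduct.one_def, two_mul]
    module
  FmFbp := by
    rw [superAnti_comm, realise_H_eq, realise_Z1_eq, realise_Z2_eq, realise, realise,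
      superAnti_smul_right,
      superAnti_sum_tmul (p := fun s => zCoord b (root s)) (q := fun s => zbCoord b (root s))
        (zeta_mul_z G c b) (f_mul_fd b)]
    simp only [← projPlus_eq_sum hJ, ← projMinus_eq_sum hJ]
    rw [← twistedSigma, two_mul]
    module
  HFp := (superComm_left_sum_tmul (ε := 1)
    (fun j => (superComm_opH_zb G c b j).trans (one_smul ℂ _).symm)).trans (one_smul ℂ _)
  HFbp := (superComm_left_sum_tmul (ε := 1)
    (fun j => (superComm_opH_z G c b j).trans (one_smul ℂ _).symm)).trans (one_smul ℂ _)
  HFm := by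
    rw [realise, realise, superComm_smul, superComm_left_sum_tmul (ε := -1)
      (fun j => (superComm_opH_zeta G c b j).trans (neg_one_smul ℂ _).symm), neg_one_smul, smul_neg]
  HFbm := by
    rw [realise, realise, superComm_smul, superComm_left_sum_tmul (ε := -1)
      (fun j => (superComm_opH_zetab G c b j).trans (neg_one_smul ℂ _).symm), neg_one_smul, smul_neg]
  Z2Fp := (superComm_right_sum_tmul (X := numberOp b) (ε := 1)
    (fun j => (superComm_numberOp_fd b j).trans (one_smul ℂ _).symm)).trans (one_smul ℂ _)
  Z2Fbp := (superComm_right_sum_tmul (X := numberOp b) (ε := -1)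
    (fun j => (superComm_numberOp_f b j).trans (neg_one_smul ℂ _).symm)).trans (neg_one_smul ℂ _)
  Z2Fm := by
    rw [realise, realise, superComm_smul]
    exact congrArg _ ((superComm_right_sum_tmul (X := numberOp b) (ε := 1)
      (fun j => (superComm_numberOp_fd b j).trans (one_smul ℂ _).symm)).trans (one_smul ℂ _))
  Z2Fbm := by
    rw [realise, realise, superComm_smul, ← smul_neg]
    exact congrArg _ ((superComm_right_sum_tmul (X := numberOp b) (ε := -1)
      (fun j => (superComm_numberOp_f b j).trans (neg_one_smul ℂ _).symm)).trans (neg_one_smul ℂ _))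

end RealisationSuper

/-! ### The standard module -/

section StandardModule

variable {E : Type*} [NormedAddCommGroup E] [InnerProductSpace ℝ E]

open scoped RealInnerProductSpace

theorem IsReflection.conj {s : E ≃ₗᵢ[ℝ] E} (hs : IsReflection s) (g : E ≃ₗᵢ[ℝ] E) :
    IsReflection (g * s * g⁻¹) := by
  obtain ⟨α, hα, rfl⟩ := hs
  refine ⟨g α, fun h => hα (g.map_eq_zero_iff.1 h), ?_⟩
  ext v
  change g ((ℝ ∙ α)ᗮ.reflection (g.symm v)) = _
  have h : ⟪α, g.symm v⟫ = ⟪g α, v⟫ := by rw [← g.inner_map_map, g.apply_symm_apply]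
  rw [reflection_orthogonal_singleton_apply, reflection_orthogonal_singleton_apply, map_sub,
    map_smul, g.apply_symm_apply, h, g.inner_map_map]

variable (G : Subgroup (E ≃ₗᵢ[ℝ] E))

/-- Conjugation as a permutation of the reflections. -/
def conjRefl {G : Subgroup (E ≃ₗᵢ[ℝ] E)} (g : G) : Refl G ≃ Refl G where
  toFun s := ⟨g * s.1 * g⁻¹, s.2.conj g⟩
  invFun s := ⟨g⁻¹ * s.1 * g, by simpa using s.2.conj (g⁻¹ : E ≃ₗᵢ[ℝ] E)⟩
  left_inv s := Subtype.ext (by group)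
  right_inv s := Subtype.ext (by group)

variable {V : Type*} [AddCommGroup V] [Module ℂ V]

/-! ### Irreducible representations of the finite group -/

section Irreducible

variable {G} {τ : Representation ℂ G V} (hτ : τ.IsIrreducible)
include hτ

theorem eq_top_of_stable {W : Submodule ℂ V} (h : ∀ g : G, ∀ v ∈ W, τ g v ∈ W) (hW : W ≠ ⊥) :
    W = ⊤ := by
  rcases hτ.eq_bot_or_eq_top (⟨W, h⟩ : Subrepresentation τ) with h1 | h1
  · exact absurd (congrArg Subrepresentation.toSubmodule h1) hW
  · exact congrArg Subrepresentation.toSubmodule h1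

theorem nontrivial_of_isIrreducible : Nontrivial V := by
  by_contra hV
  rw [not_nontrivial_iff_subsingleton] at hV
  obtain ⟨W, W', hne⟩ := hτ.exists_pair_ne
  exact hne (Subrepresentation.toSubmodule_injective (Subsingleton.elim _ _))

/-- The orbit of a nonzero vector is finite and its span is stable. -/
theorem finiteDimensional_of_isIrreducible [Finite G] : FiniteDimensional ℂ V := by
  have := nontrivial_of_isIrreducible hτ
  obtain ⟨v, hv⟩ := exists_ne (0 : V)
  have htop : Submodule.span ℂ (Set.range fun g : G => τ g v) = ⊤ := by
    refine eq_top_of_stable hτ (fun g w hw => ?_) fun h => hv ?_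
    · have : Submodule.span ℂ (Set.range fun g : G => τ g v)
          ≤ (Submodule.span ℂ (Set.range fun g : G => τ g v)).comap (τ g) := by
        rw [Submodule.span_le]
        rintro _ ⟨g', rfl⟩
        exact Submodule.subset_span ⟨g * g', by simp⟩
      exact this hw
    · have h1 : τ 1 v ∈ Submodule.span ℂ (Set.range fun g : G => τ g v) :=
        Submodule.subset_span ⟨1, rfl⟩
      rw [h] at h1
      simpa using h1
  exact Module.finite_def.2 (htop ▸ Submodule.fg_span (Set.finite_range _))

/-- Schur's lemma: as c is conjugation invariant, σ commutes with G, so an eigenspace of σ is a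
nonzero subrepresentation. The existence of the scalar is what makes the choice in `scalarN`
meaningful. -/
theorem sum_refl_smul_eq [Finite G] {c : Refl G → ℝ}
    (hc : ∀ s t : Refl G, IsConj s.1 t.1 → c s = c t) (v : V) :
    ∑ s : Refl G, (c s : ℂ) • τ s.1 v = scalarN G c τ • v := by
  have := nontrivial_of_isIrreducible hτ
  have := finiteDimensional_of_isIrreducible hτ
  let S : Module.End ℂ V := ∑ s : Refl G, (c s : ℂ) • τ s.1
  have hS : ∀ v, S v = ∑ s : Refl G, (c s : ℂ) • τ s.1 v := fun v => by
    simp [S, LinearMap.sum_apply]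
  have hcomm : ∀ (g : G) (v : V), S (τ g v) = τ g (S v) := by
    intro g v
    rw [hS, hS, map_sum]
    refine Fintype.sum_equiv (conjRefl g⁻¹) _ _ fun s => ?_
    rw [map_smul, hc s (conjRefl g⁻¹ s) (isConj_iff.2 ⟨g⁻¹, rfl⟩)]
    congr 1
    change (τ s.1 * τ g) v = (τ g * τ (g⁻¹ * s.1 * g⁻¹⁻¹)) v
    rw [← map_mul, ← map_mul]
    congr 2
    group
  obtain ⟨N, hN⟩ := Module.End.exists_eigenvalue S
  have htop : Module.End.eigenspace S N = ⊤ := by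
    refine eq_top_of_stable hτ (fun g w hw => ?_) hN
    rw [Module.End.mem_eigenspace_iff] at hw ⊢
    rw [hcomm, hw, map_smul]
  have hex : ∃ N : ℂ, ∀ v : V, ∑ s : Refl G, (c s : ℂ) • τ s.1 v = N • v :=
    ⟨N, fun v => by
      rw [← hS]
      exact Module.End.mem_eigenspace_iff.1 (htop ▸ Submodule.mem_top)⟩
  exact Classical.epsilon_spec hex v

end Irreducible

/-! ### The grading of the standard module -/

variable [Finite G] (c : Refl G → ℝ) (τ : Representation ℂ G V)

theorem cherednik_induction {P : Cherednik G c → Prop} (hr : ∀ r : ℂ, P (algebraMap ℂ _ r))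
    (hv : ∀ ξ, P (hVec G c ξ)) (hx : ∀ x, P (hCov G c x)) (hg : ∀ g, P (hGrp G c g))
    (hm : ∀ a b, P a → P b → P (a * b)) (ha : ∀ a b, P a → P b → P (a + b))
    (u : Cherednik G c) : P u := by
  obtain ⟨x, rfl⟩ := RingQuot.mkAlgHom_surjective ℂ (CherRel G c) u
  induction x using FreeAlgebra.induction with
  | grade0 r => exact (AlgHom.commutes (cherMk G c) r) ▸ hr r
  | grade1 g =>
    cases g with
    | vec ξ => exact hv ξ
    | cov x => exact hx x
    | grp g => exact hg g
  | mul a b h1 h2 => exact (map_mul (cherMk G c) a b) ▸ hm _ _ h1 h2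
  | add a b h1 h2 => exact (map_add (cherMk G c) a b) ▸ ha _ _ h1 h2

theorem cherednik_smul_comm (u : Cherednik G c) (r : ℂ) (m : Standard G c τ) :
    u • r • m = r • u • m := by
  rw [← algebraMap_smul (Cherednik G c) r m, ← algebraMap_smul (Cherednik G c) r (u • m), smul_smul,
    smul_smul, Algebra.commutes]

theorem hGrp_smul_standardι (g : G) (v : V) :
    hGrp G c g • standardι G c τ v = standardι G c τ (τ g v) := by
  rw [standardι, ← map_smul, ← sub_eq_zero, standardι, ← map_sub, TensorProduct.smul_tmul',
    smul_eq_mul, mul_one]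
  exact (Submodule.Quotient.mk_eq_zero _).2 (Submodule.subset_span (Or.inl ⟨g, v, rfl⟩))

theorem hVec_smul_standardι (ξ : E) (v : V) : hVec G c ξ • standardι G c τ v = 0 := by
  rw [standardι, ← map_smul, TensorProduct.smul_tmul', smul_eq_mul, mul_one]
  exact (Submodule.Quotient.mk_eq_zero _).2 (Submodule.subset_span (Or.inr ⟨ξ, v, rfl⟩))

/-- `standardι` as a linear map. -/
def standardιₗ : V →ₗ[ℂ] Standard G c τ where
  toFun := standardι G c τ
  map_add' v w := by rw [standardι, TensorProduct.tmul_add, map_add]; rfl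
  map_smul' r v := by
    rw [standardι, TensorProduct.tmul_smul, RingHom.id_apply, standardι, ← algebraMap_smul
      (Cherednik G c) r, map_smul, algebraMap_smul]

variable {G c τ}

theorem hCov_smul_mem_standardDeg {k : ℕ} (x : Module.Dual ℝ E) {m : Standard G c τ}
    (hm : m ∈ standardDeg G c τ k) : hCov G c x • m ∈ standardDeg G c τ (k + 1) := by
  have : standardDeg G c τ k ≤ (standardDeg G c τ (k + 1)).comap
      (Algebra.lsmul ℂ ℂ (Standard G c τ) (hCov G c x)) := by
    rw [standardDeg, Submodule.span_le]
    rintro _ ⟨y, v, rfl⟩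
    refine Submodule.subset_span ⟨Fin.cons x y, v, ?_⟩
    rw [List.ofFn_succ, List.prod_cons, mul_smul]
    simp
  exact this hm

theorem standardDeg_induction {P : ℕ → Standard G c τ → Prop}
    (h0 : ∀ k, P k 0) (hadd : ∀ k m m', P k m → P k m' → P k (m + m'))
    (hs : ∀ k (r : ℂ) m, P k m → P k (r • m)) (hι : ∀ v, P 0 (standardι G c τ v))
    (hx : ∀ k x m, m ∈ standardDeg G c τ k → P k m → P (k + 1) (hCov G c x • m)) :
    ∀ k, ∀ m ∈ standardDeg G c τ k, P k m := by
  intro k m hm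
  have key : ∀ (k : ℕ) (x : Fin k → Module.Dual ℝ E) (v : V),
      P k ((List.ofFn fun i => hCov G c (x i)).prod • standardι G c τ v) := by
    intro k
    induction k with
    | zero => intro x v; simpa using hι v
    | succ k ih =>
      intro x v
      rw [List.ofFn_succ, List.prod_cons, mul_smul]
      exact hx k _ _ (Submodule.subset_span ⟨fun i => x i.succ, v, rfl⟩) (ih _ v)
  induction hm using Submodule.span_induction with
  | mem m hm => obtain ⟨x, v, rfl⟩ := hm; exact key k x v
  | zero => exact h0 k
  | add m m' _ _ h1 h2 => exact hadd k m m' h1 h2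
  | smul r m _ h1 => exact hs k r m h1

theorem standardι_mem_standardDeg (v : V) : standardι G c τ v ∈ standardDeg G c τ 0 :=
  Submodule.subset_span ⟨Fin.elim0, v, by simp⟩

theorem hGrp_smul_mem_standardDeg (g : G) :
    ∀ k, ∀ m ∈ standardDeg G c τ k, hGrp G c g • m ∈ standardDeg G c τ k := by
  refine standardDeg_induction (P := fun k m => hGrp G c g • m ∈ standardDeg G c τ k)
    (fun k => by rw [smul_zero]; exact Submodule.zero_mem _)
    (fun k m m' h1 h2 => by rw [smul_add]; exact Submodule.add_mem _ h1 h2)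
    (fun k r m h => by rw [cherednik_smul_comm]; exact Submodule.smul_mem _ _ h)
    (fun v => by rw [hGrp_smul_standardι]; exact standardι_mem_standardDeg _)
    (fun k x m _ h => ?_)
  rw [← mul_smul, hGrp_mul_hCov, mul_smul]
  exact hCov_smul_mem_standardDeg _ h

/-- [ξ, x] lies in ℂ[G], which preserves degrees, and ξ kills V(τ); so ξ lowers the degree by one.
Degree 0 is stated apart, since there is no degree below it. -/
theorem hVec_smul_standardDeg (ξ : E) : ∀ k, ∀ m ∈ standardDeg G c τ k,
    (k = 0 → hVec G c ξ • m = 0) ∧ ∀ j, k = j + 1 → hVec G c ξ • m ∈ standardDeg G c τ j := by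
  refine standardDeg_induction (fun k => by simp) (fun k m m' h1 h2 => ⟨fun hk => ?_, fun j hj => ?_⟩)
    (fun k r m h => ⟨fun hk => ?_, fun j hj => ?_⟩)
    (fun v => ⟨fun _ => hVec_smul_standardι G c τ ξ v, fun j hj => by omega⟩)
    (fun k x m hm h => ⟨fun hk => by omega, fun j hj => ?_⟩)
  · rw [smul_add, h1.1 hk, h2.1 hk, add_zero]
  · rw [smul_add]; exact Submodule.add_mem _ (h1.2 j hj) (h2.2 j hj)
  · rw [cherednik_smul_comm, h.1 hk, smul_zero]
  · rw [cherednik_smul_comm]; exact Submodule.smul_mem _ _ (h.2 j hj)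
  · obtain rfl : k = j := by omega
    rw [← mul_smul, hVec_mul_hCov, sub_smul, add_smul, mul_smul, smul_assoc, one_smul,
      reflSum_apply, Finset.sum_smul]
    refine Submodule.sub_mem _ (Submodule.add_mem _ ?_ (Submodule.smul_mem _ _ hm))
      (Submodule.sum_mem _ fun s _ => ?_)
    · cases k with
      | zero => rw [h.1 rfl, smul_zero]; exact Submodule.zero_mem _
      | succ k => exact hCov_smul_mem_standardDeg x (h.2 k rfl)
    · rw [smul_assoc]
      exact Submodule.smul_mem _ _ (hGrp_smul_mem_standardDeg s.1 k m hm)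

theorem hVec_smul_eq_zero (ξ : E) {m : Standard G c τ} (hm : m ∈ standardDeg G c τ 0) :
    hVec G c ξ • m = 0 := (hVec_smul_standardDeg ξ 0 m hm).1 rfl

theorem hVec_smul_mem_standardDeg (ξ : E) {k : ℕ} {m : Standard G c τ}
    (hm : m ∈ standardDeg G c τ (k + 1)) : hVec G c ξ • m ∈ standardDeg G c τ k :=
  (hVec_smul_standardDeg ξ (k + 1) m hm).2 k rfl

/-- The sum of the graded pieces is stable under each kind of generator of H_c and contains the
image of V(τ), which generates the module. -/
theorem iSup_standardDeg : ⨆ k, standardDeg G c τ k = ⊤ := by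
  set T := ⨆ k, standardDeg G c τ k with hT
  have red : ∀ u : Cherednik G c, (∀ k, ∀ m ∈ standardDeg G c τ k, u • m ∈ T) →
      ∀ m ∈ T, u • m ∈ T := by
    intro u hu m hm
    have : T ≤ T.comap (Algebra.lsmul ℂ ℂ (Standard G c τ) u) := iSup_le fun k m hm => hu k m hm
    exact this hm
  have hle : ∀ k, standardDeg G c τ k ≤ T := le_iSup _
  have key : ∀ u : Cherednik G c, ∀ m ∈ T, u • m ∈ T := by
    intro u
    induction u using cherednik_induction with
    | hr r => intro m hm; rw [algebraMap_smul]; exact T.smul_mem r hm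
    | hv ξ =>
      refine red _ fun k m hm => ?_
      cases k with
      | zero => rw [hVec_smul_eq_zero ξ hm]; exact T.zero_mem
      | succ k => exact hle k (hVec_smul_mem_standardDeg ξ hm)
    | hx x => exact red _ fun k m hm => hle (k + 1) (hCov_smul_mem_standardDeg x hm)
    | hg g => exact red _ fun k m hm => hle k (hGrp_smul_mem_standardDeg g k m hm)
    | hm a b h1 h2 => intro m hm; rw [mul_smul]; exact h1 _ (h2 _ hm)
    | ha a b h1 h2 => intro m hm; rw [add_smul]; exact T.add_mem (h1 _ hm) (h2 _ hm)
  refine eq_top_iff.2 fun m hm => ?_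
  clear hm
  obtain ⟨y, rfl⟩ := (standardRel G c τ).mkQ_surjective m
  induction y using TensorProduct.induction_on with
  | zero => rw [map_zero]; exact T.zero_mem
  | add a b h1 h2 => rw [map_add]; exact T.add_mem h1 h2
  | tmul u v =>
    have : (standardRel G c τ).mkQ (u ⊗ₜ[ℂ] v) = u • standardι G c τ v := by
      change standardMk G c τ _ = _
      rw [standardι, ← map_smul, TensorProduct.smul_tmul', smul_eq_mul, mul_one]
    rw [this]
    exact key u _ (hle 0 (standardι_mem_standardDeg v))

theorem finiteDimensional_standardDeg [FiniteDimensional ℂ V] {κ : Type*} [Fintype κ]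
    (b : OrthonormalBasis κ ℝ E) (k : ℕ) : FiniteDimensional ℂ (standardDeg G c τ k) := by
  induction k with
  | zero =>
    refine Submodule.finiteDimensional_of_le (S₂ := LinearMap.range (standardιₗ G c τ)) ?_
    rw [standardDeg, Submodule.span_le]
    rintro _ ⟨x, v, rfl⟩
    exact ⟨v, by simp [standardιₗ]⟩
  | succ k ih =>
    let T : Submodule ℂ (Standard G c τ) := ⨆ i : κ, (standardDeg G c τ k).map
      (Algebra.lsmul ℂ ℂ (Standard G c τ) (hCov G c (b.toBasis.coord i)))
    refine Submodule.finiteDimensional_of_le (S₂ := T) ?_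
    rw [standardDeg, Submodule.span_le]
    rintro _ ⟨x, v, rfl⟩
    rw [List.ofFn_succ, List.prod_cons, mul_smul, hCov_eq_sum G c b, Finset.sum_smul]
    refine Submodule.sum_mem _ fun i _ => ?_
    rw [smul_assoc]
    exact T.smul_mem _ (le_iSup (fun i : κ => (standardDeg G c τ k).map
      (Algebra.lsmul ℂ ℂ (Standard G c τ) (hCov G c (b.toBasis.coord i)))) i
      (Submodule.mem_map_of_mem (f := Algebra.lsmul ℂ ℂ (Standard G c τ)
        (hCov G c (b.toBasis.coord i)))
        (Submodule.subset_span ⟨fun i => x i.succ, v, rfl⟩)))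

variable {n : ℕ} (b : OrthonormalBasis (Fin n ⊕ Fin n) ℝ E)

/-- On the image of V(τ) the Euler element vanishes and σ acts by N_c(τ), so the eigenvalue is n -
N_c(τ). Each covector adds 1. -/
theorem opH_smul_standardDeg (hτ : τ.IsIrreducible)
    (hc : ∀ s t : Refl G, IsConj s.1 t.1 → c s = c t) :
    ∀ k, ∀ m ∈ standardDeg G c τ k,
      opH G c b • m = ((k : ℂ) + (n : ℂ) - scalarN G c τ) • m := by
  refine standardDeg_induction (fun k => by simp) (fun k m m' h1 h2 => by
    rw [smul_add, h1, h2, smul_add]) (fun k r m h => by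
    rw [cherednik_smul_comm, h, smul_comm]) (fun v => ?_) (fun k x m _ h => ?_)
  · have h1 : euler G c b • standardι G c τ v = 0 := by
      rw [euler, Finset.sum_smul]
      exact Finset.sum_eq_zero fun i _ => by rw [mul_smul, hVec_smul_standardι, smul_zero]
    have h2 : sigma G c • standardι G c τ v = scalarN G c τ • standardι G c τ v := by
      change _ = _ • standardιₗ G c τ v
      rw [← map_smul, ← sum_refl_smul_eq hτ hc, map_sum, sigma, Finset.sum_smul]
      refine Finset.sum_congr rfl fun s _ => ?_
      rw [map_smul, smul_assoc, hGrp_smul_standardι]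
      rfl
    rw [opH_eq, add_smul, sub_smul, h1, h2, algebraMap_smul]
    push_cast
    module
  · have h1 := superComm_opH G c b (hCov G c x)
    rw [superComm_euler_sub_sigma_hCov] at h1
    have h2 := congrArg (· • m) h1
    simp only [superComm] at h2
    rw [sub_smul, mul_smul, mul_smul, h, cherednik_smul_comm] at h2
    rw [sub_eq_iff_eq_add.1 h2]
    push_cast
    generalize hCov G c x • m = y
    module

end StandardModule

/-! ### Spinors -/

section Spinors

variable {E : Type*} [NormedAddCommGroup E] [InnerProductSpace ℝ E] {n : ℕ}
  {b : OrthonormalBasis (Fin n ⊕ Fin n) ℝ E}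

theorem cl_smul_comm (u : Cl E) (r : ℂ) (p : Spinor b) : u • r • p = r • u • p := by
  rw [← algebraMap_smul (Cl E) r p, ← algebraMap_smul (Cl E) r (u • p), smul_smul,
    smul_smul, Algebra.commutes]

theorem fd_smul_mem_spinorDeg {l : ℕ} (j : Fin n) {p : Spinor b} (hp : p ∈ spinorDeg b l) :
    fd b j • p ∈ spinorDeg b (l + 1) := by
  have : spinorDeg b l ≤ (spinorDeg b (l + 1)).comap (Algebra.lsmul ℂ ℂ (Spinor b) (fd b j)) := by
    rw [spinorDeg, Submodule.span_le]
    rintro _ ⟨y, rfl⟩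
    refine Submodule.subset_span ⟨Fin.cons j y, ?_⟩
    rw [List.ofFn_succ, List.prod_cons, mul_smul]
    simp
  exact this hp

theorem spinorDeg_induction {P : ℕ → Spinor b → Prop}
    (h0 : ∀ l, P l 0) (hadd : ∀ l p q, P l p → P l q → P l (p + q))
    (hs : ∀ l (r : ℂ) p, P l p → P l (r • p)) (hI : P 0 (spinI b))
    (hx : ∀ l j p, p ∈ spinorDeg b l → P l p → P (l + 1) (fd b j • p)) :
    ∀ l, ∀ p ∈ spinorDeg b l, P l p := by
  intro l p hp
  have key : ∀ (l : ℕ) (x : Fin l → Fin n),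
      P l ((List.ofFn fun i => fd b (x i)).prod • spinI b) := by
    intro l
    induction l with
    | zero => intro x; simpa using hI
    | succ l ih =>
      intro x
      rw [List.ofFn_succ, List.prod_cons, mul_smul]
      exact hx l _ _ (Submodule.subset_span ⟨fun i => x i.succ, rfl⟩) (ih _)
  induction hp using Submodule.span_induction with
  | mem m hm => obtain ⟨x, rfl⟩ := hm; exact key l x
  | zero => exact h0 l
  | add m m' _ _ h1 h2 => exact hadd l m m' h1 h2
  | smul r m _ h1 => exact hs l r m h1

theorem spinI_mem_spinorDeg : spinI b ∈ spinorDeg b 0 :=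
  Submodule.subset_span ⟨Fin.elim0, by simp⟩

theorem f_mul_self (j : Fin n) : f b j * f b j = 0 :=
  mul_self_eq_zero_of_superAnti (f_mul_f b j j)

/-- f_j commutes with f_i f_i† for i ≠ j, so it can be moved up to its own factor, where f_j² = 0.
-/
theorem f_mul_spinVac (j : Fin n) : f b j * spinVac b = 0 := by
  have key : ∀ L : List (Fin n), j ∈ L → f b j * (L.map fun i => f b i * fd b i).prod = 0 := by
    intro L
    induction L with
    | nil => intro h; simp at h
    | cons i L ih =>
      intro h
      rw [List.map_cons, List.prod_cons]
      by_cases hij : i = j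
      · subst hij
        rw [← mul_assoc, ← mul_assoc, f_mul_self, zero_mul, zero_mul]
      · have hL : j ∈ L := (List.mem_cons.1 h).resolve_left (Ne.symm hij)
        have h1 := f_mul_f b j i
        have h2 := fd_mul_f b i j
        rw [if_neg hij, zero_smul] at h2
        have h3 : f b j * (f b i * fd b i) = f b i * fd b i * f b j := by
          rw [← mul_assoc, eq_neg_of_add_eq_zero_left h1, mul_assoc (f b i),
            eq_neg_of_add_eq_zero_left h2]
          noncomm_ring
        rw [← mul_assoc, h3, mul_assoc, ih hL, mul_zero]
  have := key (List.finRange n) (List.mem_finRange j)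
  rwa [← List.ofFn_eq_map] at this

theorem f_smul_spinI (j : Fin n) : f b j • spinI b = 0 :=
  Subtype.ext (f_mul_spinVac j)

theorem f_smul_fd_smul (j k : Fin n) (p : Spinor b) :
    f b j • fd b k • p = (if k = j then (1 : ℂ) else 0) • p - fd b k • f b j • p := by
  have h := congrArg (· • p) (fd_mul_f b k j)
  simp only [add_smul, mul_smul, smul_assoc, one_smul] at h
  rw [← h, add_sub_cancel_left]

theorem f_smul_spinorDeg (j : Fin n) : ∀ l, ∀ p ∈ spinorDeg b l,
    (l = 0 → f b j • p = 0) ∧ ∀ i, l = i + 1 → f b j • p ∈ spinorDeg b i := by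
  refine spinorDeg_induction (fun k => by simp) (fun k m m' h1 h2 => ⟨fun hk => ?_, fun j hj => ?_⟩)
    (fun k r m h => ⟨fun hk => ?_, fun j hj => ?_⟩)
    ⟨fun _ => f_smul_spinI j, fun j hj => by omega⟩
    (fun l k p hp h => ⟨fun hk => by omega, fun i hi => ?_⟩)
  · rw [smul_add, h1.1 hk, h2.1 hk, add_zero]
  · rw [smul_add]; exact Submodule.add_mem _ (h1.2 j hj) (h2.2 j hj)
  · rw [cl_smul_comm, h.1 hk, smul_zero]
  · rw [cl_smul_comm]; exact Submodule.smul_mem _ _ (h.2 j hj)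
  · obtain rfl : l = i := by omega
    rw [f_smul_fd_smul]
    refine Submodule.sub_mem _ (Submodule.smul_mem _ _ hp) ?_
    cases l with
    | zero => rw [h.1 rfl, smul_zero]; exact Submodule.zero_mem _
    | succ l => exact fd_smul_mem_spinorDeg k (h.2 l rfl)

theorem cliffordAlgebra_smul_mem (T : Submodule ℂ (Spinor b))
    (hf : ∀ j, ∀ p ∈ T, f b j • p ∈ T) (hfd : ∀ j, ∀ p ∈ T, fd b j • p ∈ T) (u : Cl E) :
    ∀ p ∈ T, u • p ∈ T := by
  induction u using CliffordAlgebra.induction with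
  | algebraMap r => intro p hp; rw [algebraMap_smul]; exact T.smul_mem r hp
  | ι x =>
    intro p hp
    induction x using TensorProduct.induction_on with
    | zero => rw [map_zero, zero_smul]; exact T.zero_mem
    | add x y h1 h2 => rw [map_add, add_smul]; exact T.add_mem h1 h2
    | tmul r v =>
      have h : CliffordAlgebra.ι (quadC E) (r ⊗ₜ[ℝ] v) = r • cl v := by
        rw [cl, ← map_smul, TensorProduct.smul_tmul', smul_eq_mul, mul_one]
      rw [h, smul_assoc, cl_eq_sum b v, add_smul, Finset.sum_smul, Finset.sum_smul]
      refine T.smul_mem _ (T.add_mem (T.sum_mem fun j _ => ?_) (T.sum_mem fun j _ => ?_))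
      · rw [smul_assoc]; exact T.smul_mem _ (hf j p hp)
      · rw [smul_assoc]; exact T.smul_mem _ (hfd j p hp)
  | mul a b h1 h2 => intro p hp; rw [mul_smul]; exact h1 _ (h2 _ hp)
  | add a b h1 h2 => intro p hp; rw [add_smul]; exact T.add_mem (h1 _ hp) (h2 _ hp)

theorem exists_smul_spinI (p : Spinor b) : ∃ u : Cl E, p = u • spinI b := by
  obtain ⟨u, hu⟩ := Submodule.mem_span_singleton.1 (show (p : spinorIdeal b).1 ∈ _ from p.2)
  exact ⟨u, Subtype.ext hu.symm⟩

theorem iSup_spinorDeg : ⨆ l, spinorDeg b l = ⊤ := by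
  set T := ⨆ l, spinorDeg b l with hT
  have hle : ∀ l, spinorDeg b l ≤ T := le_iSup _
  have red : ∀ u : Cl E, (∀ l, ∀ p ∈ spinorDeg b l, u • p ∈ T) → ∀ p ∈ T, u • p ∈ T := by
    intro u hu p hp
    have : T ≤ T.comap (Algebra.lsmul ℂ ℂ (Spinor b) u) := iSup_le fun l p hp => hu l p hp
    exact this hp
  refine eq_top_iff.2 fun p _ => ?_
  obtain ⟨u, rfl⟩ := exists_smul_spinI p
  refine cliffordAlgebra_smul_mem T (fun j => red _ fun l p hp => ?_)
    (fun j => red _ fun l p hp => hle (l + 1) (fd_smul_mem_spinorDeg j hp)) u _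
    (hle 0 spinI_mem_spinorDeg)
  cases l with
  | zero => rw [(f_smul_spinorDeg j 0 p hp).1 rfl]; exact T.zero_mem
  | succ l => exact hle l ((f_smul_spinorDeg j _ p hp).2 l rfl)

/-- Every linear combination of the f_j† squares to zero, so products of them are images of exterior
products, which vanish on repeated vectors. By the pigeonhole principle this forces 𝕊^l = 0 for l >
n. -/
theorem fd_list_prod_eq_zero {l : ℕ} (x : Fin l → Fin n) (hx : ¬ Function.Injective x) :
    (List.ofFn fun i => fd b (x i)).prod = 0 := by
  let F : (Fin n → ℂ) →ₗ[ℂ] Cl E := Fintype.linearCombination ℂ (fd b)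
  have hF : ∀ v, F v * F v = 0 := fun v => mul_self_eq_zero_of_superAnti <| by
    change (∑ j, v j • fd b j) * (∑ j, v j • fd b j) + (∑ j, v j • fd b j) * (∑ j, v j • fd b j) = 0
    rw [Finset.sum_mul_sum]
    nth_rewrite 2 [Finset.sum_comm]
    rw [← Finset.sum_add_distrib]
    refine Finset.sum_eq_zero fun j _ => ?_
    rw [← Finset.sum_add_distrib]
    refine Finset.sum_eq_zero fun k _ => ?_
    rw [smul_mul_smul_comm, smul_mul_smul_comm, mul_comm (v k), ← smul_add, fd_mul_fd, smul_zero]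
  let Λ : ExteriorAlgebra ℂ (Fin n → ℂ) →ₐ[ℂ] Cl E := ExteriorAlgebra.lift ℂ ⟨F, hF⟩
  have h0 := (ExteriorAlgebra.ιMulti ℂ l).map_eq_zero_of_not_injective
    (fun i => (Pi.single (x i) 1 : Fin n → ℂ)) (fun hinj => hx fun i j hij => hinj (by simp [hij]))
  have h1 := congrArg Λ h0
  rw [ExteriorAlgebra.ιMulti_apply, map_list_prod, List.map_ofFn, map_zero] at h1
  rw [← h1]
  congr 2
  funext i
  simp [Λ, F, Fintype.linearCombination_apply]

theorem spinorDeg_eq_bot {l : ℕ} (hl : n < l) : spinorDeg b l = ⊥ := by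
  rw [spinorDeg, Submodule.span_eq_bot]
  rintro _ ⟨x, rfl⟩
  rw [fd_list_prod_eq_zero x fun h => ?_, zero_smul]
  have := Fintype.card_le_of_injective x h
  simp at this
  omega

theorem finiteDimensional_spinorDeg (l : ℕ) : FiniteDimensional ℂ (spinorDeg b l) := by
  refine FiniteDimensional.span_of_finite ℂ ((Set.finite_range fun j : Fin l → Fin n =>
    (List.ofFn fun i => fd b (j i)).prod • spinI b).subset ?_)
  rintro _ ⟨j, rfl⟩
  exact ⟨j, rfl⟩

theorem numberOp_smul_spinorDeg : ∀ l, ∀ p ∈ spinorDeg b l,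
    numberOp b • p = ((l : ℂ) - (n : ℂ) / 2) • p := by
  refine spinorDeg_induction (fun k => by simp) (fun k m m' h1 h2 => by
    rw [smul_add, h1, h2, smul_add]) (fun k r m h => by
    rw [cl_smul_comm, h, smul_comm]) ?_ (fun l j p _ h => ?_)
  · rw [numberOp_eq, sub_smul, Finset.sum_smul, Finset.sum_eq_zero fun j _ => by
      rw [mul_smul, f_smul_spinI, smul_zero], smul_assoc, one_smul]
    push_cast
    module
  · have h2 := congrArg (· • p) (superComm_numberOp_fd b j)
    simp only [superComm] at h2
    rw [sub_smul, mul_smul, mul_smul, h, cl_smul_comm] at h2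
    rw [sub_eq_iff_eq_add.1 h2]
    push_cast
    generalize fd b j • p = y
    module

end Spinors

/-! ### Adjoints with respect to a Hermitian form -/

section Adjoints

variable {K A : Type*} [AddCommGroup K] [Module ℂ K] [Ring A] [Algebra ℂ A]

/-- `u` and `u'` act by adjoint operators. -/
def IsAdjointPair (form : InnerProductSpace.Core ℂ K) (ρ : A →ₐ[ℂ] Module.End ℂ K) (u u' : A) :
    Prop :=
  ∀ x y, form.inner (ρ u x) y = form.inner x (ρ u' y)

namespace IsAdjointPair

variable {form : InnerProductSpace.Core ℂ K} {ρ : A →ₐ[ℂ] Module.End ℂ K} {u u' v v' : A}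

theorem symm (h : IsAdjointPair form ρ u u') : IsAdjointPair form ρ u' u := fun x y => by
  rw [← form.conj_inner_symm, ← h, form.conj_inner_symm]

theorem mul (h : IsAdjointPair form ρ u u') (h' : IsAdjointPair form ρ v v') :
    IsAdjointPair form ρ (u * v) (v' * u') := fun x y => by
  rw [map_mul, map_mul, Module.End.mul_apply, Module.End.mul_apply, h, h']

theorem inner_add_right (x y y' : K) :
    form.inner x (y + y') = form.inner x y + form.inner x y' := by
  rw [← form.conj_inner_symm, form.add_left, map_add, form.conj_inner_symm, form.conj_inner_symm]

theorem inner_smul_right (r : ℂ) (x y : K) : form.inner x (r • y) = r * form.inner x y := by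
  rw [← form.conj_inner_symm, form.smul_left, map_mul, form.conj_inner_symm,
    starRingEnd_self_apply]

theorem add (h : IsAdjointPair form ρ u u') (h' : IsAdjointPair form ρ v v') :
    IsAdjointPair form ρ (u + v) (u' + v') := fun x y => by
  rw [map_add, map_add, LinearMap.add_apply, LinearMap.add_apply, form.add_left, inner_add_right,
    h, h']

theorem smul (h : IsAdjointPair form ρ u u') (r : ℂ) :
    IsAdjointPair form ρ (r • u) (starRingEnd ℂ r • u') := fun x y => by
  rw [map_smul, map_smul, LinearMap.smul_apply, LinearMap.smul_apply, form.smul_left,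
    inner_smul_right, h]

theorem sub (h : IsAdjointPair form ρ u u') (h' : IsAdjointPair form ρ v v') :
    IsAdjointPair form ρ (u - v) (u' - v') := by
  have := h.add (h'.smul (-1))
  simpa [sub_eq_add_neg] using this

theorem sum {κ : Type*} (I : Finset κ) {w w' : κ → A}
    (h : ∀ i, IsAdjointPair form ρ (w i) (w' i)) :
    IsAdjointPair form ρ (∑ i ∈ I, w i) (∑ i ∈ I, w' i) := by
  classical
  induction I using Finset.induction_on with
  | empty =>
    intro x y
    have h1 : form.inner (0 : K) y = 0 := by simpa using form.smul_left 0 y 0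
    have h2 : form.inner x (0 : K) = 0 := by simpa using inner_smul_right (form := form) 0 x 0
    simp [h1, h2]
  | insert i s hi ih => rw [Finset.sum_insert hi, Finset.sum_insert hi]; exact (h i).add ih

end IsAdjointPair

end Adjoints

/-! ### Linear algebra -/

section LinearAlgebra

/-- Modular law: t_i = t_i ⊓ (s_i ⊔ ⨆ t_j) = s_i ⊔ (t_i ⊓ ⨆ t_j) = s_i, the suprema being over j ≠
i. -/
theorem iSupIndep.eq_of_le_of_iSup_eq_top {α κ : Type*} [CompleteLattice α] [IsModularLattice α]
    {s t : κ → α} (ht : iSupIndep t) (hst : ∀ i, s i ≤ t i) (htop : ⨆ i, s i = ⊤) (i : κ) :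
    s i = t i := by
  refine le_antisymm (hst i) ?_
  have h1 : s i ⊔ ⨆ (j) (_ : j ≠ i), t j = ⊤ := by
    rw [eq_top_iff, ← htop]
    refine iSup_le fun j => ?_
    by_cases hj : j = i
    · exact hj ▸ le_sup_left
    · exact (hst j).trans (le_sup_of_le_right (le_iSup₂_of_le j hj le_rfl))
  have h2 : (s i ⊔ ⨆ (j) (_ : j ≠ i), t j) ⊓ t i = s i ⊔ (⨆ (j) (_ : j ≠ i), t j) ⊓ t i :=
    sup_inf_assoc_of_le _ (hst i)
  rw [h1, top_inf_eq, inf_comm, (ht i).eq_bot, sup_bot_eq] at h2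
  exact h2.le

/-- An element of W ⊗ S has unique coefficients in W along a basis of S, and T ⊗ 1 acts on these
coefficients. This identifies ℋ_k ⊗ 𝕊^l with the kernel of E₋ ⊗ 1 in bidegree (k, l). -/
theorem map₂_inf_ker {M Q : Type*} [AddCommGroup M] [Module ℂ M] [AddCommGroup Q] [Module ℂ Q]
    (T : Module.End ℂ M) (W : Submodule ℂ M) (S : Submodule ℂ Q) :
    Submodule.map₂ (TensorProduct.mk ℂ M Q) (W ⊓ LinearMap.ker T) S
      = Submodule.map₂ (TensorProduct.mk ℂ M Q) W S ⊓ LinearMap.ker (T.rTensor Q) := by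
  classical
  refine le_antisymm (Submodule.map₂_le.2 fun m hm q hq => ⟨Submodule.apply_mem_map₂ _ hm.1 hq, ?_⟩)
    ?_
  · have : T m = 0 := hm.2
    simp [this]
  · rintro p ⟨hp, hk⟩
    rw [← TensorProduct.range_mapIncl] at hp
    obtain ⟨p', rfl⟩ := hp
    let β := Module.Basis.ofVectorSpace ℂ S
    obtain ⟨w, rfl⟩ := (TensorProduct.equivFinsuppOfBasisRight (M := W) β).symm.surjective p'
    rw [TensorProduct.equivFinsuppOfBasisRight_symm_apply] at hk ⊢
    -- The vanishing is known in M ⊗ Q and is pulled back to M ⊗ S by flatness, so that the basis of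
    -- S can be used.
    have h0 : w.sum (fun i m => T m ⊗ₜ[ℂ] β i) = 0 := by
      refine Module.Flat.lTensor_preserves_injective_linearMap (M := M) S.subtype
        S.subtype_injective ?_
      rw [map_zero, ← LinearMap.mem_ker.1 hk, Finsupp.sum, Finsupp.sum, map_sum, map_sum, map_sum]
      exact Finset.sum_congr rfl fun i _ => rfl
    let w' := w.mapRange (fun m : W => T m) (by simp)
    have h1 : w' = 0 := by
      refine TensorProduct.sum_tmul_basis_right_eq_zero β w' ?_
      rw [Finsupp.sum_mapRange_index (by simp)]
      exact h0
    rw [Finsupp.sum, map_sum]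
    refine Submodule.sum_mem _ fun i _ => ?_
    refine Submodule.apply_mem_map₂ _ ⟨(w i).2, ?_⟩ (β i).2
    have := DFunLike.congr_fun h1 i
    simpa [w'] using this

end LinearAlgebra

/-! ### Polynomial spinors -/

section PolynomialSpinors

open UGen

variable {E : Type*} [NormedAddCommGroup E] [InnerProductSpace ℝ E]
  {G : Subgroup (E ≃ₗᵢ[ℝ] E)} [Finite G] {c : Refl G → ℝ}
  {n : ℕ} {J : E →ₗ[ℝ] E} {b : OrthonormalBasis (Fin n ⊕ Fin n) ℝ E}
  {V : Type*} [AddCommGroup V] [Module ℂ V] {τ : Representation ℂ G V}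

theorem act_tmul_tmul (u : Cherednik G c) (v : Cl E) (m : Standard G c τ) (p : Spinor b) :
    act G c b τ (u ⊗ₜ v) (m ⊗ₜ p) = (u • m) ⊗ₜ (v • p) := rfl

variable (G c b τ) in
/-- The polynomial spinors of bidegree `(k, l)`. -/
def spinDeg (k l : ℕ) : Submodule ℂ (SpinModule G c b τ) :=
  Submodule.map₂ (TensorProduct.mk ℂ (Standard G c τ) (Spinor b))
    (standardDeg G c τ k) (spinorDeg b l)

theorem iSup_spinDeg : ⨆ kl : ℕ × ℕ, spinDeg G c b τ kl.1 kl.2 = ⊤ := by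
  rw [← TensorProduct.map₂_mk_top_top_eq_top, ← iSup_standardDeg, ← iSup_spinorDeg,
    Submodule.map₂_iSup_left, iSup_prod]
  refine iSup_congr fun k => ?_
  rw [Submodule.map₂_iSup_right]
  rfl

theorem finiteDimensional_spinDeg (hτ : τ.IsIrreducible) (k l : ℕ) :
    FiniteDimensional ℂ (spinDeg G c b τ k l) := by
  have := finiteDimensional_of_isIrreducible hτ
  have h1 := finiteDimensional_standardDeg (c := c) (τ := τ) b k
  have h2 := finiteDimensional_spinorDeg (b := b) l
  exact Module.Finite.iff_fg.2 (Submodule.FG.map₂ _ (Module.Finite.iff_fg.1 h1)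
    (Module.Finite.iff_fg.1 h2))

theorem spinDeg_eq_bot (k : ℕ) {l : ℕ} (hl : n < l) : spinDeg G c b τ k l = ⊥ := by
  rw [spinDeg, spinorDeg_eq_bot hl, Submodule.map₂_bot_right]

theorem harmSpin_eq (k l : ℕ) : harmSpin G c b τ k l
    = spinDeg G c b τ k l ⊓ LinearMap.ker (act G c b τ (realise G c J b Em)) := by
  rw [harmSpin, harm, spinDeg, map₂_inf_ker]
  congr 2
  refine TensorProduct.ext' fun m p => ?_
  change _ = act G c b τ (opEm G c b ⊗ₜ 1) (m ⊗ₜ p)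
  rw [act_tmul_tmul, one_smul]
  rfl

section Action

variable [Module U21 (SpinModule G c b τ)] [IsScalarTower ℂ U21 (SpinModule G c b τ)]
  (hact : ∀ (g : UGen) (p : SpinModule G c b τ), uι g • p = act G c b τ (realise G c J b g) p)
include hact

theorem spinDeg_le_weightSpace (hτ : τ.IsIrreducible)
    (hc : ∀ s t : Refl G, IsConj s.1 t.1 → c s = c t) (k l : ℕ) :
    spinDeg G c b τ k l ≤ weightSpace (SpinModule G c b τ)
      ((n - scalarN G c τ : ℂ) + k) (-(n : ℂ) / 2 + l) := by
  refine Submodule.map₂_le.2 fun m hm p hp => mem_weightSpace.2 ⟨?_, ?_⟩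
  · rw [hact]
    change act G c b τ (opH G c b ⊗ₜ 1) (m ⊗ₜ p) = _ • (m ⊗ₜ p)
    rw [act_tmul_tmul, one_smul, opH_smul_standardDeg b hτ hc k m hm, TensorProduct.smul_tmul']
    congr 2
    ring
  · rw [hact]
    change act G c b τ (1 ⊗ₜ numberOp b) (m ⊗ₜ p) = _ • (m ⊗ₜ p)
    rw [act_tmul_tmul, one_smul, numberOp_smul_spinorDeg l p hp, TensorProduct.tmul_smul]
    congr 1
    ring

/-- The pieces of bidegree (k, l) lie in weight spaces that are independent, and they already span
the module, so none of these weight spaces can be larger. -/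
theorem weightSpace_eq_spinDeg (hτ : τ.IsIrreducible)
    (hc : ∀ s t : Refl G, IsConj s.1 t.1 → c s = c t) (k l : ℕ) :
    weightSpace (SpinModule G c b τ) ((n - scalarN G c τ : ℂ) + k) (-(n : ℂ) / 2 + l)
      = spinDeg G c b τ k l := by
  -- The single operator H + iZ₂ separates all bidegrees, since k + il determines k and l;
  -- independence is then that of the eigenspaces of one operator.
  let X : Module.End ℂ (SpinModule G c b τ) := uAct _ (uι H) + Complex.I • uAct _ (uι Z2)
  let μ : ℕ × ℕ → ℂ := fun kl =>
    ((n - scalarN G c τ : ℂ) + kl.1) + Complex.I * (-(n : ℂ) / 2 + kl.2)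
  have hμ : Function.Injective μ := fun x y hxy => by
    have h : ((x.1 : ℂ) + Complex.I * x.2) = y.1 + Complex.I * y.2 := by
      simp only [μ] at hxy; linear_combination hxy
    have h1 := congrArg Complex.re h
    have h2 := congrArg Complex.im h
    simp at h1 h2
    exact Prod.ext h1 h2
  have hind := X.eigenspaces_iSupIndep.comp hμ
  have hle : ∀ kl : ℕ × ℕ, weightSpace (SpinModule G c b τ)
      ((n - scalarN G c τ : ℂ) + kl.1) (-(n : ℂ) / 2 + kl.2) ≤ X.eigenspace (μ kl) := by
    intro kl p hp
    rw [mem_weightSpace] at hp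
    rw [Module.End.mem_eigenspace_iff]
    change uι H • p + Complex.I • uι Z2 • p = _
    rw [hp.1, hp.2, smul_smul, ← add_smul]
  exact (iSupIndep.eq_of_le_of_iSup_eq_top (hind.mono hle)
    (fun kl => spinDeg_le_weightSpace hact hτ hc kl.1 kl.2) iSup_spinDeg (k, l)).symm

/-- Harmonicity is implied by the other conditions, because -2E₋ = {F₋, F̄₋}. The multiplicity space
is thereby described by the action of gl(2|1) alone. -/
theorem mem_monog_iff (hτ : τ.IsIrreducible)
    (hc : ∀ s t : Refl G, IsConj s.1 t.1 → c s = c t) (k l : ℕ) (ν : ℂ) (p : SpinModule G c b τ) :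
    p ∈ monog G c J b τ k l ν ↔ p ∈ weightSpace (SpinModule G c b τ)
      ((n - scalarN G c τ : ℂ) + k) (-(n : ℂ) / 2 + l) ∧ uι Z1 • p = ν • p ∧ uι Fm • p = 0 ∧
        uι Fbm • p = 0 := by
  rw [weightSpace_eq_spinDeg hact hτ hc, monog, harmSpin_eq (J := J), Submodule.mem_inf,
    Submodule.mem_inf, Submodule.mem_inf, Submodule.mem_inf, LinearMap.mem_ker, LinearMap.mem_ker,
    LinearMap.mem_ker, Module.End.mem_eigenspace_iff, ← hact, ← hact, ← hact, ← hact]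
  constructor
  · rintro ⟨⟨⟨⟨h1, -⟩, h2⟩, h3⟩, h4⟩
    exact ⟨h1, h2, h3, h4⟩
  · rintro ⟨h1, h2, h3, h4⟩
    refine ⟨⟨⟨⟨h1, ?_⟩, h2⟩, h3⟩, h4⟩
    rw [uι_Em_smul, h3, h4]
    simp

theorem isLowest_of_mem_monog (hτ : τ.IsIrreducible)
    (hc : ∀ s t : Refl G, IsConj s.1 t.1 → c s = c t) {k l : ℕ} {ν : ℂ} {p : SpinModule G c b τ}
    (hp : p ∈ monog G c J b τ k l ν) :
    IsLowest ((k : ℂ) + (n : ℂ) - scalarN G c τ) ν ((l : ℂ) - (n : ℂ) / 2) p := by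
  obtain ⟨h1, h2, h3, h4⟩ := (mem_monog_iff hact hτ hc k l ν p).1 hp
  obtain ⟨h5, h6⟩ := mem_weightSpace.1 h1
  refine ⟨h3, h4, ?_, h2, ?_⟩
  · rw [h5]; congr 1; ring
  · rw [h6]; congr 1; ring

end Action

theorem act_realise_comm {r : HC G c} (hr : r ∈ centR G c J b) (g : UGen)
    (p : SpinModule G c b τ) : act G c b τ (realise G c J b g) (act G c b τ r p)
      = act G c b τ r (act G c b τ (realise G c J b g) p) := by
  have h := (Subalgebra.mem_centralizer_iff ℂ).1 hr _ ⟨g, rfl⟩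
  rw [← Module.End.mul_apply, ← map_mul, h, map_mul, Module.End.mul_apply]

/-! ### Adjoints of the odd generators and of Z₂ -/

section Adjoint

variable {form : InnerProductSpace.Core ℂ (SpinModule G c b τ)}
  (hvec : ∀ ξ : E, IsAdjointPair form (act G c b τ) (hVec G c ξ ⊗ₜ[ℂ] 1)
    (hCov G c (innerₗ E ξ) ⊗ₜ[ℂ] 1))
  (hcl : ∀ v : E, IsAdjointPair form (act G c b τ) (1 ⊗ₜ[ℂ] cl v) (1 ⊗ₜ[ℂ] cl v))

section Vec

include hvec

theorem isAdjointPair_coord (i : Fin n ⊕ Fin n) : IsAdjointPair form (act G c b τ)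
    (hCov G c (b.toBasis.coord i) ⊗ₜ[ℂ] 1) (hVec G c (b i) ⊗ₜ[ℂ] 1) := by
  have h : innerₗ E (b i) = b.toBasis.coord i :=
    LinearMap.ext fun v => (coord_apply_eq_inner b i v).symm
  exact h ▸ (hvec (b i)).symm

/-- (x_j + iy_j)* = ξ_j - iη_j = 2ζ_j; hence the factor 2 in F₋ and F̄₋. -/
theorem isAdjointPair_z (j : Fin n) : IsAdjointPair form (act G c b τ)
    (z G c b j ⊗ₜ[ℂ] 1) ((2 : ℂ) • (zeta G c b j ⊗ₜ[ℂ] 1)) := by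
  have h := (isAdjointPair_coord hvec (.inl j)).add
    ((isAdjointPair_coord hvec (.inr j)).smul Complex.I)
  convert h using 1
  · rw [z, TensorProduct.add_tmul, TensorProduct.smul_tmul']
  · rw [zeta, ← TensorProduct.smul_tmul', smul_smul, Complex.conj_I, TensorProduct.sub_tmul,
      ← TensorProduct.smul_tmul', neg_smul, ← sub_eq_add_neg]
    norm_num

theorem isAdjointPair_zb (j : Fin n) : IsAdjointPair form (act G c b τ)
    (zb G c b j ⊗ₜ[ℂ] 1) ((2 : ℂ) • (zetab G c b j ⊗ₜ[ℂ] 1)) := by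
  have h := (isAdjointPair_coord hvec (.inl j)).sub
    ((isAdjointPair_coord hvec (.inr j)).smul Complex.I)
  convert h using 1
  · rw [zb, TensorProduct.sub_tmul, TensorProduct.smul_tmul']
  · rw [zetab, ← TensorProduct.smul_tmul', smul_smul, Complex.conj_I, TensorProduct.add_tmul,
      ← TensorProduct.smul_tmul', neg_smul, sub_neg_eq_add]
    norm_num

end Vec

theorem conj_one_half : starRingEnd ℂ (1 / 2) = 1 / 2 := by
  rw [map_div₀, map_one, map_ofNat]

include hcl in
theorem isAdjointPair_f (j : Fin n) : IsAdjointPair form (act G c b τ)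
    (1 ⊗ₜ[ℂ] f b j) (1 ⊗ₜ[ℂ] fd b j) := by
  have h := ((hcl (b (.inl j))).sub ((hcl (b (.inr j))).smul Complex.I)).smul (1 / 2)
  convert h using 1
  · rw [f, TensorProduct.tmul_smul, TensorProduct.tmul_sub, TensorProduct.tmul_smul]
  · rw [fd, TensorProduct.tmul_smul, TensorProduct.tmul_add, TensorProduct.tmul_smul,
      Complex.conj_I, neg_smul, sub_neg_eq_add, conj_one_half]

include hcl in
theorem isAdjointPair_Z2 : IsAdjointPair form (act G c b τ)
    (realise G c J b Z2) (realise G c J b Z2) := by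
  have h := ((IsAdjointPair.sum Finset.univ fun j => ((isAdjointPair_f hcl j).symm.mul
    (isAdjointPair_f hcl j)).sub ((isAdjointPair_f hcl j).mul (isAdjointPair_f hcl j).symm))).smul
    (1 / 2)
  have e : realise G c J b Z2 = (1 / 2 : ℂ) • ∑ j, ((1 : Cherednik G c) ⊗ₜ[ℂ] fd b j * 1 ⊗ₜ[ℂ] f b j
      - 1 ⊗ₜ[ℂ] f b j * 1 ⊗ₜ[ℂ] fd b j) := by
    rw [realise, TensorProduct.tmul_smul, TensorProduct.tmul_sum]
    simp only [Algebra.TensorProduct.tmul_mul_tmul, one_mul, TensorProduct.tmul_sub]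
  rw [conj_one_half] at h
  rwa [← e] at h

include hvec hcl

theorem isAdjointPair_Fp : IsAdjointPair form (act G c b τ)
    (realise G c J b Fp) (realise G c J b Fbm) := by
  have h := IsAdjointPair.sum Finset.univ fun j =>
    (isAdjointPair_zb hvec j).mul (isAdjointPair_f hcl j).symm
  convert h using 1
  · simp [realise]
  · simp [realise, Finset.smul_sum]

theorem isAdjointPair_Fbp : IsAdjointPair form (act G c b τ)
    (realise G c J b Fbp) (realise G c J b Fm) := by
  have h := IsAdjointPair.sum Finset.univ fun j =>
    (isAdjointPair_z hvec j).mul (isAdjointPair_f hcl j)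
  convert h using 1
  · simp [realise]
  · simp [realise, Finset.smul_sum]

end Adjoint

end PolynomialSpinors

end SpinorHowe

end

/-! ### The joint decomposition of K_c(τ) -/

open SpinorHowe in
theorem mainTheorem7 {n : ℕ} {E : Type*} [NormedAddCommGroup E] [InnerProductSpace ℝ E]
    (G : Subgroup (E ≃ₗᵢ[ℝ] E)) [Finite G] (hG : IsReflectionGroup G)
    (c : Refl G → ℝ) (hc : ∀ s t : Refl G, IsConj s.1 t.1 → c s = c t)
    (J : E →ₗ[ℝ] E) (b : OrthonormalBasis (Fin n ⊕ Fin n) ℝ E)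
    (hJ : ∀ j : Fin n, J (b (.inl j)) = -b (.inr j) ∧ J (b (.inr j)) = b (.inl j))
    {V : Type*} [AddCommGroup V] [Module ℂ V] (τ : Representation ℂ G V) (hτ : τ.IsIrreducible)
    (hK : IsUnitarisable G c b τ) :
    (∀ i : SpinIndex G c J b τ, i.M ≠ ⊥ → IsSimpleModule U21 i.L) ∧
    (∀ i : SpinIndex G c J b τ, ∀ r ∈ centR G c J b, ∀ m ∈ i.M, act G c b τ r m ∈ i.M) ∧
    ∃ Φ : (⨁ i : SpinIndex G c J b τ, i.M ⊗[ℂ] i.L) ≃ₗ[ℂ] SpinModule G c b τ,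
      (∀ (i : SpinIndex G c J b τ) (m : i.M), Φ (i.incl m i.vec) = m) ∧
      (∀ (g : UGen) (i : SpinIndex G c J b τ) (m : i.M) (v : i.L),
        Φ (i.incl m (uι g • v)) = act G c b τ (realise G c J b g) (Φ (i.incl m v))) ∧
      (∀ r ∈ centR G c J b, ∀ (i : SpinIndex G c J b τ) (m m' : i.M) (v : i.L),
        (m' : SpinModule G c b τ) = act G c b τ r m →
          Φ (i.incl m' v) = act G c b τ r (Φ (i.incl m v))) := by
  have hrel := superRelations_realise G c hJ
  let ρ : U21 →ₐ[ℂ] Module.End ℂ (SpinModule G c b τ) := (act G c b τ).comp hrel.lift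
  let _ : Module U21 (SpinModule G c b τ) := Module.compHom _ ρ.toRingHom
  have _ : IsScalarTower ℂ U21 (SpinModule G c b τ) := ⟨fun r u x => by
    change ρ (r • u) x = r • ρ u x
    rw [map_smul]; rfl⟩
  have hact : ∀ (g : UGen) (p : SpinModule G c b τ),
      uι g • p = act G c b τ (realise G c J b g) p := fun g p => by
    change act G c b τ (hrel.lift (uι g)) p = _
    rw [hrel.lift_uι]
  have hcomm : ∀ r ∈ centR G c J b, ∀ (u : U21) (p : SpinModule G c b τ),
      u • act G c b τ r p = act G c b τ r (u • p) := by
    intro r hr u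
    induction u using u21_induction with
    | hc a => intro p; rw [algebraMap_u21_smul, algebraMap_u21_smul, map_smul]
    | hg g => intro p; rw [hact, hact, act_realise_comm hr]
    | hm a b ha hb => intro p; rw [mul_smul, mul_smul, hb, ha]
    | ha a b ha hb => intro p; rw [add_smul, add_smul, ha, hb, map_add]
  obtain ⟨form, hvec, -, hcl⟩ := hK
  have hM : ∀ i : SpinIndex G c J b τ, ∀ m ∈ i.M, IsLowest _ _ _ m :=
    fun i m hm => isLowest_of_mem_monog hact hτ hc hm
  have hws := weightSpace_eq_spinDeg hact hτ hc
  obtain ⟨hsimple, Φ, hΦ⟩ := exists_isotypic_decomposition form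
    (fun x y => by rw [hact, hact]; exact isAdjointPair_Fp hvec hcl x y)
    (fun x y => by rw [hact, hact]; exact isAdjointPair_Fbp hvec hcl x y)
    (fun x y => by rw [hact, hact]; exact isAdjointPair_Z2 hcl x y)
    hM
    -- The weights under H, Z₂ and Z₁ determine k, l and ν, hence the index.
    (fun i j hij => by
      by_contra! h
      obtain ⟨h1, h2, h3⟩ := h
      refine hij ?_
      obtain ⟨li, ki, νi, _⟩ := i
      obtain ⟨lj, kj, νj, _⟩ := j
      have hk : ki = kj := by simpa using h1
      have hl : li = lj := Fin.ext (by simpa using h3)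
      have hν : νi = νj := h2
      subst hk hl hν
      rfl)
    (fun k l => by rw [hws]; exact finiteDimensional_spinDeg hτ k l)
    (by simp only [hws]; exact iSup_spinDeg)
    (fun i => by
      have := finiteDimensional_spinDeg (c := c) (b := b) hτ i.k i.l
      refine Submodule.finiteDimensional_of_le (S₂ := spinDeg G c b τ i.k i.l) fun m hm => ?_
      rw [← hws]
      exact ((mem_monog_iff hact hτ hc _ _ _ m).1 hm).1)
    -- A nonzero lowest weight vector names its own index: l ≤ n because 𝕊^l vanishes beyond n, and
    -- μ is an eigenvalue of Z₁ on the harmonic spinors because x is a harmonic eigenvector.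
    (fun k l μ x hx h1 h2 h3 => by
      by_cases h0 : x = 0
      · rw [h0]; exact Submodule.zero_mem _
      have hmem := (mem_monog_iff hact hτ hc k l μ x).2 ⟨hx, h1, h2, h3⟩
      have hl : l < n + 1 := by
        by_contra hl
        rw [hws, spinDeg_eq_bot k (by omega), Submodule.mem_bot] at hx
        exact h0 hx
      have hμ : μ ∈ eigenSet G c J b τ k l := ⟨x, hmem.1.1.1, h0, by rw [← hact, h1]⟩
      exact Submodule.mem_iSup_of_mem (⟨⟨l, hl⟩, k, μ, hμ⟩ : SpinIndex G c J b τ) hmem)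
  refine ⟨hsimple, fun i r hr m hm => ?_, Φ, fun i m => ?_, fun g i m v => ?_,
    fun r hr i m m' v hm => ?_⟩
  -- All the conditions defining the multiplicity space are equations in the action of `U21`, with
  -- which the centraliser commutes.
  · obtain ⟨h1, h2, h3, h4⟩ := (mem_monog_iff hact hτ hc _ _ _ m).1 hm
    obtain ⟨h5, h6⟩ := mem_weightSpace.1 h1
    refine (mem_monog_iff hact hτ hc _ _ _ _).2 ⟨mem_weightSpace.2 ⟨?_, ?_⟩, ?_, ?_, ?_⟩
    · rw [hcomm r hr, h5, map_smul]
    · rw [hcomm r hr, h6, map_smul]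
    · rw [hcomm r hr, h2, map_smul]
    · rw [hcomm r hr, h3, map_zero]
    · rw [hcomm r hr, h4, map_zero]
  · have := hΦ i m 1
    rwa [one_smul, one_smul] at this
  -- Both intertwining properties are read off from m ⊗ uv₀ ↦ um, as every vector of L has the form
  -- uv₀.
  · obtain ⟨u, rfl⟩ := exists_smul_lowestVec v
    rw [← hact, ← mul_smul]
    refine (hΦ i m _).trans ?_
    rw [mul_smul]
    exact congrArg _ (hΦ i m u).symm
  · obtain ⟨u, rfl⟩ := exists_smul_lowestVec v
    refine (hΦ i m' u).trans ?_
    rw [hm, hcomm r hr]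
    exact congrArg _ (hΦ i m u).symm
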